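/- \textbf{Theorem 1.} \textsc{Weighted Coloring} on forests is $\mathsf{W}[1]$-hard when parameterized by the size of a largest connected component. Here a \emph{proper coloring} of a finite simple graph $G$ is a partition $c=(S_1,\dots,S_r)$ of $V(G)$ into stable sets, for some $r$. For a weight function $w$ on $V(G)$ with positive values, the weight of $c$ is $w(c)=\sum_{i=1}^{r}\max_{v\in S_i}w(v)$, and the \emph{weighted chromatic number} $\sigma(G,w)$ is the minimum of $w(c)$ over all proper colorings $c$ of $G$, the number of colors being arbitrary. An instance of \textsc{Weighted Coloring} on forests consists of a forest $G$ with positive rational vertex weights $w$ (written in binary) and a rational number $M\ge 0$; the question is whether $\sigma(G,w)\le M$. The parameter is the number of vertices of a largest connected component of $G$. An instance of a parameterized problem is a pair $I=(x,k)$ of a word $x$ over a finite alphabet and a natural number $k$, the \emph{parameter}. A \emph{parameterized reduction} from a parameterized problem $P$ to a parameterized problem $Q$ is an algorithm (a Turing machine) which, for some computable functions $f,g$ and some constant $c$, given an instance $I=(x,k)$ of $P$, computes within $f(k)\cdot|I|^{c}$ steps an instance $(x',k')$ of $Q$ with $k'\le g(k)$ that is a yes-instance of $Q$ if and only if $I$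 is a yes-instance of $P$. A parameterized problem is \emph{$\mathsf{W}[1]$-hard} if it admits a parameterized reduction from \textsc{Independent Set} parameterized by the size of the solution: given a graph $H$ and the parameter $k$, is there a set of at least $k$ pairwise non-adjacent vertices of $H$? -/

import Mathlib

open scoped NNReal

/-! ### Parameterized problems and parameterized reductions -/

/-- A parameterized problem over a finite alphabet `Sym`. Its instances are mathematical objects;
`code I = (x, k)` is the word `x` over `Sym` that describes the instance `I`, together with its
parameter `k`. As a subset of `Sym* × ℕ`, the problem is `{code I | Yes I}`. -/
structure ParamProblem where
  /-- the instances -/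
  Inst : Type
  /-- the alphabet -/
  Sym : Type
  symFintype : Fintype Sym
  /-- the word and the parameter of an instance -/
  code : Inst → List Sym × ℕ
  code_injective : Function.Injective code
  /-- the instances whose answer is yes -/
  Yes : Inst → Prop

namespace ParamProblem

/-- The parameter of an instance. -/
def param (P : ParamProblem) (I : P.Inst) : ℕ := (P.code I).2

/-- The pair `(x, k)` as one word: `k` in unary, with `none` as the unary digit, and then `x`. -/
def word (P : ParamProblem) (I : P.Inst) : List (Option P.Sym) :=
  List.replicate (P.code I).2 none ++ (P.code I).1.map some

/-- The size `|I| = |x| + k` of an instance `I = (x, k)`. -/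
def size (P : ParamProblem) (I : P.Inst) : ℕ := (P.word I).length

/-- A parameterized reduction from `P` to `Q`: a Turing machine which, given an instance `I` of
`P` with parameter `k`, computes within `f k * |I| ^ c` steps an equivalent instance of `Q`
whose parameter is at most `g k`; here `f` and `g` are computable and `c` is a constant. -/
def Reduces (P Q : ParamProblem) : Prop :=
  ∃ (F : P.Inst → Q.Inst) (f g : ℕ → ℕ) (c : ℕ)
    (T : Turing.TM2ComputableAux (Option P.Sym) (Option Q.Sym)),
    Computable f ∧ Computable g ∧
    (∀ I, P.Yes I ↔ Q.Yes (F I)) ∧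
    (∀ I, Q.param (F I) ≤ g (P.param I)) ∧
    ∀ I, Nonempty (Turing.TM2OutputsInTime T.tm
      ((P.word I).map T.inputAlphabet.symm)
      (some ((Q.word (F I)).map T.outputAlphabet.symm))
      (f (P.param I) * P.size I ^ c))

end ParamProblem

/-! ### Words describing sequences of bit strings -/

/-- A sequence of bit strings as one word: every bit string is followed by the end mark `none`. -/
def encodeTokens (L : List (List Bool)) : List (Option Bool) :=
  L.flatMap fun t => t.map some ++ [none]

theorem encodeToken_append_inj : ∀ {a b : List Bool} {r s : List (Option Bool)},
    a.map some ++ none :: r = b.map some ++ none :: s → a = b ∧ r = s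
  | [], [], _, _, h => by simpa using h
  | [], _ :: _, _, _, h => by simp at h
  | _ :: _, [], _, _, h => by simp at h
  | x :: a, y :: b, r, s, h => by
    simp only [List.map_cons, List.cons_append, List.cons.injEq, Option.some.injEq] at h
    obtain ⟨h1, h2⟩ := encodeToken_append_inj h.2
    exact ⟨by rw [h.1, h1], h2⟩

theorem encodeTokens_injective : Function.Injective encodeTokens := by
  intro L
  induction L with
  | nil =>
    intro M h
    cases M with
    | nil => rfl
    | cons b M => simp [encodeTokens] at h
  | cons a L ih =>
    intro M h
    cases M with
    | nil => simp [encodeTokens] at h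
    | cons b M =>
      simp only [encodeTokens, List.flatMap_cons, List.append_assoc, List.singleton_append] at h
      obtain ⟨h1, h2⟩ := encodeToken_append_inj h
      rw [h1, ih h2]

/-- Unary notation. -/
def unary (n : ℕ) : List Bool := List.replicate n true

theorem unary_injective : Function.Injective unary := fun a b h => by
  simpa [unary] using congrArg List.length h

/-- Binary notation of a nonnegative rational number in lowest terms: numerator, denominator. -/
def ratTokens (q : ℚ≥0) : List (List Bool) :=
  [Computability.encodeNat q.num, Computability.encodeNat q.den]

theorem ratTokens_injective : Function.Injective ratTokens := fun p q h => by
  simp only [ratTokens, List.cons.injEq, and_true] at h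
  have e : Function.Injective Computability.encodeNat :=
    Function.LeftInverse.injective Computability.decode_encodeNat
  exact NNRat.ext_num_den (e h.1) (e h.2)

theorem flatMap_tokens_injective {α : Type} (f : α → List (List Bool)) (m : ℕ)
    (hlen : ∀ a, (f a).length = m + 1) (hf : Function.Injective f) :
    Function.Injective fun L : List α => L.flatMap f := by
  intro L
  induction L with
  | nil =>
    intro M h
    cases M with
    | nil => rfl
    | cons b M =>
      have := congrArg List.length h
      simp [hlen] at this
      omega
  | cons a L ih =>
    intro M h
    cases M with
    | nil =>
      have := congrArg List.length h
      simp [hlen] at this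
    | cons b M =>
      simp only [List.flatMap_cons] at h
      obtain ⟨h1, h2⟩ := List.append_inj h (by rw [hlen, hlen])
      rw [hf h1, ih h2]

/-! ### Finite graphs as input data -/

/-- A finite simple graph on the vertices `0, …, n - 1`, given by a list of its edges. -/
structure GraphData where
  n : ℕ
  edges : List (Fin n × Fin n)
  loopless : ∀ e ∈ edges, e.1 ≠ e.2

/-- The graph that is described by the data. -/
def GraphData.graph (D : GraphData) : SimpleGraph (Fin D.n) :=
  SimpleGraph.fromRel fun u v => (u, v) ∈ D.edges

/-- The list of edges, vertices being written in unary. -/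
def edgeTokens {n : ℕ} (E : List (Fin n × Fin n)) : List (List Bool) :=
  E.flatMap fun e => [unary e.1, unary e.2]

theorem edgeTokens_injective {n : ℕ} : Function.Injective (edgeTokens (n := n)) :=
  flatMap_tokens_injective _ 1 (fun _ => rfl) fun a b h => by
    simp only [List.cons.injEq, and_true] at h
    exact Prod.ext (Fin.ext (unary_injective h.1)) (Fin.ext (unary_injective h.2))

/-! ### Independent Set, parameterized by the size of the solution -/

/-- The code of `(D, k)`: the word lists the number of vertices in unary and the edges;
the parameter is `k`. -/
def indepSetCode (I : GraphData × ℕ) : List (Option Bool) × ℕ :=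
  (encodeTokens (unary I.1.n :: edgeTokens I.1.edges), I.2)

theorem indepSetCode_injective : Function.Injective indepSetCode := by
  rintro ⟨⟨n, E, hE⟩, k⟩ ⟨⟨n', E', hE'⟩, k'⟩ h
  simp only [indepSetCode, Prod.mk.injEq] at h
  obtain ⟨h, rfl⟩ := h
  have h := encodeTokens_injective h
  simp only [List.cons.injEq] at h
  obtain ⟨h1, h2⟩ := h
  obtain rfl := unary_injective h1
  obtain rfl := edgeTokens_injective h2
  rfl

/-- Independent Set: given a graph and `k`, is there an independent set with at least `k`
vertices? The parameter is `k`. -/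
def independentSetProblem : ParamProblem where
  Inst := GraphData × ℕ
  Sym := Option Bool
  symFintype := inferInstance
  code := indepSetCode
  code_injective := indepSetCode_injective
  Yes I := ∃ S : Finset (Fin I.1.n), I.2 ≤ S.card ∧ I.1.graph.IsIndepSet (S : Set (Fin I.1.n))

/-- A parameterized problem is `W[1]`-hard if Independent Set, parameterized by the size of the
solution, has a parameterized reduction to it. -/
def ParamProblem.IsW1Hard (P : ParamProblem) : Prop :=
  independentSetProblem.Reduces P

/-! ### Weighted colorings -/

section WeightedColoring

variable {V : Type} [Fintype V]

/-- The weight of the color `i` of a coloring: the largest weight of a vertex of color `i`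
(zero if the color is not used). -/
noncomputable def colorWeight (G : SimpleGraph V) (w : V → ℝ≥0) {k : ℕ} (c : G.Coloring (Fin k))
    (i : Fin k) : ℝ≥0 :=
  (Finset.univ.filter fun v => c v = i).sup w

/-- The weight of a coloring: the sum of the weights of its colors. -/
noncomputable def coloringWeight (G : SimpleGraph V) (w : V → ℝ≥0) {k : ℕ}
    (c : G.Coloring (Fin k)) : ℝ≥0 :=
  ∑ i, colorWeight G w c i

/-- The weighted chromatic number `σ(G, w)`: the minimum weight of a proper coloring of `G`, the
number of colors being arbitrary. -/
noncomputable def weightedChromaticNumber (G : SimpleGraph V) (w : V → ℝ≥0) : ℝ≥0 :=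
  sInf {x | ∃ (k : ℕ) (c : G.Coloring (Fin k)), coloringWeight G w c = x}

/-- The number of vertices of a largest connected component of `G`. -/
noncomputable def largestComponentSize (G : SimpleGraph V) : ℕ :=
  Finset.univ.sup fun v : V => (G.connectedComponentMk v).supp.ncard

end WeightedColoring

/-! ### Weighted Coloring on forests -/

/-- An instance of Weighted Coloring on forests: a forest with positive rational vertex weights,
and a rational number `bound`. -/
structure WeightedForestData extends GraphData where
  weight : Fin n → ℚ≥0
  weight_pos : ∀ v, 0 < weight v
  isForest : toGraphData.graph.IsAcyclic
  bound : ℚ≥0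

/-- The code of an instance: the word lists the number of vertices in unary, the bound and the
weights of the vertices in binary, and the edges; the parameter is the number of vertices of a
largest connected component. -/
noncomputable def weightedForestCode (I : WeightedForestData) : List (Option Bool) × ℕ :=
  (encodeTokens (unary I.n :: (ratTokens I.bound ++
      ((List.ofFn I.weight).flatMap ratTokens ++ edgeTokens I.edges))),
    largestComponentSize I.graph)

theorem weightedForestCode_injective : Function.Injective weightedForestCode := by
  rintro ⟨⟨n, E, hE⟩, w, hw, hF, M⟩ ⟨⟨n', E', hE'⟩, w', hw', hF', M'⟩ h
  have h := encodeTokens_injective (congrArg Prod.fst h)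
  simp only [List.cons.injEq] at h
  obtain ⟨h1, h⟩ := h
  obtain rfl := unary_injective h1
  obtain ⟨h2, h5⟩ := List.append_inj h rfl
  obtain rfl := ratTokens_injective h2
  obtain ⟨h3, h4⟩ := List.append_inj h5 (by simp [ratTokens]; rfl)
  obtain rfl := List.ofFn_injective
    (flatMap_tokens_injective ratTokens 1 (fun _ => rfl) ratTokens_injective h3)
  obtain rfl := edgeTokens_injective h4
  rfl

/-- Weighted Coloring on forests: given a weighted forest `(G, w)` and a number `M`, is
`σ(G, w) ≤ M`? The parameter is the number of vertices of a largest connected component of `G`. -/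
noncomputable def weightedForestColoringProblem : ParamProblem where
  Inst := WeightedForestData
  Sym := Option Bool
  symFintype := inferInstance
  code := weightedForestCode
  code_injective := weightedForestCode_injective
  Yes I := weightedChromaticNumber I.graph (fun v => (I.weight v : ℝ≥0)) ≤ (I.bound : ℝ≥0)

/-! The forest has one tree for each clause of a constraint system. The trees are disjoint and
interact only through the weights of the colors, which they share. Put d = `slots k` = 2k + 6 and U
= `base k n`. The bound is (2^d - 1)U plus a slack (4^(k+1) - 1)n + 2, which is less than U. The
trees contain vertices of weight 2^j U, for all j < d, that are forced to have pairwise distinct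
colors. Hence a coloring within the bound has exactly d heavy colors, the color j weighing at least
2^j U, and it can only choose how to spread the slack over them. Let s(y) be the slack of the color
y < 2k + 2, measured in units of 3·4^(y/2).

Some clauses say s(2i+1) + s(2i) ≥ n for i ≤ k. The units 3·4^i add up to 4^(k+1) - 1, and a surplus
of one in some pair costs at least 3 while only 2 is to spare, so equality holds. Thus s(2i+1) is a
number between 0 and n. Other clauses make it positive for i < k, so that it names the vertex
s(2i+1) - 1 of the given graph, and say that the k vertices are distinct and not adjacent. By the
equality, s(2i+1) ≤ x means n - x ≤ s(2i), so upper bounds are lower bounds in disguise, and "the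
pair i does not name x or the pair j does not name y" is a disjunction of four lower bounds on s.

The root of the tree of a clause weighs 2^(d-4) U and can only take one of the four spare colors
d-4, ..., d-1. Four of its children stand for the literals. The children of the literal vertex m are
forced to use all heavy colors except the spare color d-4+m and the color y of the literal. Its own
weight is 2^y U plus the threshold in units, so y is open to it only if the literal is true. If all
literals are false, these four vertices occupy all spare colors and none is left for the root. If
the literal m is true, the root takes d-4+m. Forcing works from the top: a vertex of weight 2^j U in
slot j has children in the slots j+1, ..., d-1 that are already forced, which leaves the color j. So
the depth, and with it the size of a tree, depends on k only. `Gadget.exists_slack` and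
`Gadget.exists_choice` lead from a coloring to an independent set; `Gadget.exists_slack_of_choice`,
`Gadget.color_ne_child`, `Gadget.weight_le_cap` and `Gadget.sum_cap` lead back.

For the Turing machine, programs of a structured language `Cmd` are compiled to machines with the
same number of steps (`Cmd.Exec.steps`). On top of it, programs of a loop language `Stm` run in time
polynomial in any bound X ≥ 2 for their variables (`Stm.runs`). The only two quantities that are not
polynomial in the input are powers of two depending on k. They are supplied as variables, and X =
`width k` · |I| gives the time `width k ^ K` · |I| ^ K. -/

/-! ### A structured language on stacks and its Turing machines -/

/-- The alphabet of all words and stacks. -/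
abbrev Symb := Option (Option Bool)

/-- Structured programs on stacks indexed by natural numbers. The command `loop r final body` pops
the stack `r` and runs `body` on the popped symbols until the stack is empty or a symbol with
`final` has been popped. The command `branch r body other` pops once. -/
inductive Cmd
  | skip
  | push (r : ℕ) (a : Symb)
  | seq (p q : Cmd)
  | loop (r : ℕ) (final : Symb → Bool) (body : Symb → Cmd)
  | branch (r : ℕ) (body : Symb → Cmd) (other : Cmd)

/-- The contents of all stacks. -/
abbrev Store := ℕ → List Symb

namespace Cmd

open Function (update)

/-- `Exec p s t n`: the program `p` transforms `s` into `t` within `n` steps. -/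
inductive Exec : Cmd → Store → Store → ℕ → Prop
  | skip (s) : Exec skip s s 1
  | push (r a s) : Exec (push r a) s (update s r (a :: s r)) 1
  | seq {p q s t u m n} (h₁ : Exec p s t m) (h₂ : Exec q t u n) : Exec (seq p q) s u (m + n)
  | loop_nil {r final body s} (h : s r = []) : Exec (loop r final body) s s 1
  | loop_final {r final body s a l} (h : s r = a :: l) (ha : final a = true) :
      Exec (loop r final body) s (update s r l) 1
  | loop_step {r final body s a l t u m n} (h : s r = a :: l) (ha : final a = false)
      (h₁ : Exec (body a) (update s r l) t m) (h₂ : Exec (loop r final body) t u n) :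
      Exec (loop r final body) s u (1 + m + n)
  | branch_nil {r body other s t n} (h : s r = []) (h₁ : Exec other s t n) :
      Exec (branch r body other) s t (1 + n)
  | branch_cons {r body other s a l t n} (h : s r = a :: l)
      (h₁ : Exec (body a) (update s r l) t n) : Exec (branch r body other) s t (1 + n)

/-- The labels of the machine of a program. -/
def Lab : Cmd → Type
  | skip => Unit
  | push _ _ => Unit
  | seq p q => Lab p ⊕ Lab q
  | loop _ _ body => Option (Σ a, Lab (body a))
  | branch _ body other => Option ((Σ a, Lab (body a)) ⊕ Lab other)

instance labFinite : ∀ p : Cmd, Finite p.Lab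
  | skip => inferInstanceAs (Finite Unit)
  | push _ _ => inferInstanceAs (Finite Unit)
  | seq p q =>
    have := labFinite p
    have := labFinite q
    inferInstanceAs (Finite (p.Lab ⊕ q.Lab))
  | loop _ _ body =>
    have := fun a => labFinite (body a)
    inferInstanceAs (Finite (Option (Σ a, Lab (body a))))
  | branch _ body other =>
    have := fun a => labFinite (body a)
    have := labFinite other
    inferInstanceAs (Finite (Option ((Σ a, Lab (body a)) ⊕ Lab other)))

/-- The first label of a program. -/
def start : (p : Cmd) → p.Lab
  | skip => ()
  | push _ _ => ()
  | seq p _ => Sum.inl p.start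
  | loop _ _ _ => (none : Option (Sigma _))
  | branch _ _ _ => (none : Option (Sigma _ ⊕ Lab _))

/-- The statements of machines with `L` stacks. -/
abbrev MStmt (L : ℕ) (Λ : Type) := Turing.TM2.Stmt (fun _ : Fin L => Symb) Λ (Option Symb)

/-- The statement at a label of a program. -/
def code (L : ℕ) [NeZero L] {Λ : Type} : (p : Cmd) → (p.Lab → Λ) → Λ → p.Lab → MStmt L Λ
  | skip, _, exit, _ => .goto fun _ => exit
  | push r a, _, exit, _ => .push (Fin.ofNat L r) (fun _ => a) (.goto fun _ => exit)
  | seq p q, ι, exit, l =>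
    match l with
    | Sum.inl l => code L p (fun l => ι (Sum.inl l)) (ι (Sum.inr q.start)) l
    | Sum.inr l => code L q (fun l => ι (Sum.inr l)) exit l
  | loop r final body, ι, exit, l =>
    match l with
    | none => .pop (Fin.ofNat L r) (fun _ x => x) (.goto fun v =>
        match v with
        | none => exit
        | some a => if final a then exit else ι (some ⟨a, (body a).start⟩))
    | some ⟨a, l⟩ => code L (body a) (fun l => ι (some ⟨a, l⟩))
        (ι (none : Option (Σ a, Lab (body a)))) l
  | branch r body other, ι, exit, l =>
    match l with
    | none => .pop (Fin.ofNat L r) (fun _ x => x) (.goto fun v =>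
        match v with
        | none => ι (some (Sum.inr other.start))
        | some a => ι (some (Sum.inl ⟨a, (body a).start⟩)))
    | some (Sum.inl ⟨a, l⟩) => code L (body a) (fun l => ι (some (Sum.inl ⟨a, l⟩))) exit l
    | some (Sum.inr l) => code L other (fun l => ι (some (Sum.inr l))) exit l

/-- All stacks of a program have indices below `L`. -/
def Below (L : ℕ) : Cmd → Prop
  | skip => True
  | push r _ => r < L
  | seq p q => Below L p ∧ Below L q
  | loop r _ body => r < L ∧ ∀ a, Below L (body a)
  | branch r body other => r < L ∧ (∀ a, Below L (body a)) ∧ Below L other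

theorem Below.mono {L L' : ℕ} (hL : L ≤ L') : ∀ {p : Cmd}, p.Below L → p.Below L'
  | skip, _ => trivial
  | push _ _, h => lt_of_lt_of_le h hL
  | seq _ _, h => ⟨h.1.mono hL, h.2.mono hL⟩
  | loop _ _ _, h => ⟨lt_of_lt_of_le h.1 hL, fun a => (h.2 a).mono hL⟩
  | branch _ _ _, h => ⟨lt_of_lt_of_le h.1 hL, fun a => (h.2.1 a).mono hL, h.2.2.mono hL⟩

theorem exists_below : ∀ p : Cmd, ∃ L, p.Below L
  | skip => ⟨0, trivial⟩
  | push r _ => ⟨r + 1, Nat.lt_succ_self r⟩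
  | seq p q =>
    let ⟨L, h⟩ := exists_below p
    let ⟨L', h'⟩ := exists_below q
    ⟨max L L', h.mono (le_max_left _ _), h'.mono (le_max_right _ _)⟩
  | loop r _ body => by
    choose L h using fun a => exists_below (body a)
    exact ⟨max (r + 1) (Finset.univ.sup L), lt_max_of_lt_left (Nat.lt_succ_self r), fun a =>
      (h a).mono (le_trans (Finset.le_sup (Finset.mem_univ a)) (le_max_right _ _))⟩
  | branch r body other => by
    choose L h using fun a => exists_below (body a)
    obtain ⟨L', h'⟩ := exists_below other
    exact ⟨max (max (r + 1) L') (Finset.univ.sup L),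
      lt_max_of_lt_left (lt_max_of_lt_left (Nat.lt_succ_self r)), fun a =>
      (h a).mono (le_trans (Finset.le_sup (Finset.mem_univ a)) (le_max_right _ _)),
      h'.mono (le_trans (le_max_right _ _) (le_max_left _ _))⟩

/-- The first `L` stacks. -/
def restr (L : ℕ) (s : Store) : Fin L → List Symb := fun i => s i

theorem restr_ofNat {L : ℕ} [NeZero L] (s : Store) {r : ℕ} (hr : r < L) :
    restr L s (Fin.ofNat L r) = s r := by
  simp [restr, Nat.mod_eq_of_lt hr]

theorem update_restr {L : ℕ} [NeZero L] (s : Store) {r : ℕ} (hr : r < L) (l : List Symb) :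
    update (restr L s) (Fin.ofNat L r) l = restr L (update s r l) := by
  funext i
  have : i = Fin.ofNat L r ↔ (i : ℕ) = r := by
    rw [Fin.ext_iff]; simp [Nat.mod_eq_of_lt hr]
  simp only [restr, Function.update_apply, this]

/-- Iterated steps of a machine. -/
def Steps {L : ℕ} {Λ : Type} (M : Λ → MStmt L Λ) (n : ℕ)
    (c c' : Turing.TM2.Cfg (fun _ : Fin L => Symb) Λ (Option Symb)) : Prop :=
  (flip bind (Turing.TM2.step M))^[n] (some c) = some c'

theorem Steps.trans {L : ℕ} {Λ : Type} {M : Λ → MStmt L Λ} {m n : ℕ}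
    {c c' c'' : Turing.TM2.Cfg (fun _ : Fin L => Symb) Λ (Option Symb)}
    (h : Steps M m c c') (h' : Steps M n c' c'') : Steps M (m + n) c c'' := by
  unfold Steps at *
  rw [Nat.add_comm, Function.iterate_add_apply, h, h']

theorem Steps.one {L : ℕ} {Λ : Type} {M : Λ → MStmt L Λ} {l : Λ} {v : Option Symb}
    {S : Fin L → List Symb} {c : Turing.TM2.Cfg (fun _ : Fin L => Symb) Λ (Option Symb)}
    (h : Turing.TM2.stepAux (M l) v S = c) : Steps M 1 ⟨some l, v, S⟩ c := by
  subst h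
  rfl

/-- The embedding `ι` of the labels and the label `exit` are arbitrary, so the induction hypotheses
apply to subprograms sitting inside a larger machine. The internal state `v` is arbitrary as well:
it is only read directly after a pop, which overwrites it. -/
theorem Exec.steps {L : ℕ} [NeZero L] {p : Cmd} {s t : Store} {n : ℕ} (h : Exec p s t n) :
    ∀ {Λ : Type} (M : Λ → MStmt L Λ) (ι : p.Lab → Λ) (exit : Λ)
      (_ : ∀ l, M (ι l) = code L p ι exit l) (_ : p.Below L) (v : Option Symb),
      ∃ v', Steps M n ⟨some (ι p.start), v, restr L s⟩ ⟨some exit, v', restr L t⟩ := by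
  induction h with
  | skip s =>
    intro Λ M ι exit hM hb v
    exact ⟨v, Steps.one (by rw [hM]; rfl)⟩
  | push r a s =>
    intro Λ M ι exit hM hb v
    refine ⟨v, Steps.one ?_⟩
    rw [hM]
    simp only [code, Turing.TM2.stepAux]
    rw [restr_ofNat s hb, update_restr s hb]
  | seq h₁ h₂ ih₁ ih₂ =>
    intro Λ M ι exit hM hb v
    obtain ⟨v₁, h₁⟩ := ih₁ M (fun l => ι (Sum.inl l)) _ (fun l => hM (Sum.inl l)) hb.1 v
    obtain ⟨v₂, h₂⟩ := ih₂ M (fun l => ι (Sum.inr l)) _ (fun l => hM (Sum.inr l)) hb.2 v₁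
    exact ⟨v₂, h₁.trans h₂⟩
  | @loop_nil r final body s h =>
    intro Λ M ι exit hM hb v
    refine ⟨none, Steps.one ?_⟩
    rw [hM]
    simp only [code, start, Turing.TM2.stepAux]
    have hs : update s r [] = s := by rw [← h, Function.update_eq_self]
    rw [restr_ofNat s hb.1, update_restr s hb.1, h]
    simp [hs]
  | @loop_final r final body s a l h ha =>
    intro Λ M ι exit hM hb v
    refine ⟨some a, Steps.one ?_⟩
    rw [hM]
    simp only [code, start, Turing.TM2.stepAux]
    rw [restr_ofNat s hb.1, update_restr s hb.1, h]
    simp [ha]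
  | @loop_step r final body s a l t u m n h ha h₁ h₂ ih₁ ih₂ =>
    intro Λ M ι exit hM hb v
    obtain ⟨v₁, h₁⟩ := ih₁ M (fun l => ι (some ⟨a, l⟩)) _ (fun l => hM (some ⟨a, l⟩)) (hb.2 a)
      (some a)
    obtain ⟨v₂, h₂⟩ := ih₂ M ι exit hM hb v₁
    refine ⟨v₂, Steps.trans (Steps.trans (Steps.one ?_) h₁) h₂⟩
    rw [hM]
    simp only [code, start, Turing.TM2.stepAux]
    rw [restr_ofNat s hb.1, update_restr s hb.1, h]
    simp [ha]
  | @branch_nil r body other s t n h h₁ ih₁ =>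
    intro Λ M ι exit hM hb v
    obtain ⟨v₁, h₁⟩ := ih₁ M (fun l => ι (some (Sum.inr l))) _
      (fun l => hM (some (Sum.inr l))) hb.2.2 none
    refine ⟨v₁, Steps.trans (Steps.one ?_) h₁⟩
    rw [hM]
    simp only [code, start, Turing.TM2.stepAux]
    have hs : update s r [] = s := by rw [← h, Function.update_eq_self]
    rw [restr_ofNat s hb.1, update_restr s hb.1, h]
    simp [hs]
  | @branch_cons r body other s a l t n h h₁ ih₁ =>
    intro Λ M ι exit hM hb v
    obtain ⟨v₁, h₁⟩ := ih₁ M (fun l => ι (some (Sum.inl ⟨a, l⟩))) _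
      (fun l => hM (some (Sum.inl ⟨a, l⟩))) (hb.2.1 a) (some a)
    refine ⟨v₁, Steps.trans (Steps.one ?_) h₁⟩
    rw [hM]
    simp only [code, start, Turing.TM2.stepAux]
    rw [restr_ofNat s hb.1, update_restr s hb.1, h]
    simp

/-- The Turing machine of a program: the input is on the stack `0`, the output on the
stack `2`. -/
noncomputable def machine (p : Cmd) (L : ℕ) : Turing.FinTM2 where
  K := Fin (L + 3)
  k₀ := 0
  k₁ := 2
  Γ _ := Symb
  Λ := Option p.Lab
  main := some p.start
  ΛFin := Fintype.ofFinite _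
  σ := Option Symb
  initialState := none
  m l := match l with
    | none => .load (fun _ => none) .halt
    | some l => code (L + 3) p some none l

/-- The machine of a program, with its alphabets. -/
noncomputable def computer (p : Cmd) (L : ℕ) : Turing.TM2ComputableAux Symb Symb where
  tm := p.machine L
  inputAlphabet := Equiv.refl _
  outputAlphabet := Equiv.refl _

/-- The store with `l` on the stack `r`, all other stacks being empty. -/
def single (r : ℕ) (l : List Symb) : Store := fun i => if i = r then l else []

/-- The additional step is the one at the label `none`. It resets the internal state, since
`Turing.haltList` prescribes the initial state, and also empty stacks apart from the output. Three
stacks are added to `L` so that the stacks `0` and `2` exist in any case. -/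
theorem computer_outputs {p : Cmd} {L : ℕ} (hL : p.Below L) {x y : List Symb} {n N : ℕ}
    (h : Exec p (single 0 x) (single 2 y) n) (hN : n + 1 ≤ N) :
    Nonempty (Turing.TM2OutputsInTime (p.computer L).tm
      (x.map (p.computer L).inputAlphabet.symm)
      (some (y.map (p.computer L).outputAlphabet.symm)) N) := by
  obtain ⟨v, hv⟩ := h.steps (L := L + 3) (p.machine L).m some none (fun _ => rfl)
    (hL.mono (by omega)) none
  have h2 := hv.trans (Steps.one (M := (p.machine L).m) (l := none) (v := v)
    (S := restr (L + 3) (single 2 y)) rfl)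
  refine ⟨⟨⟨n + 1, ?_⟩, hN⟩⟩
  have e1 : Turing.initList (p.computer L).tm (x.map (p.computer L).inputAlphabet.symm) =
      ⟨some (some p.start), none, restr (L + 3) (single 0 x)⟩ := by
    refine congrArg (Turing.TM2.Cfg.mk _ _) (funext fun k : Fin (L + 3) => ?_)
    by_cases hk : k = 0
    · subst hk
      exact (dif_pos rfl).trans (x.map_id)
    · refine (dif_neg hk).trans ?_
      exact (if_neg fun h : (k : ℕ) = 0 => hk (Fin.ext h)).symm
  have e2 : Turing.haltList (p.computer L).tm (y.map (p.computer L).outputAlphabet.symm) =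
      ⟨none, none, restr (L + 3) (single 2 y)⟩ := by
    refine congrArg (Turing.TM2.Cfg.mk _ _) (funext fun k : Fin (L + 3) => ?_)
    by_cases hk : k = 2
    · subst hk
      exact (dif_pos rfl).trans (y.map_id)
    · refine (dif_neg hk).trans ?_
      exact (if_neg fun h : (k : ℕ) = 2 => hk (Fin.ext h)).symm
  rw [e1, Option.map_some, e2]
  exact h2

end Cmd

/-! ### Basic stack commands and their running times. -/

namespace Cmd

open Function (update)

/-- `Runs p s t N`: the program `p` transforms `s` into `t` within at most `N` steps. -/
def Runs (p : Cmd) (s t : Store) (N : ℕ) : Prop := ∃ n ≤ N, Exec p s t n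

theorem Runs.mono {p : Cmd} {s t : Store} {M N : ℕ} (h : Runs p s t M) (hMN : M ≤ N) :
    Runs p s t N :=
  let ⟨n, hn, h⟩ := h
  ⟨n, hn.trans hMN, h⟩

theorem Runs.congr {p : Cmd} {s t t' : Store} {M N : ℕ} (h : Runs p s t M) (ht : t = t')
    (hMN : M ≤ N) : Runs p s t' N :=
  ht ▸ h.mono hMN

theorem Runs.seq {p q : Cmd} {s t u : Store} {M N : ℕ} (h₁ : Runs p s t M) (h₂ : Runs q t u N) :
    Runs (seq p q) s u (M + N) :=
  let ⟨m, hm, h₁⟩ := h₁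
  let ⟨n, hn, h₂⟩ := h₂
  ⟨m + n, by omega, h₁.seq h₂⟩

theorem runs_skip (s : Store) : Runs skip s s 1 := ⟨1, le_rfl, .skip s⟩

theorem runs_push (r : ℕ) (a : Symb) (s : Store) : Runs (push r a) s (update s r (a :: s r)) 1 :=
  ⟨1, le_rfl, .push r a s⟩

theorem runs_branch_nil {r : ℕ} {body : Symb → Cmd} {other : Cmd} {s t : Store} {N : ℕ}
    (h : s r = []) (h₁ : Runs other s t N) : Runs (branch r body other) s t (1 + N) :=
  let ⟨n, hn, h₁⟩ := h₁
  ⟨1 + n, by omega, .branch_nil h h₁⟩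

theorem runs_branch_cons {r : ℕ} {body : Symb → Cmd} {other : Cmd} {s t : Store} {N : ℕ} {a : Symb}
    {l : List Symb} (h : s r = a :: l) (h₁ : Runs (body a) (update s r l) t N) :
    Runs (branch r body other) s t (1 + N) :=
  let ⟨n, hn, h₁⟩ := h₁
  ⟨1 + n, by omega, .branch_cons h h₁⟩

/-- `F i` is the store before round `i`. The symbols `rest` remain for the last call of the loop, so
both ways of leaving it, by an empty stack and by a final symbol, are instances. -/
theorem runs_loop {r : ℕ} {final : Symb → Bool} {body : Symb → Cmd} {t : Store} {c N : ℕ}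
    (rest : List Symb) : ∀ (l : List Symb) (F : ℕ → Store)
    (_ : ∀ i ≤ l.length, F i r = l.drop i ++ rest)
    (_ : ∀ (i : ℕ) (h : i < l.length), final l[i] = false ∧
      Runs (body l[i]) (update (F i) r (l.drop (i + 1) ++ rest)) (F (i + 1)) c)
    (_ : Runs (loop r final body) (F l.length) t N),
    Runs (loop r final body) (F 0) t (l.length * (c + 1) + N)
  | [], F, _, _, h => by simpa using h
  | a :: l, F, hF, hs, h => by
    obtain ⟨ha, m, hm, h₁⟩ := hs 0 (by simp)
    obtain ⟨n, hn, h₂⟩ := runs_loop rest l (fun i => F (i + 1))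
      (fun i hi => by simpa using hF (i + 1) (by simpa using hi))
      (fun i hi => by
        have := hs (i + 1) (by simpa using hi)
        rwa [List.getElem_cons_succ] at this) h
    refine ⟨1 + m + n, ?_, .loop_step (by simpa using hF 0 (by simp)) ha h₁ h₂⟩
    simp only [List.length_cons]
    linarith

theorem runs_loop_all {r : ℕ} {final : Symb → Bool} {body : Symb → Cmd} {c : ℕ}
    (l : List Symb) (F : ℕ → Store) (hF : ∀ i ≤ l.length, F i r = l.drop i)
    (hs : ∀ (i : ℕ) (h : i < l.length), final l[i] = false ∧
      Runs (body l[i]) (update (F i) r (l.drop (i + 1))) (F (i + 1)) c) :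
    Runs (loop r final body) (F 0) (F l.length) (l.length * (c + 1) + 1) := by
  refine runs_loop [] l F (by simpa using hF) (by simpa using hs) ⟨1, le_rfl, .loop_nil ?_⟩
  simpa using hF l.length le_rfl

theorem runs_loop_until {r : ℕ} {final : Symb → Bool} {body : Symb → Cmd} {c : ℕ} {a : Symb}
    (rest : List Symb) (l : List Symb) (F : ℕ → Store)
    (hF : ∀ i ≤ l.length, F i r = l.drop i ++ a :: rest) (ha : final a = true)
    (hs : ∀ (i : ℕ) (h : i < l.length), final l[i] = false ∧
      Runs (body l[i]) (update (F i) r (l.drop (i + 1) ++ a :: rest)) (F (i + 1)) c) :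
    Runs (loop r final body) (F 0) (update (F l.length) r rest) (l.length * (c + 1) + 1) :=
  runs_loop (a :: rest) l F hF hs
    ⟨1, le_rfl, .loop_final (by simpa using hF l.length le_rfl) ha⟩

/-- The unary digit. -/
abbrev tally : Symb := some (some true)

/-- The number `n` as a stack. -/
abbrev tl (n : ℕ) : List Symb := List.replicate n tally

/-- Pop everything from a stack and run `p` after each pop. -/
def forEach (r : ℕ) (p : Cmd) : Cmd := loop r (fun _ => false) fun _ => p

theorem runs_forEach {r : ℕ} {p : Cmd} {c n : ℕ} (F : ℕ → Store)
    (hF : ∀ i ≤ n, F i r = tl (n - i))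
    (hs : ∀ i < n, Runs p (update (F i) r (tl (n - (i + 1)))) (F (i + 1)) c) :
    Runs (forEach r p) (F 0) (F n) (n * (c + 1) + 1) := by
  have := runs_loop_all (r := r) (final := fun _ => false) (body := fun _ => p) (c := c) (tl n) F
    (by simpa using hF) (by simpa using hs)
  simpa [forEach] using this

/-- Empty a stack. -/
def clear (r : ℕ) : Cmd := forEach r skip

theorem runs_clear (r : ℕ) (s : Store) :
    Runs (clear r) s (update s r []) ((s r).length * 2 + 1) := by
  have := runs_loop_all (r := r) (final := fun _ => false) (body := fun _ => skip) (c := 1) (s r)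
    (fun i => update s r ((s r).drop i)) (by simp) (fun i hi => ⟨rfl, by
      simpa using runs_skip _⟩)
  simpa [clear, forEach] using this

/-- Move a stack onto another one. -/
def move (r d : ℕ) : Cmd := loop r (fun _ => false) fun a => push d a

theorem runs_move {r d : ℕ} (hrd : r ≠ d) (s : Store) :
    Runs (move r d) s (update (update s r []) d ((s r).reverse ++ s d))
      ((s r).length * 2 + 1) := by
  have := runs_loop_all (r := r) (final := fun _ => false) (body := fun a => push d a) (c := 1) (s r)
    (fun i => update (update s r ((s r).drop i)) d (((s r).take i).reverse ++ s d))
    (fun i hi => by simp [hrd]) (fun i hi => ⟨rfl, by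
      refine (runs_push d _ _).congr ?_ le_rfl
      have e : ((s r).take (i + 1)).reverse = (s r)[i] :: ((s r).take i).reverse := by
        rw [List.take_succ_eq_append_getElem hi, List.reverse_append]; rfl
      funext j
      simp only [Function.update_apply, e]
      clear e
      split_ifs <;> simp_all⟩)
  simpa [move] using this

/-- Move a stack onto another one, and push a unary digit on a third one for each symbol. -/
def moveCount (r t d : ℕ) : Cmd :=
  loop r (fun _ => false) fun a => seq (push t a) (push d tally)

theorem runs_moveCount {r t d : ℕ} (hrt : r ≠ t) (hrd : r ≠ d) (htd : t ≠ d) (s : Store) :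
    Runs (moveCount r t d) s (update (update (update s r []) t ((s r).reverse ++ s t)) d
      (tl (s r).length ++ s d)) ((s r).length * 3 + 1) := by
  have := runs_loop_all (r := r) (final := fun _ => false)
    (body := fun a => seq (push t a) (push d tally)) (c := 2) (s r)
    (fun i => update (update (update s r ((s r).drop i)) t (((s r).take i).reverse ++ s t)) d
      (tl i ++ s d))
    (fun i hi => by simp [hrd, hrt]) (fun i hi => ⟨rfl, by
      refine ((runs_push t _ _).seq (runs_push d _ _)).congr ?_ le_rfl
      have e : ((s r).take (i + 1)).reverse = (s r)[i] :: ((s r).take i).reverse := by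
        rw [List.take_succ_eq_append_getElem hi, List.reverse_append]; rfl
      funext j
      simp only [Function.update_apply, e]
      clear e
      split_ifs <;> simp_all [List.replicate_succ]⟩)
  simpa [moveCount] using this

/-- Push a unary digit on `d` for each symbol of `r`; the stack `t` is auxiliary. -/
def count (r t d : ℕ) : Cmd := seq (moveCount r t d) (move t r)

/-- Moving to `t` and back reverses twice and restores `r`. In this way a variable is read without
being destroyed. -/
theorem runs_count {r t d : ℕ} (hrt : r ≠ t) (hrd : r ≠ d) (htd : t ≠ d) (s : Store)
    (ht : s t = []) :
    Runs (count r t d) s (update s d (tl (s r).length ++ s d)) ((s r).length * 5 + 2) := by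
  refine ((runs_moveCount hrt hrd htd s).seq (runs_move (r := t) (d := r) hrt.symm _)).congr ?_ ?_
  · funext j
    simp only [Function.update_apply]
    split_ifs <;> simp_all
  · simp [htd, ht]
    omega

/-- Push `n` unary digits. -/
def pushN (d : ℕ) : ℕ → Cmd
  | 0 => skip
  | n + 1 => seq (push d tally) (pushN d n)

theorem runs_pushN (d : ℕ) : ∀ (n : ℕ) (s : Store),
    Runs (pushN d n) s (update s d (tl n ++ s d)) (n + 1)
  | 0, s => by simpa [pushN] using runs_skip s
  | n + 1, s => by
    refine ((runs_push d _ s).seq (runs_pushN d n _)).congr ?_ (by omega)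
    funext j
    simp only [Function.update_apply, tl, List.replicate_succ']
    split_ifs <;> simp_all

/-- Push a word, its first symbol first. -/
def pushes (d : ℕ) : List Symb → Cmd
  | [] => skip
  | a :: l => seq (push d a) (pushes d l)

theorem runs_pushes (d : ℕ) : ∀ (l : List Symb) (s : Store),
    Runs (pushes d l) s (update s d (l.reverse ++ s d)) (l.length + 1)
  | [], s => by simpa [pushes] using runs_skip s
  | a :: l, s => by
    refine ((runs_push d _ s).seq (runs_pushes d l _)).congr ?_ (by simp; omega)
    funext j
    simp only [Function.update_apply]
    split_ifs <;> simp_all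

/-- Pop one symbol from `r` for each symbol of `t`. -/
def subtract (r t : ℕ) : Cmd := forEach t (branch r (fun _ => skip) skip)

/-- Popping from an empty stack has no effect, which is exactly the truncation of the subtraction in
`ℕ`. -/
theorem runs_subtract {r t a b : ℕ} (hrt : r ≠ t) (s : Store) (hr : s r = tl a) (ht : s t = tl b) :
    Runs (subtract r t) s (update (update s t []) r (tl (a - b))) (b * 3 + 1) := by
  have := runs_forEach (r := t) (p := branch r (fun _ => skip) skip) (c := 2) (n := b)
    (fun i => update (update s t (tl (b - i))) r (tl (a - i)))
    (fun i hi => by simp [Ne.symm hrt]) (fun i hi => by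
      rcases Nat.lt_or_ge i a with hia | hia
      · have e : a - i = (a - (i + 1)) + 1 := by omega
        refine runs_branch_cons (a := tally) (l := tl (a - (i + 1))) (N := 1) ?_ ?_
        · rw [Function.update_of_ne hrt, Function.update_self, e]; rfl
        · refine (runs_skip _).congr ?_ le_rfl
          funext j
          simp only [Function.update_apply]
          split_ifs <;> simp_all
      · refine runs_branch_nil (N := 1) ?_ ?_
        · rw [Function.update_of_ne hrt, Function.update_self]
          simp; omega
        · refine (runs_skip _).congr ?_ le_rfl
          funext j
          have e1 : a - i = 0 := by omega
          have e2 : a - (i + 1) = 0 := by omega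
          simp only [Function.update_apply, e1, e2]
          split_ifs <;> simp_all)
  have e : update (update s t (tl (b - 0))) r (tl (a - 0)) = s := by
    funext j
    simp only [Function.update_apply]
    split_ifs <;> simp_all
  simp only [e] at this
  simpa [subtract, forEach] using this

end Cmd

/-! ### Polynomial bounds -/

/-- The function `f` is bounded by a power on arguments `X ≥ 2`. -/
def PolyBounded (f : ℕ → ℕ) : Prop := ∃ K, ∀ X, 2 ≤ X → f X ≤ X ^ K

namespace PolyBounded

theorem const (n : ℕ) : PolyBounded fun _ => n :=
  ⟨n, fun X hX => (Nat.lt_pow_self (by omega : 1 < X)).le⟩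

theorem id : PolyBounded fun X => X := ⟨1, fun X _ => by simp⟩

theorem pow {f : ℕ → ℕ} (hf : PolyBounded f) (n : ℕ) : PolyBounded fun X => f X ^ n :=
  let ⟨K, hK⟩ := hf
  ⟨K * n, fun X hX => by rw [pow_mul]; exact Nat.pow_le_pow_left (hK X hX) n⟩

theorem mul {f g : ℕ → ℕ} (hf : PolyBounded f) (hg : PolyBounded g) :
    PolyBounded fun X => f X * g X :=
  let ⟨K, hK⟩ := hf
  let ⟨L, hL⟩ := hg
  ⟨K + L, fun X hX => by rw [pow_add]; exact Nat.mul_le_mul (hK X hX) (hL X hX)⟩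

theorem add {f g : ℕ → ℕ} (hf : PolyBounded f) (hg : PolyBounded g) :
    PolyBounded fun X => f X + g X :=
  let ⟨K, hK⟩ := hf
  let ⟨L, hL⟩ := hg
  ⟨K + L + 1, fun X hX => by
    have h1 : X ^ K ≤ X ^ (K + L) := Nat.pow_le_pow_right (by omega) (by omega)
    have h2 : X ^ L ≤ X ^ (K + L) := Nat.pow_le_pow_right (by omega) (by omega)
    have h3 : X ^ (K + L) * 2 ≤ X ^ (K + L) * X := Nat.mul_le_mul_left _ hX
    have := hK X hX
    have := hL X hX
    simp only [pow_succ]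
    omega⟩

end PolyBounded

/-! ### Conversion from unary to binary notation. -/

namespace Cmd

open Function (update)

theorem runs_loop_cons {r : ℕ} {final : Symb → Bool} {body : Symb → Cmd} {s t u : Store} {a : Symb}
    {l : List Symb} {M N : ℕ} (h : s r = a :: l) (ha : final a = false)
    (h₁ : Runs (body a) (update s r l) t M) (h₂ : Runs (loop r final body) t u N) :
    Runs (loop r final body) s u (1 + M + N) :=
  let ⟨m, hm, h₁⟩ := h₁
  let ⟨n, hn, h₂⟩ := h₂
  ⟨1 + m + n, by omega, .loop_step h ha h₁ h₂⟩

theorem runs_loop_nil {r : ℕ} {final : Symb → Bool} {body : Symb → Cmd} {s : Store}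
    (h : s r = []) : Runs (loop r final body) s s 1 :=
  ⟨1, le_rfl, .loop_nil h⟩

/-- Halve the number on the stack `t`, rounding up, with the result on the stack `t + 1` and the
remainder on the stack `t + 2`. -/
def halve (t : ℕ) : Cmd :=
  forEach t (branch t (fun _ => push (t + 1) tally) (seq (push (t + 1) tally) (push (t + 2) tally)))

/-- A round pops twice, once by the loop and once by the branch, so the induction goes from `m` to
`m + 2`. Only a last incomplete round writes a remainder. -/
theorem runs_halve (t : ℕ) : ∀ (m : ℕ) (s : Store), s t = tl m →
    Runs (halve t) s (update (update (update s t []) (t + 1) (tl ((m + 1) / 2) ++ s (t + 1)))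
      (t + 2) (tl (m % 2) ++ s (t + 2))) (m * 4 + 1)
  | 0, s, h => by
    refine (runs_loop_nil (by simpa using h)).congr ?_ le_rfl
    funext j
    simp only [Function.update_apply]
    split_ifs <;> simp_all
  | 1, s, h => by
    refine Runs.congr (runs_loop_cons (l := []) (a := tally) (by simpa using h) rfl
      (runs_branch_nil (by simp) ((runs_push _ _ _).seq (runs_push _ _ _)))
      (runs_loop_nil (by simp))) ?_ (by omega)
    funext j
    simp only [Function.update_apply]
    split_ifs <;> simp_all
  | m + 2, s, h => by
    refine Runs.congr (runs_loop_cons (l := tl (m + 1)) (a := tally) h rfl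
      (runs_branch_cons (l := tl m) (a := tally) (by simp [List.replicate_succ]) (runs_push _ _ _))
      (runs_halve t m _ ?_)) ?_ (by omega)
    · simp
    · have e : (m + 2 + 1) / 2 = (m + 1) / 2 + 1 := by omega
      funext j
      simp only [Function.update_apply, e, Nat.add_mod_right, tl, List.replicate_succ']
      split_ifs <;> simp_all

/-- The digits come with the least significant one first, so repeated halving produces them in the
order of the word. -/
theorem encodeNat_of_pos {n : ℕ} (hn : 0 < n) :
    Computability.encodeNat n = decide (n % 2 = 1) :: Computability.encodeNat (n / 2) := by
  obtain ⟨p, rfl⟩ : ∃ p : PosNum, n = p := by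
    obtain ⟨p, hp⟩ : ∃ p : PosNum, (n : Num) = Num.pos p := by
      cases h : (n : Num) with
      | zero =>
        have := congrArg (fun x : Num => (x : ℕ)) h
        simp at this
        omega
      | pos p => exact ⟨p, rfl⟩
    refine ⟨p, ?_⟩
    have := congrArg (fun x : Num => (x : ℕ)) hp
    simpa using this
  have key : ∀ q : PosNum, Computability.encodeNat (q : ℕ) = Computability.encodePosNum q := by
    intro q
    have : ((q : ℕ) : Num) = Num.pos q := by
      simp
    rw [Computability.encodeNat, this]
    rfl
  cases p with
  | one =>
    rw [key]
    rfl
  | bit0 p =>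
    have h : ((PosNum.bit0 p : PosNum) : ℕ) = 2 * p := by
      rw [PosNum.cast_bit0]; ring
    rw [key, h]
    have h1 : 2 * (p : ℕ) / 2 = p := by omega
    have h2 : 2 * (p : ℕ) % 2 = 0 := by omega
    rw [h1, h2, key]
    rfl
  | bit1 p =>
    have h : ((PosNum.bit1 p : PosNum) : ℕ) = 2 * p + 1 := by
      rw [PosNum.cast_bit1]; ring
    rw [key, h]
    have h1 : (2 * (p : ℕ) + 1) / 2 = p := by omega
    have h2 : (2 * (p : ℕ) + 1) % 2 = 1 := by omega
    rw [h1, h2, key]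
    rfl

/-- The binary notation of a number, as a word over `Symb`. -/
def binWord (n : ℕ) : List Symb := (Computability.encodeNat n).map fun b => some (some b)

theorem binWord_zero : binWord 0 = [] := rfl

theorem binWord_of_pos {n : ℕ} (hn : 0 < n) :
    binWord n = some (some (decide (n % 2 = 1))) :: binWord (n / 2) := by
  rw [binWord, encodeNat_of_pos hn]; rfl

/-- Write the number on the stack `t` in binary onto the stack `1`, emptying the stack `t`. -/
def writeBin (t : ℕ) : Cmd :=
  forEach t (seq (halve t) (seq
    (branch (t + 2) (fun _ => push 1 (some (some false))) (push 1 (some (some true))))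
    (move (t + 1) t)))

/-- The loop itself pops one digit, so `halve` sees `m = n - 1`. Rounding up gives `(m + 1) / 2 = n
/ 2`, and the remainder of `m` is the opposite of the binary digit of `n`; therefore a present
remainder writes `false`. -/
theorem runs_writeBin (t : ℕ) (ht : 1 < t) : ∀ (n : ℕ) (s : Store), s t = tl n →
    s (t + 1) = [] → s (t + 2) = [] →
    Runs (writeBin t) s (update (update s t []) 1 ((binWord n).reverse ++ s 1))
      (n * (6 * n + 10) + 1) := by
  intro n
  induction n using Nat.strong_induction_on with
  | _ n ih =>
    intro s h h1 h2
    rcases Nat.eq_zero_or_pos n with rfl | hn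
    · refine (runs_loop_nil (by simpa using h)).congr ?_ (by omega)
      funext j
      simp only [Function.update_apply]
      split_ifs <;> simp_all [binWord_zero]
    · obtain ⟨m, rfl⟩ : ∃ m, n = m + 1 := ⟨n - 1, by omega⟩
      have hb : Runs (branch (t + 2) (fun _ => push 1 (some (some false)))
          (push 1 (some (some true))))
          (update (update (update (update s t (tl m)) t []) (t + 1)
            (tl ((m + 1) / 2) ++ update s t (tl m) (t + 1)))
            (t + 2) (tl (m % 2) ++ update s t (tl m) (t + 2)))
          (update (update (update s t []) (t + 1) (tl ((m + 1) / 2))) 1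
            (some (some (decide ((m + 1) % 2 = 1))) :: s 1)) 2 := by
        rcases Nat.mod_two_eq_zero_or_one m with hm | hm
        · have hm' : (m + 1) % 2 = 1 := by omega
          refine (runs_branch_nil
            (by rw [Function.update_self, Function.update_of_ne (by omega), h2, hm]; rfl)
            (runs_push _ _ _)).congr ?_ le_rfl
          clear ih
          funext j
          have : ¬ 1 = t := by omega
          simp only [Function.update_apply, hm, hm']
          split_ifs <;> grind
        · have hm' : (m + 1) % 2 = 0 := by omega
          have h0 : ∀ s' : Store, update s' (t + 2) (tl (m % 2) ++ update s t (tl m) (t + 2))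
              (t + 2) = [tally] := fun s' => by
            rw [Function.update_self, Function.update_of_ne (by omega), h2, hm]; rfl
          refine (runs_branch_cons (body := fun _ => push 1 (some (some false))) (h0 _)
            (runs_push _ _ _)).congr ?_ le_rfl
          clear ih
          funext j
          have : ¬ 1 = t := by omega
          simp only [Function.update_apply, hm, hm']
          split_ifs <;> grind
      refine Runs.congr (runs_loop_cons (a := tally) (l := tl m) h rfl
        ((runs_halve t m _ (by simp)).seq (hb.seq (runs_move (by omega) _)))
        (ih ((m + 1) / 2) (by omega) _ ?_ ?_ ?_)) ?_ ?_
      · have h3 : ¬ t = 1 := by omega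
        have h4 : ¬ t = 0 := by omega
        simp [h3, h4]
      · have h4 : ¬ t = 0 := by omega
        simp [Function.update_apply, h4]
      · simp [Function.update_apply, h2]
      · have h3 : ¬ 1 = t := by omega
        rw [binWord_of_pos hn]
        clear ih hb
        funext j
        simp only [Function.update_apply]
        split_ifs <;> grind
      · have h5 : ((update (update (update s t []) (t + 1) (tl ((m + 1) / 2))) 1
            (some (some (decide ((m + 1) % 2 = 1))) :: s 1)) (t + 1)).length = (m + 1) / 2 := by
          have h4 : ¬ t = 0 := by omega
          simp [h4]
        rw [h5]
        have h6 : (m + 1) / 2 ≤ m := by omega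
        have h7 : (m + 1) / 2 * (6 * ((m + 1) / 2) + 10) ≤ m * (6 * m + 10) :=
          Nat.mul_le_mul h6 (by omega)
        nlinarith

end Cmd

/-! ### A loop language -/

/-- Arithmetic expressions. -/
inductive Expr
  | const (n : ℕ)
  | var (i : ℕ)
  | add (e f : Expr)
  | mul (e f : Expr)
  | sub (e f : Expr)

namespace Expr

open Cmd
open Function (update)

/-- The value of an expression. -/
def eval (ρ : ℕ → ℕ) : Expr → ℕ
  | const n => n
  | var i => ρ i
  | add e f => e.eval ρ + f.eval ρ
  | mul e f => e.eval ρ * f.eval ρ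
  | sub e f => e.eval ρ - f.eval ρ

/-- All variables have indices below `v`. -/
def InRange (v : ℕ) : Expr → Prop
  | const _ => True
  | var i => i < v
  | add e f => e.InRange v ∧ f.InRange v
  | mul e f => e.InRange v ∧ f.InRange v
  | sub e f => e.InRange v ∧ f.InRange v

theorem eval_congr {v : ℕ} {ρ ρ' : ℕ → ℕ} (h : ∀ i < v, ρ i = ρ' i) :
    ∀ {e : Expr}, e.InRange v → e.eval ρ = e.eval ρ'
  | const _, _ => rfl
  | var i, hi => h i hi
  | add _ _, he => congrArg₂ (· + ·) (eval_congr h he.1) (eval_congr h he.2)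
  | mul _ _, he => congrArg₂ (· * ·) (eval_congr h he.1) (eval_congr h he.2)
  | sub _ _, he => congrArg₂ (· - ·) (eval_congr h he.1) (eval_congr h he.2)

/-- A program that pushes the value of an expression in unary onto the stack `d`. The variable `i`
is kept on the stack `2 * i + 4`, and the stacks from `δ` on are auxiliary. -/
def cmd : Expr → ℕ → ℕ → Cmd
  | const n, d, _ => pushN d n
  | var i, d, δ => count (2 * i + 4) δ d
  | add e f, d, δ => seq (e.cmd d δ) (f.cmd d δ)
  | mul e f, d, δ => seq (e.cmd δ (δ + 1)) (forEach δ (f.cmd d (δ + 1)))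
  | sub e f, d, δ => seq (e.cmd δ (δ + 1)) (seq (f.cmd (δ + 1) (δ + 2))
      (seq (subtract δ (δ + 1)) (move δ d)))

end Expr

namespace Cmd

open Function (update)

/-- The values of the variables. -/
def val (s : Store) (i : ℕ) : ℕ := (s (2 * i + 4)).length

/-- All stacks from `δ` on are empty. -/
def Clear (δ : ℕ) (s : Store) : Prop := ∀ j, δ ≤ j → s j = []

theorem val_update {v d : ℕ} (hd : 2 * v + 4 ≤ d) (s : Store) (l : List Symb) {i : ℕ} (hi : i < v) :
    val (update s d l) i = val s i := by
  rw [val, val, Function.update_of_ne (by omega)]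

theorem Clear.update {δ d : ℕ} {s : Store} (h : Clear δ s) (hd : d < δ) (l : List Symb) :
    Clear δ (update s d l) := fun j hj => by
  rw [Function.update_of_ne (by omega), h j hj]

theorem Clear.mono {δ δ' : ℕ} {s : Store} (h : Clear δ s) (hd : δ ≤ δ') : Clear δ' s :=
  fun j hj => h j (hd.trans hj)

end Cmd

namespace Expr

open Cmd
open Function (update)

/-- The exponent `K` depends on the expression only, and `X` bounds the variables. The result is put
on top of whatever is on `d`, so a sum needs no further work and a product is a repetition of the
pushes of the second factor. -/
theorem runs {v : ℕ} : ∀ (e : Expr), e.InRange v → ∃ K, ∀ X, 2 ≤ X → ∀ s : Store,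
    (∀ i < v, val s i ≤ X) → e.eval (val s) ≤ X ^ K ∧
      ∀ d δ, 2 * v + 4 ≤ d → d < δ → Clear δ s →
        Runs (e.cmd d δ) s (update s d (tl (e.eval (val s)) ++ s d)) (X ^ K)
  | const n, _ => by
    obtain ⟨K, hK⟩ := PolyBounded.const (n + 1)
    exact ⟨K, fun X hX s _ => ⟨(Nat.le_succ n).trans (hK X hX), fun d δ _ _ _ =>
      (runs_pushN d n s).mono (hK X hX)⟩⟩
  | var i, hi => by
    obtain ⟨K, hK⟩ := (PolyBounded.id.mul (.const 5)).add (.const 2)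
    refine ⟨K, fun X hX s hs => ?_⟩
    have h1 := hs i hi
    have h2 := hK X hX
    simp only at h2
    refine ⟨by simp only [eval]; omega, fun d δ hd hδ hc => ?_⟩
    change i < v at hi
    exact (runs_count (by omega) (by omega) (by omega) s (hc δ le_rfl)).mono (by
      simp only [val] at h1; omega)
  | add e f, h => by
    obtain ⟨K₁, h₁⟩ := e.runs h.1
    obtain ⟨K₂, h₂⟩ := f.runs h.2
    obtain ⟨K, hK⟩ := (PolyBounded.id.pow K₁).add (PolyBounded.id.pow K₂)
    refine ⟨K, fun X hX s hs => ⟨?_, fun d δ hd hδ hc => ?_⟩⟩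
    · exact (Nat.add_le_add (h₁ X hX s hs).1 (h₂ X hX s hs).1).trans (hK X hX)
    · have r₁ := (h₁ X hX s hs).2 d δ hd hδ hc
      set s' := update s d (tl (e.eval (val s)) ++ s d) with hs'
      have hv : ∀ i < v, val s' i = val s i := fun i hi => val_update hd _ _ hi
      have r₂ := (h₂ X hX s' (fun i hi => (hv i hi).trans_le (hs i hi))).2 d δ hd hδ
        (hc.update hδ _)
      refine (r₁.seq r₂).congr ?_ (hK X hX)
      rw [eval_congr hv h.2, hs', Function.update_idem, Function.update_self, eval,
        Nat.add_comm, ← List.append_assoc, ← List.replicate_add]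
  | mul e f, h => by
    obtain ⟨K₁, h₁⟩ := e.runs h.1
    obtain ⟨K₂, h₂⟩ := f.runs h.2
    obtain ⟨K, hK⟩ := (PolyBounded.id.pow K₁).add
      (((PolyBounded.id.pow K₁).mul ((PolyBounded.id.pow K₂).add (.const 1))).add (.const 1))
    refine ⟨K, fun X hX s hs => ⟨?_, fun d δ hd hδ hc => ?_⟩⟩
    · have := Nat.mul_le_mul (h₁ X hX s hs).1 (h₂ X hX s hs).1
      have := hK X hX
      simp only [mul_add] at this
      simp only [eval]
      omega
    · have r₁ := (h₁ X hX s hs).2 δ (δ + 1) (by omega) (by omega) (hc.mono (by omega))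
      have e₁ := (h₁ X hX s hs).1
      set m := e.eval (val s) with hm
      set n := f.eval (val s) with hn
      have r₂ := runs_forEach (r := δ) (p := f.cmd d (δ + 1)) (c := X ^ K₂) (n := m)
        (fun i => update (update s δ (tl (m - i))) d (tl (i * n) ++ s d))
        (fun i hi => by simp [hδ.ne']) (fun i hi => by
          set s' := update (update (update s δ (tl (m - i))) d (tl (i * n) ++ s d)) δ
            (tl (m - (i + 1))) with hs'
          have hv : ∀ i < v, val s' i = val s i := fun i hi => by
            rw [hs', val_update (by omega) _ _ hi, val_update (by omega) _ _ hi,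
              val_update (by omega) _ _ hi]
          refine ((h₂ X hX s' fun i hi => (hv i hi).trans_le (hs i hi)).2 d (δ + 1) hd
            (by omega) ((((hc.mono (by omega)).update (by omega) _).update (by omega) _).update
              (by omega) _)).congr ?_ le_rfl
          have en : tl ((i + 1) * n) ++ s d = tl n ++ (tl (i * n) ++ s d) := by
            rw [← List.append_assoc, ← List.replicate_add]
            congr 2
            ring
          rw [eval_congr hv h.2, hs', ← hn, en]
          clear_value m n
          clear r₁ hc h₁ h₂ hv hs'
          funext j
          simp only [Function.update_apply]
          split_ifs <;> grind)
      have es : update s δ (tl m ++ s δ) =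
          update (update s δ (tl (m - 0))) d (tl (0 * n) ++ s d) := by
        rw [hc δ le_rfl, List.append_nil, Nat.zero_mul, Nat.sub_zero, tl, tl, List.replicate_zero,
          List.nil_append, ← Function.update_of_ne (β := fun _ => List Symb) hδ.ne (tl m) s,
          Function.update_eq_self]
      have et : update (update s δ (tl (m - m))) d (tl (m * n) ++ s d) =
          update s d (tl (m * n) ++ s d) := by
        rw [Nat.sub_self, tl, List.replicate_zero, ← hc δ le_rfl, Function.update_eq_self]
      rw [es] at r₁
      exact (r₁.seq r₂).congr et (le_trans (Nat.add_le_add_left (Nat.add_le_add_right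
        (Nat.mul_le_mul_right _ e₁) 1) _) (hK X hX))
  | sub e f, h => by
    obtain ⟨K₁, h₁⟩ := e.runs h.1
    obtain ⟨K₂, h₂⟩ := f.runs h.2
    obtain ⟨K, hK⟩ := (PolyBounded.id.pow K₁).add ((PolyBounded.id.pow K₂).add
      ((((PolyBounded.id.pow K₂).mul (.const 3)).add (.const 1)).add
        (((PolyBounded.id.pow K₁).mul (.const 2)).add (.const 1))))
    refine ⟨K, fun X hX s hs => ⟨?_, fun d δ hd hδ hc => ?_⟩⟩
    · have := (h₁ X hX s hs).1
      have := hK X hX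
      simp only at this
      simp only [eval]
      omega
    · have r₁ := (h₁ X hX s hs).2 δ (δ + 1) (by omega) (by omega) (hc.mono (by omega))
      have e₁ := (h₁ X hX s hs).1
      have e₂ := (h₂ X hX s hs).1
      rw [hc δ le_rfl, List.append_nil] at r₁
      set m := e.eval (val s) with hm
      set s' := update s δ (tl m) with hs'
      have hv : ∀ i < v, val s' i = val s i := fun i hi => val_update (by omega) _ _ hi
      have r₂ := (h₂ X hX s' (fun i hi => (hv i hi).trans_le (hs i hi))).2 (δ + 1) (δ + 2)
        (by omega) (by omega) ((hc.mono (by omega)).update (by omega) _)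
      rw [eval_congr hv h.2, hs', Function.update_of_ne (by omega), hc (δ + 1) (by omega),
        List.append_nil] at r₂
      set n := f.eval (val s) with hn
      have r₃ := runs_subtract (r := δ) (t := δ + 1) (a := m) (b := n) (by omega)
        (update (update s δ (tl m)) (δ + 1) (tl n)) (by simp) (by simp)
      have r₄ := runs_move (r := δ) (d := d) hδ.ne'
        (update (update (update (update s δ (tl m)) (δ + 1) (tl n)) (δ + 1) []) δ (tl (m - n)))
      refine (r₁.seq (r₂.seq (r₃.seq r₄))).congr ?_ (le_trans ?_ (hK X hX))
      · have h1 := hc δ le_rfl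
        have h2 := hc (δ + 1) (by omega)
        have h3 : ¬ d = δ + 1 := by omega
        clear_value m n
        clear r₁ r₂ r₃ r₄ h₁ h₂ hv hs'
        funext j
        simp only [Function.update_apply, eval, ← hm, ← hn]
        split_ifs <;> simp_all
      · simp only [Function.update_self, List.length_replicate]
        gcongr
        omega

end Expr

/-- Programs that write a word, built from loops with a bound that is computed in advance. -/
inductive Stm
  | emit (l : List Symb)
  | bin (e : Expr)
  | seq (P Q : Stm)
  | loop (e : Expr) (P : Stm)

namespace Stm

open Cmd
open Function (update)

/-- The word that is written. The variables have indices below `v`, and the first loop uses the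
variable `v`. -/
def out : Stm → ℕ → (ℕ → ℕ) → List Symb
  | emit l, _, _ => l
  | bin e, _, ρ => binWord (e.eval ρ)
  | seq P Q, v, ρ => P.out v ρ ++ Q.out v ρ
  | loop e P, v, ρ => (List.range (e.eval ρ)).flatMap fun i => P.out (v + 1) (update ρ v i)

/-- All expressions use bound variables only. -/
def InRange : Stm → ℕ → Prop
  | emit _, _ => True
  | bin e, v => e.InRange v
  | seq P Q, v => P.InRange v ∧ Q.InRange v
  | loop e P, v => e.InRange v ∧ P.InRange (v + 1)

theorem out_congr : ∀ {P : Stm} {v : ℕ} {ρ ρ' : ℕ → ℕ} (_ : ∀ i < v, ρ i = ρ' i)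
    (_ : P.InRange v), P.out v ρ = P.out v ρ'
  | emit _, _, _, _, _, _ => rfl
  | bin e, _, _, _, h, hP => congrArg binWord (Expr.eval_congr h hP)
  | seq _ _, _, _, _, h, hP => congrArg₂ (· ++ ·) (out_congr h hP.1) (out_congr h hP.2)
  | loop e P, v, ρ, ρ', h, hP => by
    rw [out, out, Expr.eval_congr h hP.1]
    congr 1
    funext i
    refine out_congr (fun j hj => ?_) hP.2
    rcases eq_or_ne j v with rfl | hjv
    · simp
    · rw [Function.update_of_ne hjv, Function.update_of_ne hjv, h j (by omega)]

/-- The program on stacks that writes the word onto the stack `1`. -/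
def cmd : Stm → ℕ → Cmd
  | emit l, _ => pushes 1 l
  | bin e, v => .seq (e.cmd (2 * v + 4) (2 * v + 5)) (writeBin (2 * v + 4))
  | seq P Q, v => .seq (P.cmd v) (Q.cmd v)
  | loop e P, v => .seq (e.cmd (2 * v + 5) (2 * v + 6)) (.seq
      (forEach (2 * v + 5) (.seq (P.cmd (v + 1)) (push (2 * v + 4) tally)))
      (Cmd.clear (2 * v + 4)))

/-- In a loop over the variable `v`, the stack `2 * v + 5` holds the remaining rounds and the stack
`2 * v + 4` the number of finished rounds, which is the value of the variable. Everything from `2 *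
v + 6` on is free for the body. -/
theorem runs : ∀ (P : Stm) (v : ℕ), P.InRange v → ∃ K, ∀ X, 2 ≤ X → ∀ s : Store,
    (∀ i < v, val s i ≤ X) → Clear (2 * v + 4) s →
      Runs (P.cmd v) s (update s 1 ((P.out v (val s)).reverse ++ s 1)) (X ^ K)
  | emit l, v, _ => by
    obtain ⟨K, hK⟩ := PolyBounded.const (l.length + 1)
    exact ⟨K, fun X hX s _ _ => (runs_pushes 1 l s).mono (hK X hX)⟩
  | bin e, v, h => by
    obtain ⟨K₁, h₁⟩ := e.runs h
    obtain ⟨K, hK⟩ := (PolyBounded.id.pow K₁).add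
      (((PolyBounded.id.pow K₁).mul (((PolyBounded.const 6).mul (PolyBounded.id.pow K₁)).add
        (.const 10))).add (.const 1))
    refine ⟨K, fun X hX s hs hc => ?_⟩
    obtain ⟨hb, hr⟩ := h₁ X hX s hs
    have r₁ := hr (2 * v + 4) (2 * v + 5) le_rfl (by omega) (hc.mono (by omega))
    rw [hc _ le_rfl, List.append_nil] at r₁
    have r₂ := runs_writeBin (2 * v + 4) (by omega) (e.eval (val s)) _
      (Function.update_self _ _ s)
      (by rw [Function.update_of_ne (by omega), hc _ (by omega)])
      (by rw [Function.update_of_ne (by omega), hc _ (by omega)])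
    refine (r₁.seq r₂).congr ?_ (le_trans ?_ (hK X hX))
    · have h4 := hc _ le_rfl
      clear r₁ r₂ hr h₁
      funext j
      simp only [Function.update_apply, out]
      split_ifs <;> grind
    · exact Nat.add_le_add_left (Nat.add_le_add_right (Nat.mul_le_mul hb
        (Nat.add_le_add_right (Nat.mul_le_mul_left 6 hb) 10)) 1) _
  | seq P Q, v, h => by
    obtain ⟨K₁, h₁⟩ := P.runs v h.1
    obtain ⟨K₂, h₂⟩ := Q.runs v h.2
    obtain ⟨K, hK⟩ := (PolyBounded.id.pow K₁).add (PolyBounded.id.pow K₂)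
    refine ⟨K, fun X hX s hs hc => ?_⟩
    have r₁ := h₁ X hX s hs hc
    set s' := update s 1 ((P.out v (val s)).reverse ++ s 1) with hs'
    have hv : ∀ i < v, val s' i = val s i := fun i hi => by
      rw [val, val, hs', Function.update_of_ne (by omega)]
    have r₂ := h₂ X hX s' (fun i hi => (hv i hi).trans_le (hs i hi)) (hc.update (by omega) _)
    refine (r₁.seq r₂).congr ?_ (hK X hX)
    rw [out_congr hv h.2, hs', Function.update_idem, Function.update_self, out,
      List.reverse_append, List.append_assoc]
  | loop e P, v, h => by
    obtain ⟨K₁, h₁⟩ := e.runs h.1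
    obtain ⟨K₂, h₂⟩ := P.runs (v + 1) h.2
    obtain ⟨K, hK⟩ := (PolyBounded.id.pow K₁).add
      ((((PolyBounded.id.pow K₁).mul ((((PolyBounded.id.add (PolyBounded.id.pow K₁)).pow K₂).add
        (.const 1)).add (.const 1))).add (.const 1)).add
        (((PolyBounded.id.pow K₁).mul (.const 2)).add (.const 1)))
    refine ⟨K, fun X hX s hs hc => ?_⟩
    obtain ⟨hb, hr⟩ := h₁ X hX s hs
    have r₁ := hr (2 * v + 5) (2 * v + 6) (by omega) (by omega) (hc.mono (by omega))
    rw [hc _ (by omega), List.append_nil] at r₁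
    set n := e.eval (val s) with hn
    let w : ℕ → List Symb := fun i =>
      (List.range i).flatMap fun i => P.out (v + 1) (update (val s) v i)
    have r₂ := runs_forEach (r := 2 * v + 5) (p := .seq (P.cmd (v + 1)) (push (2 * v + 4) tally))
      -- The loop variable is bounded by `n ≤ X ^ K₁` instead of `X`, so the body is run with the
      -- bound `X + X ^ K₁` for its variables.
      (c := (X + X ^ K₁) ^ K₂ + 1) (n := n)
      (fun i => update (update (update s (2 * v + 5) (tl (n - i))) (2 * v + 4) (tl i)) 1
        ((w i).reverse ++ s 1)) (fun i hi => by simp) (fun i hi => by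
        set s' := update (update (update (update s (2 * v + 5) (tl (n - i))) (2 * v + 4) (tl i)) 1
          ((w i).reverse ++ s 1)) (2 * v + 5) (tl (n - (i + 1))) with hs'
        have hv : ∀ j < v + 1, val s' j = update (val s) v i j := fun j hj => by
          rw [val, hs', Function.update_of_ne (by omega), Function.update_of_ne (by omega)]
          rcases eq_or_ne j v with rfl | hjv
          · simp
          · rw [Function.update_of_ne (by omega), Function.update_of_ne (by omega),
              Function.update_of_ne hjv, val]
        have r := h₂ (X + X ^ K₁) (by omega) s' (fun j hj => by
          rw [hv j hj]
          rcases eq_or_ne j v with rfl | hjv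
          · simp; omega
          · rw [Function.update_of_ne hjv]
            exact (hs j (by omega)).trans (by omega))
          (((((hc.mono (by omega)).update (by omega) _).update (by omega) _).update
            (by omega) _).update (by omega) _)
        refine (r.seq (runs_push _ _ _)).congr ?_ le_rfl
        rw [out_congr hv h.2, hs']
        have e2 : w (i + 1) = w i ++ P.out (v + 1) (update (val s) v i) := by
          simp [w, List.range_succ]
        have e3 : tl (i + 1) = tally :: tl i := List.replicate_succ
        clear_value w n
        clear r r₁ hr hv hs' h₁ h₂
        funext j
        simp only [Function.update_apply, e2, e3]
        split_ifs <;> grind)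
    have es : update s (2 * v + 5) (tl n) = update (update (update s (2 * v + 5) (tl (n - 0)))
        (2 * v + 4) (tl 0)) 1 ((w 0).reverse ++ s 1) := by
      have h4 := hc _ le_rfl
      have e0 : w 0 = [] := rfl
      clear_value w n
      clear r₁ r₂ hr h₁ h₂
      funext j
      simp only [Function.update_apply, e0]
      split_ifs <;> grind
    rw [← es] at r₂
    refine (r₁.seq (r₂.seq (runs_clear _ _))).congr ?_ (le_trans ?_ (hK X hX))
    · have h4 := hc _ le_rfl
      have h5 := hc (2 * v + 5) (by omega)
      have e3 : Stm.out (loop e P) v (val s) = w n := rfl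
      rw [e3]
      clear_value w n
      clear r₁ r₂ hr h₁ h₂ e3 es
      funext j
      simp only [Function.update_apply]
      split_ifs <;> grind
    · have : ((update (update (update s (2 * v + 5) (tl (n - n))) (2 * v + 4) (tl n)) 1
          ((w n).reverse ++ s 1)) (2 * v + 4)).length = n := by simp
      rw [this]
      have := Nat.mul_le_mul_right ((X + X ^ K₁) ^ K₂ + 1 + 1) hb
      exact Nat.add_le_add_left (Nat.add_le_add (Nat.add_le_add_right this 1) (by omega)) _

end Stm

/-! ### The driver: reading a graph and writing a word -/

namespace Cmd

open Function (update)

/-- A step pushes at most one symbol. This bounds the length of a written word by the time spent on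
writing it. -/
theorem Exec.length_le {p : Cmd} {s t : Store} {n : ℕ} (h : Exec p s t n) (r : ℕ) :
    (t r).length ≤ (s r).length + n := by
  induction h with
  | skip s => omega
  | push r' a s =>
    by_cases hr : r = r'
    · subst hr; simp
    · simp [Function.update_of_ne hr]
  | seq _ _ ih₁ ih₂ => omega
  | loop_nil _ => omega
  | @loop_final r' _ _ s a l h _ =>
    by_cases hr : r = r'
    · subst hr; simp [h]; omega
    · simp [Function.update_of_ne hr]
  | @loop_step r' _ _ s a l _ _ _ _ h _ _ _ ih₁ ih₂ =>
    have : (update s r' l r).length ≤ (s r).length := by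
      by_cases hr : r = r'
      · subst hr; simp [h]
      · simp [Function.update_of_ne hr]
    omega
  | branch_nil _ _ ih => omega
  | @branch_cons r' _ _ s a l _ _ h _ ih =>
    have : (update s r' l r).length ≤ (s r).length := by
      by_cases hr : r = r'
      · subst hr; simp [h]
      · simp [Function.update_of_ne hr]
    omega

theorem Runs.length_le {p : Cmd} {s t : Store} {N : ℕ} (h : Runs p s t N) (r : ℕ) :
    (t r).length ≤ (s r).length + N :=
  let ⟨_, hn, h⟩ := h
  (h.length_le r).trans (by omega)

/-- The store with the input `inp`, the written word `acc` in reversed order, the output `out`, and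
the variables `ρ`. -/
def st (inp acc out : List Symb) (ρ : ℕ → ℕ) : Store := fun r =>
  if r = 0 then inp else if r = 1 then acc else if r = 2 then out
  else if r % 2 = 0 then tl (ρ ((r - 4) / 2)) else []

section st

variable (inp acc out l : List Symb) (ρ : ℕ → ℕ)

@[simp] theorem st_zero : st inp acc out ρ 0 = inp := rfl

@[simp] theorem st_one : st inp acc out ρ 1 = acc := rfl

@[simp] theorem st_two : st inp acc out ρ 2 = out := rfl

@[simp] theorem st_three : st inp acc out ρ 3 = [] := rfl

theorem st_var (i : ℕ) : st inp acc out ρ (2 * i + 4) = tl (ρ i) := by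
  have h1 : (2 * i + 4) % 2 = 0 := by omega
  have h2 : (2 * i + 4 - 4) / 2 = i := by omega
  simp only [st, h1, h2]
  simp

@[simp] theorem val_st : val (st inp acc out ρ) = ρ := by
  funext i
  rw [val, st_var, List.length_replicate]

theorem update_st_zero : update (st inp acc out ρ) 0 l = st l acc out ρ := by
  funext j
  simp only [Function.update_apply, st]
  split_ifs <;> simp_all

theorem update_st_one : update (st inp acc out ρ) 1 l = st inp l out ρ := by
  funext j
  simp only [Function.update_apply, st]
  split_ifs <;> simp_all

theorem update_st_two : update (st inp acc out ρ) 2 l = st inp acc l ρ := by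
  funext j
  simp only [Function.update_apply, st]
  split_ifs <;> simp_all

theorem update_st_var (i m : ℕ) :
    update (st inp acc out ρ) (2 * i + 4) (tl m) = st inp acc out (update ρ i m) := by
  funext j
  by_cases hj : j = 2 * i + 4
  · rw [hj, Function.update_self, st_var, Function.update_self]
  · rw [Function.update_of_ne hj]
    simp only [st]
    by_cases h4 : j < 4
    · interval_cases j <;> simp
    · by_cases h2 : j % 2 = 0
      · rw [Function.update_of_ne (by omega)]
      · simp [h2]

theorem clear_st {v : ℕ} (hρ : ∀ i, v ≤ i → ρ i = 0) : Clear (2 * v + 4) (st inp acc out ρ) := by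
  intro j hj
  have h0 : j ≠ 0 := by omega
  have h1 : j ≠ 1 := by omega
  have h2 : j ≠ 2 := by omega
  simp only [st, h0, h1, h2, if_false]
  split_ifs
  · rw [hρ _ (by omega)]; rfl
  · rfl

theorem runs_push_var (i : ℕ) :
    Runs (push (2 * i + 4) tally) (st inp acc out ρ)
      (st inp acc out (update ρ i (ρ i + 1))) 1 := by
  refine (runs_push _ _ _).congr ?_ le_rfl
  rw [st_var, ← List.replicate_succ, update_st_var]

theorem runs_clear_var (i : ℕ) :
    Runs (clear (2 * i + 4)) (st inp acc out ρ) (st inp acc out (update ρ i 0))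
      (ρ i * 2 + 1) := by
  refine (runs_clear _ _).congr ?_ ?_
  · exact update_st_var inp acc out ρ i 0
  · rw [st_var, List.length_replicate]

end st

/-- The program of a `Stm`, in terms of `st`. -/
theorem runs_stm {P : Stm} {v : ℕ} (h : P.InRange v) : ∃ K, ∀ X, 2 ≤ X → ∀ inp acc out ρ,
    (∀ i < v, ρ i ≤ X) → (∀ i, v ≤ i → ρ i = 0) →
      Runs (P.cmd v) (st inp acc out ρ) (st inp ((P.out v ρ).reverse ++ acc) out ρ) (X ^ K) := by
  obtain ⟨K, hK⟩ := P.runs v h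
  refine ⟨K, fun X hX inp acc out ρ h1 h2 => ?_⟩
  have := hK X hX (st inp acc out ρ) (by simpa using h1) (clear_st inp acc out ρ h2)
  simpa [update_st_one] using this

/-- The end mark of a token. -/
abbrev mark : Symb := some none

/-- Read the parameter and the first token. -/
def readHead : Cmd :=
  loop 0 (fun a => decide (a = mark)) fun a =>
    if a = none then push (2 * 0 + 4) tally else push (2 * 1 + 4) tally

/-- Variables with given values for `0` and `1`. -/
def env₂ (k n : ℕ) : ℕ → ℕ
  | 0 => k
  | 1 => n
  | _ => 0

/-- Of the first `i` symbols, `min i k` are digits of the parameter and `i - k` are digits of the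
first token; this is the invariant. -/
theorem runs_readHead (k n : ℕ) (rest : List Symb) :
    Runs readHead (st (List.replicate k none ++ tl n ++ mark :: rest) [] [] fun _ => 0)
      (st rest [] [] (env₂ k n)) ((k + n) * 2 + 1) := by
  have key := runs_loop_until (r := 0) (final := fun a => decide (a = mark))
    (body := fun a => if a = none then push (2 * 0 + 4) tally else push (2 * 1 + 4) tally)
    (c := 1) (a := mark) rest (List.replicate k none ++ tl n)
    (fun i => st ((List.replicate k none ++ tl n).drop i ++ mark :: rest) [] []
      (env₂ (min i k) (i - k))) (fun i _ => rfl) rfl (fun i hi => by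
      rw [update_st_zero]
      by_cases hik : i < k
      · have e : (List.replicate k none ++ tl n)[i] = none := by
          rw [List.getElem_append_left (by simpa using hik)]; simp
        rw [e]
        refine ⟨rfl, ?_⟩
        rw [if_pos rfl]
        refine (runs_push_var _ _ _ _ 0).congr ?_ le_rfl
        congr 1
        funext j
        match j with
        | 0 => simp [env₂]; omega
        | 1 => simp [env₂]; omega
        | _ + 2 => simp [env₂]
      · have e : (List.replicate k none ++ tl n)[i] = tally := by
          rw [List.getElem_append_right (by simpa using hik)]; simp
        rw [e]
        refine ⟨rfl, ?_⟩
        rw [if_neg (by simp)]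
        refine (runs_push_var _ _ _ _ 1).congr ?_ le_rfl
        congr 1
        funext j
        match j with
        | 0 => simp [env₂]; omega
        | 1 => simp [env₂]; omega
        | _ + 2 => simp [env₂])
  refine Runs.congr (s := _) (p := readHead) (by
    have e0 : st (List.replicate k none ++ tl n ++ mark :: rest) [] [] (fun _ => 0) =
      (fun i => st ((List.replicate k none ++ tl n).drop i ++ mark :: rest) [] []
      (env₂ (min i k) (i - k))) 0 := by
        simp only [List.drop_zero, Nat.zero_min, Nat.zero_sub]
        congr 1
        funext j
        match j with
        | 0 => rfl
        | 1 => rfl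
        | _ + 2 => rfl
    rw [e0]
    exact key) ?_ (by simp)
  rw [update_st_zero]
  simp

/-- Count the end marks of the input in the variable `2`. -/
def countMarks : Cmd :=
  seq (loop 0 (fun _ => false) fun a =>
    seq (push 3 a) (if a = mark then push (2 * 2 + 4) tally else skip)) (move 3 0)

theorem runs_countMarks (inp : List Symb) (ρ : ℕ → ℕ) (hρ : ρ 2 = 0) :
    Runs countMarks (st inp [] [] ρ) (st inp [] [] (update ρ 2 (inp.count mark)))
      (inp.length * 5 + 2) := by
  have key := runs_loop_all (r := 0) (final := fun _ => false)
    (body := fun a => seq (push 3 a) (if a = mark then push (2 * 2 + 4) tally else skip))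
    (c := 2) inp
    (fun i => update (st (inp.drop i) [] [] (update ρ 2 ((inp.take i).count mark))) 3
      (inp.take i).reverse) (fun i hi => rfl) (fun i hi => ⟨rfl, by
      have e : (inp.take (i + 1)).reverse = inp[i] :: (inp.take i).reverse := by
        rw [List.take_succ_eq_append_getElem hi, List.reverse_append]; rfl
      have e' : (inp.take (i + 1)).count mark =
          (inp.take i).count mark + if inp[i] = mark then 1 else 0 := by
        rw [List.take_succ_eq_append_getElem hi, List.count_append, List.count_singleton]
        simp only [beq_iff_eq]
      rw [e, e']
      generalize inp[i] = a
      generalize (inp.take i).reverse = l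
      generalize (inp.take i).count mark = m
      generalize inp.drop i = q
      generalize inp.drop (i + 1) = q'
      have e3 : update (update (update (st q [] [] (update ρ 2 m)) 3 l) 0 q') 3 (a :: l) =
          update (st q' [] [] (update ρ 2 m)) 3 (a :: l) := by
        rw [← update_st_zero q _ _ q']
        funext j
        simp only [Function.update_apply]
        split_ifs <;> grind
      have r1 := runs_push 3 a (update (update (st q [] [] (update ρ 2 m)) 3 l) 0 q')
      rw [Function.update_of_ne (a := 3) (a' := 0) (by decide), Function.update_self, e3] at r1
      refine r1.seq (?_ : Runs _ _ _ 1)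
      by_cases ha : a = mark
      · rw [if_pos ha, if_pos ha]
        refine (runs_push _ _ _).congr ?_ le_rfl
        rw [Function.update_of_ne (by decide), st_var, Function.update_comm (by decide),
          ← List.replicate_succ, update_st_var]
        simp
      · rw [if_neg ha, if_neg ha]
        exact runs_skip _⟩)
  have e0 : (fun i => update (st (inp.drop i) [] [] (update ρ 2 ((inp.take i).count mark))) 3
      (inp.take i).reverse) 0 = st inp [] [] ρ := by
    have h1 : update ρ 2 0 = ρ := by rw [← hρ, Function.update_eq_self]
    have h2 : update (st inp [] [] ρ) 3 [] = st inp [] [] ρ :=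
      Function.update_eq_self 3 (st inp [] [] ρ)
    simp [h1, h2]
  beta_reduce at e0
  rw [e0] at key
  refine (key.seq (runs_move (by decide) _)).congr ?_ ?_
  · simp only [List.drop_length, List.take_length, Function.update_self, Function.update_idem,
      List.reverse_reverse]
    rw [Function.update_of_ne (by decide), st_zero, List.append_nil,
      Function.update_comm (by decide), update_st_zero]
    exact Function.update_eq_self 3 (st inp [] [] _)
  · simp
    omega

/-- Double the number on the stack `t`; the stack `t'` is auxiliary. -/
def double (t t' : ℕ) : Cmd :=
  seq (forEach t (seq (push t' tally) (push t' tally))) (move t' t)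

theorem runs_double {t t' : ℕ} (h : t ≠ t') (s : Store) (m : ℕ) (ht : s t = tl m)
    (ht' : s t' = []) : Runs (double t t') s (update s t (tl (2 * m))) (m * 7 + 2) := by
  have key := runs_forEach (r := t) (p := seq (push t' tally) (push t' tally)) (c := 2) (n := m)
    (fun i => update (update s t (tl (m - i))) t' (tl (2 * i)))
    (fun i hi => by simp [h]) (fun i hi => by
      refine ((runs_push _ _ _).seq (runs_push _ _ _)).congr ?_ le_rfl
      have e : tl (2 * (i + 1)) = tally :: tally :: tl (2 * i) := rfl
      rw [e]
      funext j
      simp only [Function.update_apply]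
      split_ifs <;> grind)
  have e0 : (fun i => update (update s t (tl (m - i))) t' (tl (2 * i))) 0 = s := by
    funext j
    simp only [Function.update_apply]
    split_ifs <;> simp_all
  beta_reduce at e0
  rw [e0] at key
  refine (key.seq (runs_move h.symm _)).congr ?_ ?_
  · funext j
    simp only [Function.update_apply]
    split_ifs <;> simp_all
  · simp
    omega

/-- Set the variable `v` to a power of two. -/
def powTwo (v : ℕ) (e : Expr) : Cmd :=
  seq (e.cmd (2 * v + 5) (2 * v + 6)) (seq (push (2 * v + 4) tally)
    (forEach (2 * v + 5) (double (2 * v + 4) (2 * v + 6))))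

/-- A power of two is not polynomially bounded in its exponent, so its value has to be covered by
`X` as a hypothesis. -/
theorem runs_powTwo {v : ℕ} {e : Expr} (h : e.InRange v) : ∃ K, ∀ X, 2 ≤ X → ∀ inp acc out ρ,
    (∀ i < v, ρ i ≤ X) → (∀ i, v ≤ i → ρ i = 0) → 2 ^ e.eval ρ ≤ X →
      Runs (powTwo v e) (st inp acc out ρ) (st inp acc out (update ρ v (2 ^ e.eval ρ)))
        (X ^ K) := by
  obtain ⟨K₁, h₁⟩ := e.runs h
  obtain ⟨K, hK⟩ := (PolyBounded.id.pow K₁).add ((PolyBounded.const 1).add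
    (((PolyBounded.id.pow K₁).mul (((PolyBounded.id.mul (.const 7)).add (.const 2)).add
      (.const 1))).add (.const 1)))
  refine ⟨K, fun X hX inp acc out ρ hρ hc hb => ?_⟩
  obtain ⟨e₁, r₁⟩ := h₁ X hX (st inp acc out ρ) (by simpa using hρ)
  have hc' := clear_st inp acc out ρ hc
  have r₁ := r₁ (2 * v + 5) (2 * v + 6) (by omega) (by omega) (hc'.mono (by omega))
  rw [val_st] at r₁ e₁
  rw [hc' _ (by omega), List.append_nil] at r₁
  set n := e.eval ρ
  set s := st inp acc out ρ
  have h4 := hc' (2 * v + 4) (by omega)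
  have h5 := hc' (2 * v + 5) (by omega)
  have h6 := hc' (2 * v + 6) (by omega)
  have r₂ := runs_push (2 * v + 4) tally (update s (2 * v + 5) (tl n))
  have r₃ := runs_forEach (r := 2 * v + 5) (p := double (2 * v + 4) (2 * v + 6))
    (c := X * 7 + 2) (n := n)
    (fun i => update (update s (2 * v + 5) (tl (n - i))) (2 * v + 4) (tl (2 ^ i)))
    (fun i hi => by simp) (fun i hi => by
      refine (runs_double (by omega) _ (2 ^ i) (by simp) ?_).congr ?_ ?_
      · rw [Function.update_of_ne (by omega), Function.update_of_ne (by omega),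
          Function.update_of_ne (by omega), h6]
      · rw [pow_succ']
        funext j
        simp only [Function.update_apply]
        split_ifs <;> grind
      · have : 2 ^ i ≤ 2 ^ n := Nat.pow_le_pow_right (by omega) hi.le
        omega)
  have e0 : (fun i => update (update s (2 * v + 5) (tl (n - i))) (2 * v + 4) (tl (2 ^ i))) 0 =
      update (update s (2 * v + 5) (tl n)) (2 * v + 4)
        (tally :: update s (2 * v + 5) (tl n) (2 * v + 4)) := by
    rw [Function.update_of_ne (by omega), h4]
    rfl
  beta_reduce at e0
  rw [e0] at r₃
  refine (r₁.seq (r₂.seq r₃)).congr ?_ (le_trans ?_ (hK X hX))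
  · rw [← update_st_var, Nat.sub_self, tl, List.replicate_zero, ← h5, Function.update_eq_self]
  · exact Nat.add_le_add_left (Nat.add_le_add_left (Nat.add_le_add_right
      (Nat.mul_le_mul_right _ e₁) 1) 1) _

/-- Read a token in unary into the variable `i`. -/
def readToken (i : ℕ) : Cmd :=
  loop 0 (fun a => decide (a = mark)) fun _ => push (2 * i + 4) tally

theorem runs_readToken (i n : ℕ) (rest acc out : List Symb) (ρ : ℕ → ℕ) :
    Runs (readToken i) (st (tl n ++ mark :: rest) acc out ρ)
      (st rest acc out (update ρ i (ρ i + n))) (n * 2 + 1) := by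
  have key := runs_loop_until (r := 0) (final := fun a => decide (a = mark))
    (body := fun _ => push (2 * i + 4) tally) (c := 1) (a := mark) rest (tl n)
    (fun j => st ((tl n).drop j ++ mark :: rest) acc out (update ρ i (ρ i + j)))
    (fun i _ => rfl) rfl (fun j hj => by
      rw [update_st_zero]
      refine ⟨by simp, (runs_push_var _ _ _ _ i).congr ?_ le_rfl⟩
      simp [Nat.add_assoc])
  rw [update_st_zero] at key
  simpa [readToken] using key

/-- For each pair of tokens, set the variables `5` and `6` to their lengths and run `p`. -/
def forPairs (p : Cmd) : Cmd :=
  loop 0 (fun _ => false) fun a =>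
    seq (if a = mark then skip else seq (push (2 * 5 + 4) tally) (readToken 5))
      (seq (readToken 6) (seq p (seq (clear (2 * 5 + 4)) (clear (2 * 6 + 4)))))

/-- Pairs of numbers in unary. -/
def pairsWord (E : List (ℕ × ℕ)) : List Symb :=
  E.flatMap fun e => tl e.1 ++ mark :: (tl e.2 ++ [mark])

/-- The loop has already popped the first symbol of a pair. If that is the end mark, the first
number is zero; otherwise it is a digit, which is added before the rest of the token is read. -/
theorem runs_forPairs {p : Cmd} {f : (ℕ → ℕ) → List Symb} {c X : ℕ} {ρ : ℕ → ℕ}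
    (h5 : ρ 5 = 0) (h6 : ρ 6 = 0) (out : List Symb) : ∀ (E : List (ℕ × ℕ)) (acc : List Symb)
    (_ : ∀ e ∈ E, e.1 ≤ X ∧ e.2 ≤ X)
    (_ : ∀ e ∈ E, ∀ inp acc, Runs p (st inp acc out (update (update ρ 5 e.1) 6 e.2))
      (st inp ((f (update (update ρ 5 e.1) 6 e.2)).reverse ++ acc) out
        (update (update ρ 5 e.1) 6 e.2)) c),
    Runs (forPairs p) (st (pairsWord E) acc out ρ)
      (st [] ((E.flatMap fun e => f (update (update ρ 5 e.1) 6 e.2)).reverse ++ acc) out ρ)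
      (E.length * (c + 8 * X + 8) + 1)
  | [], acc, _, _ => by simpa [pairsWord, forPairs] using runs_loop_nil (by simp)
  | (x, y) :: E, acc, hE, hp => by
    obtain ⟨hx, hy⟩ := hE (x, y) (by simp)
    simp only at hx hy
    have ih := runs_forPairs h5 h6 out E ((f (update (update ρ 5 x) 6 y)).reverse ++ acc)
      (fun e he => hE e (by simp [he])) (fun e he => hp e (by simp [he]))
    have r₂ := runs_readToken 6 y (pairsWord E) acc out (update ρ 5 x)
    have e6 : update ρ 5 x 6 = 0 := by rw [Function.update_of_ne (by decide), h6]
    rw [e6, Nat.zero_add] at r₂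
    have r₃ := hp (x, y) (by simp) (pairsWord E) acc
    simp only at r₃
    set w := f (update (update ρ 5 x) 6 y)
    have r₄ := runs_clear_var (pairsWord E) (w.reverse ++ acc) out (update (update ρ 5 x) 6 y) 5
    have r₅ := runs_clear_var (pairsWord E) (w.reverse ++ acc) out
      (update (update (update ρ 5 x) 6 y) 5 0) 6
    have e4 : update (update ρ 5 x) 6 y 5 = x := by
      rw [Function.update_of_ne (by decide), Function.update_self]
    have e5 : update (update (update ρ 5 x) 6 y) 5 0 6 = y := by
      rw [Function.update_of_ne (by decide), Function.update_self]
    have e7 : update (update (update (update ρ 5 x) 6 y) 5 0) 6 0 = ρ := by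
      funext j
      simp only [Function.update_apply]
      split_ifs <;> simp_all
    rw [e4] at r₄
    rw [e5, e7] at r₅
    have r' := r₂.seq (r₃.seq (r₄.seq r₅))
    have ew : pairsWord ((x, y) :: E) = tl x ++ mark :: (tl y ++ mark :: pairsWord E) := by
      simp [pairsWord]
    have eo : ((((x, y) :: E).flatMap fun e => f (update (update ρ 5 e.1) 6 e.2)).reverse ++ acc) =
        (E.flatMap fun e => f (update (update ρ 5 e.1) 6 e.2)).reverse ++ (w.reverse ++ acc) := by
      simp [w]
    rw [ew, eo]
    rcases x with _ | x
    · have e0 : update ρ 5 0 = ρ := by rw [← h5, Function.update_eq_self]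
      refine (runs_loop_cons (a := mark) rfl rfl (Runs.seq (M := 1) ?_ r') ih).mono ?_
      · rw [if_pos rfl, update_st_zero, e0]
        exact runs_skip _
      · simp only [List.length_cons]
        linarith
    · refine (runs_loop_cons (a := tally) rfl rfl (Runs.seq (M := 1 + (x * 2 + 1)) ?_ r')
        ih).mono ?_
      · rw [if_neg (by simp), update_st_zero]
        refine ((runs_push_var _ _ _ _ 5).seq (runs_readToken 5 x _ _ _ _)).congr ?_ le_rfl
        rw [h5, Function.update_self, Function.update_idem]
        congr 2
        omega
      · simp only [List.length_cons]
        linarith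

/-- Clear the variables below `v`. -/
def clearVars : ℕ → Cmd
  | 0 => skip
  | v + 1 => seq (clear (2 * v + 4)) (clearVars v)

theorem runs_clearVars {X : ℕ} (inp acc out : List Symb) : ∀ (v : ℕ) (ρ : ℕ → ℕ)
    (_ : ∀ i < v, ρ i ≤ X) (_ : ∀ i, v ≤ i → ρ i = 0),
    Runs (clearVars v) (st inp acc out ρ) (st inp acc out fun _ => 0) (v * (2 * X + 1) + 1)
  | 0, ρ, _, h0 => by
    have : ρ = fun _ => 0 := funext fun i => h0 i (Nat.zero_le i)
    rw [this]
    simpa [clearVars] using runs_skip _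
  | v + 1, ρ, h, h0 => by
    have hv := h v (by omega)
    have r := runs_clearVars (X := X) inp acc out v (update ρ v 0) (fun i hi => by
      rw [Function.update_of_ne (by omega)]
      exact h i (by omega)) (fun i hi => by
      rcases eq_or_ne i v with rfl | hi'
      · simp
      · rw [Function.update_of_ne hi']
        exact h0 i (by omega))
    refine ((runs_clear_var inp acc out ρ v).seq r).mono ?_
    linarith

/-- Read a parameter `k`, a number `n` and a list of pairs; set two further variables to powers of
two; write words with `H`, with `B` for each pair, and with `T`. -/
def driver (eQ eP : Expr) (H B T : Stm) : Cmd :=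
  seq readHead <| seq countMarks <| seq (powTwo 3 eQ) <| seq (powTwo 4 eP) <| seq (H.cmd 5) <|
    seq (forPairs (B.cmd 7)) <| seq (T.cmd 5) <| seq (move 1 2) (clearVars 5)

/-- The variables of the driver. -/
def env (k n m Q P : ℕ) : ℕ → ℕ
  | 0 => k
  | 1 => n
  | 2 => m
  | 3 => Q
  | 4 => P
  | _ => 0

theorem count_pairsWord (E : List (ℕ × ℕ)) : (pairsWord E).count mark = 2 * E.length := by
  induction E with
  | nil => rfl
  | cons e E ih =>
    have : pairsWord (e :: E) = tl e.1 ++ mark :: (tl e.2 ++ [mark]) ++ pairsWord E := by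
      simp [pairsWord]
    rw [this, List.count_append, ih]
    simp [List.count_replicate]
    omega

theorem length_pairsWord {X : ℕ} (E : List (ℕ × ℕ)) (hE : ∀ e ∈ E, e.1 ≤ X ∧ e.2 ≤ X) :
    (pairsWord E).length ≤ E.length * (2 * X + 2) := by
  induction E with
  | nil => simp [pairsWord]
  | cons e E ih =>
    have : pairsWord (e :: E) = tl e.1 ++ mark :: (tl e.2 ++ [mark]) ++ pairsWord E := by
      simp [pairsWord]
    have h1 := hE e (by simp)
    have h2 := ih fun e he => hE e (by simp [he])
    rw [this]
    simp only [List.length_append, List.length_replicate, List.length_cons, List.length_nil]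
    linarith

/-- The two powers of two enter only through `X`, so that `K` is the same for all parameters. -/
theorem runs_driver {eQ eP : Expr} {H B T : Stm} (hQ : eQ.InRange 3) (hP : eP.InRange 4)
    (hH : H.InRange 5) (hB : B.InRange 7) (hT : T.InRange 5) :
    ∃ K, ∀ (X k n m Q P : ℕ) (E : List (ℕ × ℕ)), 2 ≤ X → k ≤ X → n ≤ X → m ≤ X → Q ≤ X → P ≤ X →
      (∀ e ∈ E, e.1 ≤ X ∧ e.2 ≤ X) → m = 2 * E.length → Q = 2 ^ eQ.eval (env k n m 0 0) →
      P = 2 ^ eP.eval (env k n m Q 0) →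
      ∃ N, N + 1 ≤ X ^ K ∧ Exec (driver eQ eP H B T)
        (single 0 (List.replicate k none ++ tl n ++ mark :: pairsWord E))
        (single 2 (H.out 5 (env k n m Q P) ++ (E.flatMap fun e =>
          B.out 7 (update (update (env k n m Q P) 5 e.1) 6 e.2)) ++ T.out 5 (env k n m Q P)))
        N := by
  obtain ⟨K₁, h₁⟩ := runs_powTwo hQ
  obtain ⟨K₂, h₂⟩ := runs_powTwo hP
  obtain ⟨K₃, h₃⟩ := runs_stm hH
  obtain ⟨K₄, h₄⟩ := runs_stm hB
  obtain ⟨K₅, h₅⟩ := runs_stm hT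
  have hb : PolyBounded fun X => X ^ K₃ + (X * (X ^ K₄ + 8 * X + 8) + 1) + X ^ K₅ :=
    ((PolyBounded.id.pow K₃).add ((PolyBounded.id.mul (((PolyBounded.id.pow K₄).add
      ((PolyBounded.const 8).mul .id)).add (.const 8))).add (.const 1))).add (PolyBounded.id.pow K₅)
  obtain ⟨K₆, h₆⟩ := hb
  have hc : PolyBounded fun X => ((X + X) * 2 + 1) + (X * (2 * X + 2) * 5 + 2) + X ^ K₁ + X ^ K₂ +
      X ^ K₆ + (X ^ K₆ * 2 + 1) + (5 * (2 * X + 1) + 1) + 1 :=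
    ((((((((((PolyBounded.id.add .id).mul (.const 2)).add (.const 1)).add
      (((PolyBounded.id.mul (((PolyBounded.const 2).mul .id).add (.const 2))).mul (.const 5)).add
        (.const 2)))).add (.pow .id K₁)).add (.pow .id K₂)).add (.pow .id K₆)).add
      (((PolyBounded.id.pow K₆).mul (.const 2)).add (.const 1))).add
      (((PolyBounded.const 5).mul (((PolyBounded.const 2).mul .id).add (.const 1))).add
        (.const 1))).add (.const 1)
  obtain ⟨K, hK⟩ := hc
  refine ⟨K, fun X k n m Q P E hX hk hn hm hQX hPX hE hmE hQe hPe => ?_⟩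
  have hEl : E.length ≤ X := by omega
  have hlen : (pairsWord E).length ≤ X * (2 * X + 2) :=
    (length_pairsWord E hE).trans (Nat.mul_le_mul_right _ hEl)
  have z0 : ∀ i, 5 ≤ i → env k n m Q P i = 0 := fun i hi => by
    obtain ⟨j, rfl⟩ := Nat.exists_eq_add_of_le' hi; rfl
  have b0 : ∀ i, env k n m Q P i ≤ X := fun i => by
    match i with
    | 0 | 1 | 2 | 3 | 4 => assumption
    | _ + 5 => exact Nat.zero_le _
  have r₁ := runs_readHead k n (pairsWord E)
  have r₂ := runs_countMarks (pairsWord E) (env₂ k n) rfl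
  have e₂ : update (env₂ k n) 2 ((pairsWord E).count mark) = env k n m 0 0 := by
    rw [count_pairsWord, ← hmE]
    funext i
    match i with
    | 0 | 1 | 2 | 3 | 4 | _ + 5 => rfl
  rw [e₂] at r₂
  have r₃ := h₁ X hX (pairsWord E) [] [] (env k n m 0 0)
    (fun i hi => by interval_cases i <;> assumption)
    (fun i hi => by
      match i, hi with
      | 3, _ | 4, _ | _ + 5, _ => rfl) (hQe ▸ hQX)
  rw [← hQe] at r₃
  have e₃ : update (env k n m 0 0) 3 Q = env k n m Q 0 := by
    funext i
    match i with
    | 0 | 1 | 2 | 3 | 4 | _ + 5 => rfl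
  rw [e₃] at r₃
  have r₄ := h₂ X hX (pairsWord E) [] [] (env k n m Q 0)
    (fun i hi => by interval_cases i <;> assumption)
    (fun i hi => by
      match i, hi with
      | 4, _ | _ + 5, _ => rfl) (hPe ▸ hPX)
  rw [← hPe] at r₄
  have e₄ : update (env k n m Q 0) 4 P = env k n m Q P := by
    funext i
    match i with
    | 0 | 1 | 2 | 3 | 4 | _ + 5 => rfl
  rw [e₄] at r₄
  set ρ := env k n m Q P with hρ
  have r₅ := h₃ X hX (pairsWord E) [] [] ρ (fun i _ => b0 i) z0
  have r₆ := runs_forPairs (p := B.cmd 7) (f := fun ρ => B.out 7 ρ) (c := X ^ K₄) (X := X) (ρ := ρ)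
    rfl rfl [] E ((H.out 5 ρ).reverse ++ []) hE (fun e he inp acc =>
      h₄ X hX inp acc [] _ (fun i hi => by
        have := hE e he
        by_cases h6 : i = 6
        · rw [h6, Function.update_self]; exact this.2
        · rw [Function.update_of_ne h6]
          by_cases h5 : i = 5
          · rw [h5, Function.update_self]; exact this.1
          · rw [Function.update_of_ne h5]; exact b0 i) (fun i hi => by
        rw [Function.update_of_ne (by omega), Function.update_of_ne (by omega), z0 i (by omega)]))
  have r₇ := h₅ X hX [] ((E.flatMap fun e => B.out 7 (update (update ρ 5 e.1) 6 e.2)).reverse ++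
    ((H.out 5 ρ).reverse ++ [])) [] ρ (fun i _ => b0 i) z0
  have r567 := (r₅.seq (r₆.seq r₇)).mono (N := X ^ K₆) (by
    refine le_trans ?_ (h₆ X hX)
    have := Nat.mul_le_mul_right (X ^ K₄ + 8 * X + 8) hEl
    simp only
    omega)
  -- The cost of moving the word to the output stack is governed by its length, hence by the time in
  -- which it was written.
  have hl := r567.length_le 1
  simp only [st_one, List.length_nil, Nat.zero_add] at hl
  set W := H.out 5 ρ ++ (E.flatMap fun e => B.out 7 (update (update ρ 5 e.1) 6 e.2)) ++ T.out 5 ρ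
    with hW
  have eW : (T.out 5 ρ).reverse ++ ((E.flatMap fun e =>
      B.out 7 (update (update ρ 5 e.1) 6 e.2)).reverse ++ ((H.out 5 ρ).reverse ++ [])) =
      W.reverse := by simp [hW]
  rw [eW] at r₇ hl
  have r₈ := runs_move (r := 1) (d := 2) (by decide) (st [] W.reverse [] ρ)
  have e₈ : update (update (st [] W.reverse [] ρ) 1 []) 2
      ((st [] W.reverse [] ρ 1).reverse ++ st [] W.reverse [] ρ 2) = st [] [] W ρ := by
    rw [update_st_one, update_st_two]
    simp
  rw [e₈, st_one] at r₈
  have r₉ := runs_clearVars (X := X) [] [] W 5 ρ (fun i _ => b0 i) z0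
  obtain ⟨N, hN, hr⟩ := r₁.seq <| r₂.seq <| r₃.seq <| r₄.seq <| r₅.seq <| r₆.seq <| r₇.seq <|
    r₈.seq r₉
  refine ⟨N, ?_, ?_⟩
  · have hK := hK X hX
    have h₆ := h₆ X hX
    have := Nat.mul_le_mul_right (X ^ K₄ + 8 * X + 8) hEl
    simp only at hK h₆
    omega
  · have es : ∀ l, single 0 l = st l [] [] fun _ => 0 := fun l => by
      funext i
      simp only [single, st]
      split_ifs <;> rfl
    have et : ∀ l, single 2 l = st [] [] l fun _ => 0 := fun l => by
      funext i
      simp only [single, st]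
      split_ifs <;> first | rfl | omega
    rw [es, et]
    exact hr

end Cmd

/-! ### The gadget trees -/

namespace Gadget

/-- The number of children of an internal vertex, which is also the number of heavy colors. -/
def slots (k : ℕ) : ℕ := 2 * k + 6

/-- A power of two. -/
def scale (k : ℕ) : ℕ := 2 ^ (2 * k + 2)

/-- The smallest weight of a heavy color. -/
def base (k n : ℕ) : ℕ := scale k * (n + 3)

/-- A power of two that makes the trees deep enough. -/
def width (k : ℕ) : ℕ := 2 ^ (slots k * (slots k + 2))

/-- The number of internal vertices of a tree. -/
def inner (k : ℕ) : ℕ := 1 + (1 + width k) * slots k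

/-- The number of vertices of a tree. -/
def treeSize (k : ℕ) : ℕ := 1 + slots k + (1 + width k) * (slots k * slots k)

/-- The bound for the weight of a coloring. -/
def bound (k n : ℕ) : ℕ := (16 * scale k - 1) * base k n + ((scale k - 1) * n + 2)

/-- The clause `a ≤ s (2 i + 1) ∨ b ≤ s (2 i) ∨ c ≤ s (2 j + 1) ∨ e ≤ s (2 j)`. -/
structure Clause where
  (i a b j c e : ℕ)

/-- The argument of `s` in a literal of a clause. -/
def Clause.color (φ : Clause) : ℕ → ℕ
  | 0 => 2 * φ.i + 1
  | 1 => 2 * φ.i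
  | 2 => 2 * φ.j + 1
  | _ => 2 * φ.j

/-- The threshold of a literal of a clause. -/
def Clause.thresh (φ : Clause) : ℕ → ℕ
  | 0 => φ.a
  | 1 => φ.b
  | 2 => φ.c
  | _ => φ.e

/-- The function `s` satisfies the clause. -/
def Clause.Holds (φ : Clause) (s : ℕ → ℕ) : Prop := ∃ m < 4, φ.thresh m ≤ s (φ.color m)

/-- The weight of a color `y` with slack `a`. -/
def heavy (k n y a : ℕ) : ℕ := 2 ^ y * base k n + 3 * 4 ^ (y / 2) * a

/-- The vertex in slot `j` below the vertex in slot `j'` below `p` is not forced. -/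
def Light (k : ℕ) (φ : Clause) (p j' j : ℕ) : Prop :=
  j = j' ∨ p = 0 ∧ slots k ≤ j' + 4 ∧ j = φ.color (j' + 4 - slots k)

instance (k : ℕ) (φ : Clause) (p j' j : ℕ) : Decidable (Light k φ p j' j) :=
  inferInstanceAs (Decidable (_ ∨ _))

/-- The weight of the vertex `v` of the tree of a clause. The children of `v` are the vertices
`v * slots k + j + 1` with `j < slots k`. -/
def weight (k n : ℕ) (φ : Clause) (v : ℕ) : ℕ :=
  if v = 0 then scale k * base k n else
    let p := (v - 1) / slots k
    let j := (v - 1) % slots k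
    if p = 0 then
      if j + 4 < slots k then 1
      else heavy k n (φ.color (j + 4 - slots k)) (φ.thresh (j + 4 - slots k))
    else if Light k φ ((p - 1) / slots k) ((p - 1) % slots k) j then 1 else 2 ^ j * base k n

variable {k n : ℕ} {φ : Clause}

theorem slots_pos : 0 < slots k := by unfold slots; omega

theorem weight_zero : weight k n φ 0 = 2 ^ (slots k - 4) * base k n := by
  simp [weight, slots, scale]

theorem div_child {d p j : ℕ} (hj : j < d) : (p * d + j + 1 - 1) / d = p := by
  rw [Nat.add_sub_cancel, Nat.mul_comm, Nat.mul_add_div (by omega), Nat.div_eq_of_lt hj,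
    Nat.add_zero]

theorem mod_child {d p j : ℕ} (hj : j < d) : (p * d + j + 1 - 1) % d = j := by
  rw [Nat.add_sub_cancel, Nat.mul_comm, Nat.mul_add_mod, Nat.mod_eq_of_lt hj]

theorem weight_child {j : ℕ} (hj : j < slots k) : weight k n φ (j + 1) =
    if j + 4 < slots k then 1
      else heavy k n (φ.color (j + 4 - slots k)) (φ.thresh (j + 4 - slots k)) := by
  have h1 := div_child (p := 0) hj
  have h2 := mod_child (p := 0) hj
  rw [Nat.zero_mul, Nat.zero_add] at h1 h2
  rw [weight, if_neg (by omega)]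
  simp only [h1, h2, if_true]

theorem weight_grandchild {p j' j : ℕ} (hj' : j' < slots k) (hj : j < slots k) :
    weight k n φ ((p * slots k + j' + 1) * slots k + j + 1) =
      if Light k φ p j' j then 1 else 2 ^ j * base k n := by
  rw [weight, if_neg (by omega)]
  simp only [div_child hj, mod_child hj, div_child hj', mod_child hj']
  rw [if_neg (by omega)]

theorem vertex_cases {d : ℕ} (hd : 0 < d) (v : ℕ) : v = 0 ∨ (∃ j < d, v = j + 1) ∨
    ∃ p j' j, j' < d ∧ j < d ∧ v = (p * d + j' + 1) * d + j + 1 := by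
  have split : ∀ v, v = 0 ∨ ∃ p j, j < d ∧ v = p * d + j + 1 := fun v => by
    rcases v with _ | v
    · exact Or.inl rfl
    · exact Or.inr ⟨v / d, v % d, Nat.mod_lt _ hd, by rw [Nat.div_add_mod']⟩
  rcases split v with rfl | ⟨p, j, hj, rfl⟩
  · exact Or.inl rfl
  · rcases split p with rfl | ⟨p, j', hj', rfl⟩
    · exact Or.inr (Or.inl ⟨j, hj, by simp⟩)
    · exact Or.inr (Or.inr ⟨p, j', j, hj', hj, rfl⟩)

theorem child_lt_treeSize {p j : ℕ} (hp : p < inner k) (hj : j < slots k) :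
    p * slots k + j + 1 < treeSize k := by
  unfold inner at hp
  unfold treeSize
  have : p * slots k ≤ (1 + width k) * slots k * slots k := Nat.mul_le_mul_right _ (by omega)
  rw [Nat.mul_assoc] at this
  omega

/-- The unit `base` is so large that the entire slack is less than the weight of the lightest heavy
color. No further heavy color fits into the bound. -/
theorem slack_lt_base : (scale k - 1) * n + 2 < base k n := by
  unfold base scale
  obtain ⟨q, hq⟩ : ∃ q, 2 ^ (2 * k + 2) = q + 1 := ⟨2 ^ (2 * k + 2) - 1, by
    have : 0 < 2 ^ (2 * k + 2) := by positivity
    omega⟩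
  have : 2 ≤ 2 ^ (2 * k + 2) := by
    calc 2 = 2 ^ 1 := rfl
      _ ≤ _ := Nat.pow_le_pow_right (by omega) (by omega)
  rw [hq] at *
  simp only [Nat.add_sub_cancel]
  nlinarith

theorem two_pow_slots : 2 ^ slots k = 16 * scale k := by
  unfold slots scale
  rw [show 2 * k + 6 = 4 + (2 * k + 2) by ring, pow_add]
  norm_num

/-- Geometric series: the heavy colors together weigh at least `(2 ^ slots k - 1) * base k n`.
Adding `base` on the left avoids the subtraction. -/
theorem bound_eq : bound k n + base k n =
    2 ^ slots k * base k n + ((scale k - 1) * n + 2) := by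
  have : 0 < scale k := by unfold scale; positivity
  obtain ⟨q, hq⟩ : ∃ q, 16 * scale k = q + 1 := ⟨16 * scale k - 1, by omega⟩
  rw [bound, two_pow_slots, hq, Nat.add_sub_cancel]
  ring

theorem sum_two_pow (a b : ℕ) (hab : a ≤ b) : ∑ j ∈ Finset.Ico a b, 2 ^ j + 2 ^ a = 2 ^ b := by
  induction b, hab using Nat.le_induction with
  | base => simp
  | succ b hb ih =>
    rw [Finset.sum_Ico_succ_top hb, pow_succ]
    omega

/-- A child of `v` has a number `w` with `w + 1 ≤ (v + 1) * (slots k + 1)`, so powers of `slots k +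
1` bound the numbers along a downward path. Forcing takes fewer than `slots k` further levels below
the grandchildren of the root. The value `width` is a power of two so that it can be computed by
doubling. -/
theorem le_width : (slots k + 1) ^ (slots k + 2) ≤ width k := by
  unfold width
  rw [pow_mul]
  exact Nat.pow_le_pow_left (Nat.lt_two_pow_self) _

/-- Here `cap` bounds the weights of the colors. All trees share one list `γ` of heavy colors,
because any color of capacity `2 ^ j * U` outside `γ j, ..., γ (d - 1)` would raise the total to at
least `2 ^ d * U`, beyond the bound. The slack is what `cap (γ y)` has above `2 ^ y * U`. -/
theorem exists_slack {C : ℕ} (hC : 0 < C) (cl : ℕ → Clause)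
    (hcl : ∀ c < C, (cl c).i ≤ k ∧ (cl c).j ≤ k) {κ : Type} [Fintype κ]
    (col : ℕ → ℕ → κ) (cap : κ → ℕ)
    (hadj : ∀ c < C, ∀ p < inner k, ∀ j < slots k, col c p ≠ col c (p * slots k + j + 1))
    (hcap : ∀ c < C, ∀ v < treeSize k, weight k n (cl c) v ≤ cap (col c v))
    (hsum : ∑ i, cap i ≤ bound k n) :
    ∃ s : ℕ → ℕ, ∑ y ∈ Finset.range (2 * (k + 1)), 3 * 4 ^ (y / 2) * s y ≤ (scale k - 1) * n + 2 ∧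
      ∀ c < C, (cl c).Holds s := by
  classical
  set d := slots k with hd
  have hd' : d = 2 * k + 6 := rfl
  set U := base k n with hU
  have hinner : inner k = 1 + (1 + width k) * d := rfl
  have hw := le_width (k := k)
  rw [← hd] at hw
  have inner_of : ∀ {v e : ℕ}, v + 1 ≤ (d + 1) ^ e → e ≤ d + 2 → v < inner k := fun hv he => by
    have h1 : (d + 1) ^ _ ≤ (d + 1) ^ (d + 2) := Nat.pow_le_pow_right (by omega) he
    have h2 : width k * 1 ≤ width k * d := Nat.mul_le_mul_left _ (by omega)
    rw [hinner]
    linarith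
  -- the reference vertices
  let par : ℕ → ℕ := fun j => if j = 0 then 1 else 0
  have hpar : ∀ j, par j ≤ 1 ∧ par j ≠ j := fun j => by
    simp only [par]
    split_ifs <;> omega
  -- The parent of the reference vertex is in slot 0, or in slot 1 if `j = 0`. It is a child of the
  -- root other than the last four, in a slot different from `j`, so the reference vertex is not
  -- light for any clause.
  let ref : ℕ → ℕ := fun j => (0 * d + par j + 1) * d + j + 1
  let γ : ℕ → κ := fun j => col 0 (ref j)
  have ref_light : ∀ φ j, ¬ Light k φ 0 (par j) j := fun φ j h => by
    have := hpar j
    rcases h with h | ⟨_, h, _⟩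
    · exact this.2 h.symm
    · rw [← hd] at h
      omega
  have ref_bound : ∀ j < d, ref j + 1 ≤ (d + 1) ^ 3 := fun j hj => by
    have h1 : (par j + 1) * d ≤ 2 * d := Nat.mul_le_mul_right _ (by have := (hpar j).1; omega)
    have h2 : (d + 1) ^ 3 = d ^ 3 + 3 * d ^ 2 + 3 * d + 1 := by ring
    simp only [ref, Nat.zero_mul, Nat.zero_add]
    omega
  have capγ : ∀ j < d, 2 ^ j * U ≤ cap (γ j) := fun j hj => by
    have := hcap 0 hC (ref j) (child_lt_treeSize (inner_of (e := 2) (by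
      have := (hpar j).1
      nlinarith) (by omega)) hj)
    rwa [weight_grandchild (by have := (hpar j).1; omega) hj, if_neg (ref_light _ _)] at this
  -- a set of heavy colors with another heavy color is too heavy
  have mem : ∀ j < d, (∀ j₁ j₂, j ≤ j₁ → j₁ < j₂ → j₂ < d → γ j₁ ≠ γ j₂) → ∀ δ,
      2 ^ j * U ≤ cap δ → ∃ j₂, j ≤ j₂ ∧ j₂ < d ∧ δ = γ j₂ := by
    intro j hj hinj δ hδ
    by_contra! hne
    have hi : Set.InjOn γ (Finset.Ico j d) := by
      intro a ha b hb hab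
      simp only [Finset.coe_Ico, Set.mem_Ico] at ha hb
      rcases lt_trichotomy a b with h | h | h
      · exact absurd hab (hinj a b ha.1 h hb.2)
      · exact h
      · exact absurd hab.symm (hinj b a hb.1 h ha.2)
    have hnot : δ ∉ (Finset.Ico j d).image γ := by
      simp only [Finset.mem_image, Finset.mem_Ico, not_exists, not_and]
      exact fun x hx hxe => hne x hx.1 hx.2 hxe.symm
    have h1 : ∑ i ∈ insert δ ((Finset.Ico j d).image γ), cap i ≤ ∑ i, cap i :=
      Finset.sum_le_sum_of_subset (Finset.subset_univ _)
    rw [Finset.sum_insert hnot, Finset.sum_image hi] at h1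
    have h2 : ∑ i ∈ Finset.Ico j d, 2 ^ i * U ≤ ∑ i ∈ Finset.Ico j d, cap (γ i) :=
      Finset.sum_le_sum fun i hi => capγ i (Finset.mem_Ico.1 hi).2
    rw [← Finset.sum_mul] at h2
    have h3 := congrArg (· * U) (sum_two_pow j d hj.le)
    simp only [add_mul] at h3
    have h4 := bound_eq (k := k) (n := n)
    have h5 := slack_lt_base (k := k) (n := n)
    rw [← hd, ← hU] at h4
    rw [← hU] at h5
    omega
  -- forced vertices
  have forced : ∀ t j, d - j = t → j < d →
      (∀ c < C, ∀ p j', j' < d → ¬ Light k (cl c) p j' j →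
        (p * d + j' + 1) * d + j + 1 + 1 ≤ (d + 1) ^ (j + 3) →
        col c ((p * d + j' + 1) * d + j + 1) = γ j) ∧
      ∀ j₂, j < j₂ → j₂ < d → γ j ≠ γ j₂ := by
    intro t
    induction t using Nat.strong_induction_on with
    | _ t ih =>
      intro j hjt hj
      -- The child in slot `j₂` has a parent in the different slot `j` and a grandparent other than
      -- the root, so it is not light and the induction hypothesis forces it. One level multiplies
      -- the number plus one by at most `d + 1`, and `j + 4 ≤ j₂ + 3`.
      have step : ∀ c < C, ∀ p j', j' < d → 
          (p * d + j' + 1) * d + j + 1 + 1 ≤ (d + 1) ^ (j + 3) → ∀ j₂, j < j₂ → j₂ < d →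
          col c ((p * d + j' + 1) * d + j + 1) ≠ γ j₂ := by
        intro c hc p j' hj' hv j₂ hjj₂ hj₂
        have h1 := (ih (d - j₂) (by omega) j₂ rfl hj₂).1 c hc (p * d + j' + 1) j hj (by
          rintro (h | ⟨h, _⟩) <;> omega) (by
          have e1 : (d + 1) ^ (j + 3 + 1) ≤ (d + 1) ^ (j₂ + 3) :=
            Nat.pow_le_pow_right (by omega) (by omega)
          have e2 := Nat.mul_le_mul_right (d + 1) hv
          rw [← pow_succ] at e2
          have e3 : ((p * d + j' + 1) * d + j + 1) * d + j₂ + 1 + 1 ≤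
              ((p * d + j' + 1) * d + j + 1 + 1) * (d + 1) := by
            generalize (p * d + j' + 1) * d + j + 1 = v
            nlinarith
          exact e3.trans (e2.trans e1))
        rw [← h1]
        exact hadj c hc _ (inner_of hv (by omega)) j₂ hj₂
      have hB : ∀ j₂, j < j₂ → j₂ < d → γ j ≠ γ j₂ :=
        step 0 hC 0 (par j) (by have := (hpar j).1; omega) ((ref_bound j hj).trans
          (Nat.pow_le_pow_right (by omega) (by omega)))
      refine ⟨fun c hc p j' hj' hl hv => ?_, hB⟩
      have h1 := hcap c hc ((p * d + j' + 1) * d + j + 1) (child_lt_treeSize (inner_of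
        (e := j + 3) (le_trans (by
          have := Nat.mul_le_mul_left (p * d + j' + 1) (show 1 ≤ d by omega)
          omega) hv) (by omega)) hj)
      rw [weight_grandchild hj' hj, if_neg hl] at h1
      -- By its weight the vertex has one of the colors `γ j, ..., γ (d - 1)`, and its children
      -- occupy all of them but the first.
      obtain ⟨j₂, h2, h3, h4⟩ := mem j hj (fun j₁ j₂ h1 h2 h3 => by
        rcases eq_or_lt_of_le h1 with rfl | h1
        · exact hB j₂ h2 h3
        · exact (ih (d - j₁) (by omega) j₁ rfl (by omega)).2 j₂ h2 h3) _ h1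
      rcases eq_or_lt_of_le h2 with rfl | h2
      · exact h4
      · exact absurd h4 (step c hc p j' hj' hv j₂ h2 h3)
  have hA := fun j hj => (forced _ j rfl hj).1
  have hB := fun j hj => (forced _ j rfl hj).2
  have mem' : ∀ j < d, ∀ δ, 2 ^ j * U ≤ cap δ → ∃ j₂, j ≤ j₂ ∧ j₂ < d ∧ δ = γ j₂ := fun j hj =>
    mem j hj fun j₁ j₂ _ h2 h3 => hB j₁ (by omega) j₂ h2 h3
  -- Rounding down to whole units loses nothing, since the thresholds are whole numbers of units.
  refine ⟨fun y => (cap (γ y) - 2 ^ y * U) / (3 * 4 ^ (y / 2)), ?_, fun c hc => ?_⟩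
  · have h1 : ∑ i ∈ (Finset.range d).image γ, cap i ≤ ∑ i, cap i :=
      Finset.sum_le_sum_of_subset (Finset.subset_univ _)
    rw [Finset.sum_image (by
      intro a ha b hb hab
      simp only [Finset.coe_range, Set.mem_Iio] at ha hb
      rcases lt_trichotomy a b with h | h | h
      · exact absurd hab (hB a ha b h hb)
      · exact h
      · exact absurd hab.symm (hB b hb a h ha))] at h1
    have h2 : ∑ y ∈ Finset.range d, (cap (γ y) - 2 ^ y * U) + ∑ y ∈ Finset.range d, 2 ^ y * U =
        ∑ y ∈ Finset.range d, cap (γ y) := by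
      rw [← Finset.sum_add_distrib]
      exact Finset.sum_congr rfl fun y hy =>
        Nat.sub_add_cancel (capγ y (Finset.mem_range.1 hy))
    have h3 := congrArg (· * U) (sum_two_pow 0 d (Nat.zero_le _))
    simp only [add_mul, ← Finset.range_eq_Ico, pow_zero, one_mul] at h3
    rw [Finset.sum_mul] at h3
    have h4 := bound_eq (k := k) (n := n)
    rw [← hd, ← hU] at h4
    have h5 : ∑ y ∈ Finset.range (2 * (k + 1)),
        3 * 4 ^ (y / 2) * ((cap (γ y) - 2 ^ y * U) / (3 * 4 ^ (y / 2))) ≤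
        ∑ y ∈ Finset.range d, (cap (γ y) - 2 ^ y * U) :=
      (Finset.sum_le_sum fun y _ => Nat.mul_div_le _ _).trans
        (Finset.sum_le_sum_of_subset (Finset.range_subset_range.2 (by omega)))
    beta_reduce
    omega
  · by_contra hno
    have hno : ∀ m < 4, (cap (γ ((cl c).color m)) - 2 ^ (cl c).color m * U) /
        (3 * 4 ^ ((cl c).color m / 2)) < (cl c).thresh m := by
      intro m hm
      by_contra! h
      exact hno ⟨m, hm, h⟩
    have hcol : ∀ m, (cl c).color m < d - 4 := fun m => by
      have := hcl c hc
      unfold Clause.color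
      split <;> omega
    -- The color of a false literal is too light for its vertex. Every other heavy color that the
    -- weight allows, except the spare one, occurs on a forced child.
    have spare : ∀ m < 4, col c (d - 4 + m + 1) = γ (d - 4 + m) := by
      intro m hm
      have h1 := hno m hm
      rw [Nat.div_lt_iff_lt_mul (by positivity)] at h1
      have hl := hcol m
      have h2 := hcap c hc (d - 4 + m + 1) (by
        have := child_lt_treeSize (k := k) (p := 0) (j := d - 4 + m) (by rw [hinner]; omega)
          (by omega)
        simpa using this)
      rw [weight_child (by omega), if_neg (by omega)] at h2
      have e : d - 4 + m + 4 - slots k = m := by omega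
      rw [e, heavy, ← hU] at h2
      obtain ⟨j₂, h3, h4, h5⟩ := mem' _ (by omega) _ ((Nat.le_add_right _ _).trans h2)
      have h6 : j₂ ≠ (cl c).color m := by
        rintro rfl
        rw [h5] at h2
        have := capγ _ h4
        rw [Nat.mul_comm ((cl c).thresh m)] at h1
        omega
      have h7 : j₂ = d - 4 + m := by
        by_contra h7
        have h8 := hA j₂ h4 c hc 0 (d - 4 + m) (by omega) (by
          rintro (h | ⟨_, _, h⟩)
          · exact h7 h
          · rw [e] at h
            exact h6 h) (by
          have : (d + 1) ^ 3 ≤ (d + 1) ^ (j₂ + 3) := Nat.pow_le_pow_right (by omega) (by omega)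
          refine le_trans ?_ this
          have : (0 * d + (d - 4 + m) + 1) * d ≤ d * d := Nat.mul_le_mul_right _ (by omega)
          nlinarith)
        rw [Nat.zero_mul, Nat.zero_add] at h8
        refine hadj c hc (d - 4 + m + 1) ?_ j₂ h4 (h5.trans h8.symm)
        exact inner_of (e := 1) (by rw [pow_one]; omega) (by omega)
      rw [h5, h7]
    -- The weight of the root admits only the four spare colors, which its children now occupy.
    have h1 := hcap c hc 0 (by unfold treeSize; omega)
    rw [weight_zero, ← hd, ← hU] at h1
    obtain ⟨j₂, h3, h4, h5⟩ := mem' (d - 4) (by omega) _ h1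
    obtain ⟨m, rfl⟩ := Nat.exists_eq_add_of_le h3
    have h6 := hadj c hc 0 (by rw [hinner]; omega) (d - 4 + m) h4
    rw [Nat.zero_mul, Nat.zero_add, spare m (by omega)] at h6
    exact h6 h5

end Gadget

/-! ### Coloring the tree of a satisfied clause. -/

namespace Gadget

variable {k n : ℕ} {φ : Clause}

/-- The distance of a vertex from the root. -/
def depth (d v : ℕ) : ℕ := if _h : v = 0 then 0 else depth d ((v - 1) / d) + 1
termination_by v
decreasing_by exact lt_of_le_of_lt (Nat.div_le_self _ _) (by omega)

theorem depth_zero (d : ℕ) : depth d 0 = 0 := by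
  rw [depth, dif_pos rfl]

theorem depth_child {d p j : ℕ} (hj : j < d) : depth d (p * d + j + 1) = depth d p + 1 := by
  rw [depth, dif_neg (by omega), div_child hj]

/-- The color of a vertex of the tree of a clause with a true literal `m`. -/
def color (k : ℕ) (φ : Clause) (m v : ℕ) : ℕ :=
  if v = 0 then slots k - 4 + m else
    let p := (v - 1) / slots k
    let j := (v - 1) % slots k
    if p = 0 then
      if j + 4 < slots k then slots k + depth (slots k) v % 2
      else if j = slots k - 4 + m then φ.color m else j
    else if Light k φ ((p - 1) / slots k) ((p - 1) % slots k) j then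
      slots k + depth (slots k) v % 2
    else j

theorem color_zero (m : ℕ) : color k φ m 0 = slots k - 4 + m := rfl

theorem color_child {m j : ℕ} (hj : j < slots k) : color k φ m (j + 1) =
    if j + 4 < slots k then slots k + 1
      else if j = slots k - 4 + m then φ.color m else j := by
  have h1 := div_child (p := 0) hj
  have h2 := mod_child (p := 0) hj
  have h3 := depth_child (p := 0) hj
  rw [Nat.zero_mul, Nat.zero_add] at h1 h2 h3
  rw [color, if_neg (by omega)]
  simp only [h1, h2, if_true, h3, depth_zero]

theorem color_grandchild {m p j' j : ℕ} (hj' : j' < slots k) (hj : j < slots k) :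
    color k φ m ((p * slots k + j' + 1) * slots k + j + 1) =
      if Light k φ p j' j then slots k + depth (slots k) p % 2 else j := by
  rw [color, if_neg (by omega)]
  simp only [div_child hj, mod_child hj, div_child hj', mod_child hj', depth_child hj,
    depth_child hj']
  rw [if_neg (by omega)]
  have : (depth (slots k) p + 1 + 1) % 2 = depth (slots k) p % 2 := by omega
  rw [this]

theorem Clause.color_lt (hi : φ.i ≤ k) (hj : φ.j ≤ k) (m : ℕ) : φ.color m + 4 < slots k := by
  unfold Clause.color slots
  split <;> omega

/-- The vertex of the true literal `m` moves to the color of the literal, which no child of it uses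
because the child in that slot is light. This frees the spare color for the root. A light vertex can
have a light child in the same slot, hence two light colors alternating with the depth. -/
theorem color_ne_child (hi : φ.i ≤ k) (hj : φ.j ≤ k) {m : ℕ} (hm : m < 4) (p : ℕ) {j : ℕ}
    (hjd : j < slots k) : color k φ m p ≠ color k φ m (p * slots k + j + 1) := by
  have hc := Clause.color_lt hi hj m
  rcases vertex_cases (slots_pos (k := k)) p with rfl | ⟨j', hj', rfl⟩ |
    ⟨p, j'', j', hj'', hj', rfl⟩
  · rw [Nat.zero_mul, Nat.zero_add, color_zero, color_child hjd]
    split_ifs <;> omega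
  · have := color_grandchild (φ := φ) (m := m) (p := 0) hj' hjd
    rw [Nat.zero_mul, Nat.zero_add, depth_zero] at this
    rw [this, color_child hj']
    have hl : Light k φ 0 j' j ↔
      (j = j' ∨ 0 = 0 ∧ slots k ≤ j' + 4 ∧ j = φ.color (j' + 4 - slots k)) := Iff.rfl
    by_cases hj'm : j' = slots k - 4 + m
    · have e : j' + 4 - slots k = m := by unfold slots at *; omega
      rw [e] at hl
      rw [if_neg (by omega), if_pos hj'm]
      split_ifs with h <;> rw [hl] at h <;> omega
    · rw [if_neg hj'm]
      split_ifs with h1 h2 h2 <;> rw [hl] at h2 <;> omega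
  · rw [color_grandchild hj' hjd, color_grandchild hj'' hj', depth_child hj'']
    have hl : Light k φ (p * slots k + j'' + 1) j' j ↔ j = j' :=
      ⟨fun h => h.elim id fun h => by omega, Or.inl⟩
    simp only [hl]
    split_ifs <;> omega

/-- The weight of a color in the coloring that belongs to `s`. -/
def cap (k n : ℕ) (s : ℕ → ℕ) (y : ℕ) : ℕ :=
  if y < slots k then heavy k n y (if y < 2 * (k + 1) then s y else 0) else 1

theorem heavy_mono {y a b : ℕ} (h : a ≤ b) : heavy k n y a ≤ heavy k n y b := by
  unfold heavy
  gcongr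

/-- The vertex of a literal that is not selected fits into its spare color: thresholds are at most
`n + 2`, so the slack part at most doubles the weight `2 ^ y * base k n`. -/
theorem heavy_le_two_pow {y a j : ℕ} (ha : a ≤ n + 2) (hy : y < j) :
    heavy k n y a ≤ 2 ^ j * base k n := by
  have h1 : 4 ^ (y / 2) ≤ 2 ^ y := by
    rw [show 4 = 2 ^ 2 by norm_num, ← pow_mul]
    exact Nat.pow_le_pow_right (by omega) (by omega)
  have h2 : 3 * a ≤ base k n := by
    have h4 : 4 ≤ scale k := by
      unfold scale
      calc 4 = 2 ^ 2 := rfl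
        _ ≤ _ := Nat.pow_le_pow_right (by omega) (by omega)
    have := Nat.mul_le_mul_right (n + 3) h4
    unfold base
    omega
  have h3 : 2 ^ (y + 1) ≤ 2 ^ j := Nat.pow_le_pow_right (by omega) hy
  have h4 := Nat.mul_le_mul_right (base k n) h3
  have h5 := Nat.mul_le_mul h1 h2
  unfold heavy
  rw [pow_succ] at h4
  linarith

theorem weight_le_cap (hi : φ.i ≤ k) (hj : φ.j ≤ k) (ht : ∀ m < 4, φ.thresh m ≤ n + 2)
    {s : ℕ → ℕ} {m : ℕ} (hm : m < 4) (hs : φ.thresh m ≤ s (φ.color m)) (v : ℕ) :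
    weight k n φ v ≤ cap k n s (color k φ m v) := by
  have hc := Clause.color_lt hi hj
  have hpow : ∀ j < slots k, 2 ^ j * base k n ≤ cap k n s j := fun j hj => by
    rw [cap, if_pos hj]
    exact Nat.le_add_right _ _
  have hd : slots k = 2 * k + 6 := rfl
  have hlight : ∀ i, 1 ≤ cap k n s (slots k + i) := fun i => by
    rw [cap, if_neg (by omega)]
  rcases vertex_cases (slots_pos (k := k)) v with rfl | ⟨j, hjd, rfl⟩ | ⟨p, j', j, hj', hjd, rfl⟩
  · rw [weight_zero, color_zero]
    exact (Nat.mul_le_mul_right _ (Nat.pow_le_pow_right (by omega) (by omega))).trans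
      (hpow _ (by omega))
  · rw [weight_child hjd, color_child hjd]
    split_ifs with h1 h2
    · exact hlight 1
    · subst h2
      rw [show slots k - 4 + m + 4 - slots k = m by omega]
      have := hc m
      rw [cap, if_pos (by omega), if_pos (by omega)]
      exact heavy_mono hs
    · have := hc (j + 4 - slots k)
      exact (heavy_le_two_pow (ht _ (by omega)) (by omega)).trans (hpow j hjd)
  · rw [weight_grandchild hj' hjd, color_grandchild hj' hjd]
    split_ifs with h1
    · exact hlight _
    · exact hpow j hjd

theorem color_lt (hi : φ.i ≤ k) (hj : φ.j ≤ k) {m : ℕ} (hm : m < 4) (v : ℕ) :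
    color k φ m v < slots k + 2 := by
  have hc := Clause.color_lt hi hj
  have hd : slots k = 2 * k + 6 := rfl
  rcases vertex_cases (slots_pos (k := k)) v with rfl | ⟨j, hjd, rfl⟩ | ⟨p, j', j, hj', hjd, rfl⟩
  · rw [color_zero]
    omega
  · rw [color_child hjd]
    have := hc m
    split_ifs <;> omega
  · rw [color_grandchild hj' hjd]
    split_ifs <;> omega

/-- The two light colors use up the summand 2 of the bound. -/
theorem sum_cap {s : ℕ → ℕ}
    (hs : ∑ y ∈ Finset.range (2 * (k + 1)), 3 * 4 ^ (y / 2) * s y ≤ (scale k - 1) * n) :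
    ∑ y ∈ Finset.range (slots k + 2), cap k n s y ≤ bound k n := by
  have h0 : ∑ y ∈ Finset.range (slots k), cap k n s y =
      ∑ y ∈ Finset.range (slots k), 2 ^ y * base k n +
        ∑ y ∈ Finset.range (slots k), if y < 2 * (k + 1) then 3 * 4 ^ (y / 2) * s y else 0 := by
    rw [← Finset.sum_add_distrib]
    refine Finset.sum_congr rfl fun y hy => ?_
    rw [cap, if_pos (Finset.mem_range.1 hy), heavy]
    split_ifs <;> simp
  have h1 : ∑ y ∈ Finset.range (slots k), (if y < 2 * (k + 1) then 3 * 4 ^ (y / 2) * s y else 0) =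
      ∑ y ∈ Finset.range (2 * (k + 1)), 3 * 4 ^ (y / 2) * s y := by
    rw [← Finset.sum_filter]
    congr 1
    ext y
    simp only [Finset.mem_filter, Finset.mem_range, slots]
    omega
  have h2 := congrArg (· * base k n) (sum_two_pow 0 (slots k) (Nat.zero_le _))
  simp only [add_mul, ← Finset.range_eq_Ico, pow_zero, one_mul] at h2
  rw [Finset.sum_mul] at h2
  have h3 := bound_eq (k := k) (n := n)
  have h4 : cap k n s (slots k) = 1 := if_neg (by omega)
  have h5 : cap k n s (slots k + 1) = 1 := if_neg (by omega)
  rw [Finset.sum_range_succ, Finset.sum_range_succ, h4, h5, h0, h1]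
  omega

/-! ### The clauses of a graph -/

/-- One if the numbers are distinct, and zero otherwise. -/
def neq (i j : ℕ) : ℕ := 1 - (1 - ((i - j) + (j - i)))

theorem neq_self (i : ℕ) : neq i i = 0 := by simp [neq]

theorem neq_of_ne {i j : ℕ} (h : i ≠ j) : neq i j = 1 := by unfold neq; omega

/-- The clauses of a graph with `n` vertices and the edges `E`. If `s (2 i + 1) + s (2 i) = n`
then the vertex number `s (2 i + 1) - 1` is chosen by `i`. -/
def clauses (k n : ℕ) (E : List (ℕ × ℕ)) : List Clause :=
  ((List.range (k + 1)).flatMap fun i => (List.range (n + 1)).flatMap fun u =>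
    [⟨i, u, n + 1 - u, i, u, n + 1 - u⟩]) ++
  ((List.range k).flatMap fun i => [⟨i, 1, n + 1, i, 1, n + 1⟩]) ++
  ((List.range k).flatMap fun i => (List.range k).flatMap fun j => (List.range n).flatMap fun x =>
    [⟨i, (x + 2) * neq i j, (n - x) * neq i j, j, (x + 2) * neq i j, (n - x) * neq i j⟩]) ++
  E.flatMap fun e => (List.range k).flatMap fun i => (List.range k).flatMap fun j =>
    [⟨i, e.1 + 2, n - e.1, j, e.2 + 2, n - e.2⟩, ⟨i, e.2 + 2, n - e.2, j, e.1 + 2, n - e.1⟩]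

/-- Of the two clauses of an edge for `i` and `j`, the second is the first one for `j` and `i` in
another order. Listing both makes the number of clauses depend on `2 * E.length`, which is the
number of end marks that the program counts. -/
theorem length_clauses (k n : ℕ) (E : List (ℕ × ℕ)) : (clauses k n E).length =
    (k + 1) * (n + 1) + k + k * (k * n) + 2 * E.length * (k * k) := by
  simp [clauses, List.length_flatMap]
  ring

theorem Clause.holds_iff {s : ℕ → ℕ} : φ.Holds s ↔ φ.a ≤ s (2 * φ.i + 1) ∨ φ.b ≤ s (2 * φ.i) ∨
    φ.c ≤ s (2 * φ.j + 1) ∨ φ.e ≤ s (2 * φ.j) := by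
  constructor
  · rintro ⟨m, hm, h⟩
    match m, hm with
    | 0, _ => exact Or.inl h
    | 1, _ => exact Or.inr (Or.inl h)
    | 2, _ => exact Or.inr (Or.inr (Or.inl h))
    | 3, _ => exact Or.inr (Or.inr (Or.inr h))
  · rintro (h | h | h | h)
    · exact ⟨0, by omega, h⟩
    · exact ⟨1, by omega, h⟩
    · exact ⟨2, by omega, h⟩
    · exact ⟨3, by omega, h⟩

theorem clauses_bounds {E : List (ℕ × ℕ)} (hE : ∀ e ∈ E, e.1 < n ∧ e.2 < n) :
    ∀ φ ∈ clauses k n E, φ.i ≤ k ∧ φ.j ≤ k ∧ ∀ m < 4, φ.thresh m ≤ n + 2 := by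
  have key : ∀ φ : Clause, φ.a ≤ n + 2 → φ.b ≤ n + 2 → φ.c ≤ n + 2 → φ.e ≤ n + 2 →
      ∀ m < 4, φ.thresh m ≤ n + 2 := by
    intro φ h1 h2 h3 h4 m hm
    unfold Clause.thresh
    split <;> assumption
  have hneq : ∀ i j, neq i j ≤ 1 := fun i j => by unfold neq; omega
  intro φ hφ
  simp only [clauses, List.mem_append, List.mem_flatMap, List.mem_range, List.mem_cons,
    List.not_mem_nil, or_false] at hφ
  rcases hφ with ((⟨i, hi, u, hu, rfl⟩ | ⟨i, hi, rfl⟩) | ⟨i, hi, j, hj, x, hx, rfl⟩) |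
    ⟨e, he, i, hi, j, hj, rfl | rfl⟩
  · exact ⟨by simp only; omega, by simp only; omega, key _ (by simp only; omega)
      (by simp only; omega) (by simp only; omega) (by simp only; omega)⟩
  · exact ⟨by simp only; omega, by simp only; omega, key _ (by simp only; omega)
      (by simp only; omega) (by simp only; omega) (by simp only; omega)⟩
  · have h1 : (x + 2) * neq i j ≤ n + 2 :=
      (Nat.mul_le_mul_left _ (hneq i j)).trans (by omega)
    have h2 : (n - x) * neq i j ≤ n + 2 :=
      (Nat.mul_le_mul_left _ (hneq i j)).trans (by omega)
    exact ⟨by simp only; omega, by simp only; omega, key _ h1 h2 h1 h2⟩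
  · have := hE e he
    exact ⟨by simp only; omega, by simp only; omega, key _ (by simp only; omega)
      (by simp only; omega) (by simp only; omega) (by simp only; omega)⟩
  · have := hE e he
    exact ⟨by simp only; omega, by simp only; omega, key _ (by simp only; omega)
      (by simp only; omega) (by simp only; omega) (by simp only; omega)⟩

/-- The colors `2 * i` and `2 * i + 1` have the same unit, so only the sum of their slacks matters
for the bound. -/
theorem sum_pairs (f : ℕ → ℕ) (K : ℕ) : ∑ y ∈ Finset.range (2 * K), 3 * 4 ^ (y / 2) * f y =
    ∑ i ∈ Finset.range K, 3 * 4 ^ i * (f (2 * i + 1) + f (2 * i)) := by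
  induction K with
  | zero => rfl
  | succ K ih =>
    rw [show 2 * (K + 1) = 2 * K + 1 + 1 by ring, Finset.sum_range_succ, Finset.sum_range_succ, ih,
      Finset.sum_range_succ, show (2 * K + 1) / 2 = K by omega, show 2 * K / 2 = K by omega]
    ring

theorem sum_four_pow (K : ℕ) : ∑ i ∈ Finset.range K, 3 * 4 ^ i + 1 = 4 ^ K := by
  induction K with
  | zero => rfl
  | succ K ih =>
    rw [Finset.sum_range_succ, pow_succ]
    omega

theorem sum_scale : ∑ i ∈ Finset.range (k + 1), 3 * 4 ^ i * n = (scale k - 1) * n := by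
  rw [← Finset.sum_mul]
  have h1 := sum_four_pow (k + 1)
  have h2 : scale k = 4 ^ (k + 1) := by
    rw [scale, show 4 = 2 ^ 2 by norm_num, ← pow_mul]
    congr 1
  rw [h2]
  congr 1
  omega

/-- The bound on the slack turns the inequalities `n ≤ s (2 * i + 1) + s (2 * i)` into equalities.
Then `n - x ≤ s (2 * i)` says `s (2 * i + 1) ≤ x`, and together with `x + 2 ≤ s (2 * i + 1)` it
excludes exactly the value `x + 1`, that is, the vertex `x`. -/
theorem exists_choice {E : List (ℕ × ℕ)} {s : ℕ → ℕ}
    (hs : ∑ y ∈ Finset.range (2 * (k + 1)), 3 * 4 ^ (y / 2) * s y ≤ (scale k - 1) * n + 2)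
    (hE : ∀ e ∈ E, e.1 < n ∧ e.2 < n)
    (h : ∀ φ ∈ clauses k n E, φ.Holds s) : ∃ f : ℕ → ℕ, (∀ i < k, f i < n) ∧
      (∀ i < k, ∀ j < k, i ≠ j → f i ≠ f j) ∧
      ∀ e ∈ E, ∀ i < k, ∀ j < k, ¬ (f i = e.1 ∧ f j = e.2) := by
  simp only [clauses, List.mem_append, List.mem_flatMap, List.mem_range, List.mem_cons,
    List.not_mem_nil, or_false] at h
  have hge : ∀ i < k + 1, n ≤ s (2 * i + 1) + s (2 * i) := by
    intro i hi
    by_contra! hlt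
    -- The clause for `u = s (2 * i + 1) + 1`, the least `u` for which the first literal is false.
    have := h _ (Or.inl (Or.inl (Or.inl ⟨i, hi, s (2 * i + 1) + 1, by omega, rfl⟩)))
    rw [Clause.holds_iff] at this
    simp only at this
    omega
  have heq : ∀ i < k + 1, s (2 * i + 1) + s (2 * i) = n := by
    intro i hi
    by_contra hne
    have h1 := hge i hi
    rw [sum_pairs, ← sum_scale] at hs
    -- An excess in the pair `i` costs at least one unit `3 * 4 ^ i ≥ 3`, but only 2 is left; this
    -- is why the units carry the factor 3.
    have h2 : ∑ j ∈ Finset.range (k + 1), (3 * 4 ^ j * n + if j = i then 3 else 0) ≤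
        ∑ j ∈ Finset.range (k + 1), 3 * 4 ^ j * (s (2 * j + 1) + s (2 * j)) := by
      refine Finset.sum_le_sum fun j hj => ?_
      have h3 := hge j (Finset.mem_range.1 hj)
      have h4 : 1 ≤ 4 ^ j := Nat.one_le_pow _ _ (by omega)
      split_ifs with hji
      · subst hji
        have : 3 * 4 ^ j * (n + 1) ≤ 3 * 4 ^ j * (s (2 * j + 1) + s (2 * j)) :=
          Nat.mul_le_mul_left _ (by omega)
        linarith
      · exact Nat.mul_le_mul_left _ h3
    rw [Finset.sum_add_distrib, Finset.sum_ite_eq' (Finset.range (k + 1)) i,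
      if_pos (Finset.mem_range.2 hi)] at h2
    omega
  have hpos : ∀ i < k, 1 ≤ s (2 * i + 1) := by
    intro i hi
    have h1 := heq i (by omega)
    have := h _ (Or.inl (Or.inl (Or.inr ⟨i, hi, rfl⟩)))
    rw [Clause.holds_iff] at this
    simp only at this
    omega
  refine ⟨fun i => s (2 * i + 1) - 1, fun i hi => ?_, fun i hi j hj hij he => ?_,
    fun e he i hi j hj hij => ?_⟩
  · have := hpos i hi
    have := heq i (by omega)
    beta_reduce
    omega
  · have h1 := hpos i hi
    have h2 := heq i (by omega)
    have h3 := hpos j hj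
    have h4 := heq j (by omega)
    -- The clause for the supposed common value `x` of `i` and `j`.
    have := h _ (Or.inl (Or.inr ⟨i, hi, j, hj, s (2 * i + 1) - 1, by omega, rfl⟩))
    rw [Clause.holds_iff, neq_of_ne hij] at this
    simp only at this he
    omega
  · have h0 := hE e he
    have h1 := hpos i hi
    have h2 := heq i (by omega)
    have h3 := hpos j hj
    have h4 := heq j (by omega)
    have := h _ (Or.inr ⟨e, he, i, hi, j, hj, Or.inl rfl⟩)
    rw [Clause.holds_iff] at this
    simp only at this hij
    omega

/-- The pair `i < k` stores `f i + 1` and its complement to `n`; the unused pair `i = k` stores 0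
and `n`. For `i = j` the factor `neq i j` turns the distinctness clause into a true one, since its
thresholds vanish. -/
theorem exists_slack_of_choice {E : List (ℕ × ℕ)} (hE : ∀ e ∈ E, e.1 < n ∧ e.2 < n ∧ e.1 ≠ e.2)
    {f : ℕ → ℕ} (hf : ∀ i < k, f i < n) (hf' : ∀ i < k, ∀ j < k, i ≠ j → f i ≠ f j)
    (hfE : ∀ e ∈ E, ∀ i < k, ∀ j < k, ¬ (f i = e.1 ∧ f j = e.2)) :
    ∃ s : ℕ → ℕ, ∑ y ∈ Finset.range (2 * (k + 1)), 3 * 4 ^ (y / 2) * s y ≤ (scale k - 1) * n ∧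
      ∀ φ ∈ clauses k n E, φ.Holds s := by
  let g : ℕ → ℕ := fun i => if i < k then f i + 1 else 0
  let s : ℕ → ℕ := fun y => if y % 2 = 1 then g (y / 2) else n - g (y / 2)
  have hg : ∀ i, g i ≤ n := fun i => by
    simp only [g]
    split_ifs with h
    · exact hf i h
    · omega
  have s1 : ∀ i, s (2 * i + 1) = g i := fun i => by
    simp only [s]
    rw [if_pos (by omega), show (2 * i + 1) / 2 = i by omega]
  have s2 : ∀ i, s (2 * i) = n - g i := fun i => by
    simp only [s]
    rw [if_neg (by omega), show 2 * i / 2 = i by omega]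
  have gk : ∀ i < k, g i = f i + 1 := fun i hi => if_pos hi
  refine ⟨s, ?_, fun φ hφ => ?_⟩
  · rw [sum_pairs, ← sum_scale]
    refine Finset.sum_le_sum fun i _ => Nat.mul_le_mul_left _ ?_
    have := hg i
    rw [s1, s2]
    omega
  · simp only [clauses, List.mem_append, List.mem_flatMap, List.mem_range, List.mem_cons,
      List.not_mem_nil, or_false] at hφ
    rw [Clause.holds_iff]
    rcases hφ with ((⟨i, hi, u, hu, rfl⟩ | ⟨i, hi, rfl⟩) | ⟨i, hi, j, hj, x, hx, rfl⟩) |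
      ⟨e, he, i, hi, j, hj, rfl | rfl⟩
    · have := hg i
      simp only [s1, s2]
      omega
    · have := gk i hi
      simp only [s1, s2]
      omega
    · have h1 := gk i hi
      have h2 := gk j hj
      have h3 := hg i
      have h4 := hg j
      simp only [s1, s2]
      rcases eq_or_ne i j with rfl | hij
      · simp [neq_self]
      · have := hf' i hi j hj hij
        rw [neq_of_ne hij]
        omega
    · have h1 := gk i hi
      have h2 := gk j hj
      have h3 := hfE e he i hi j hj
      have h4 := hE e he
      have h5 := hg i
      have h6 := hg j
      simp only [s1, s2]
      omega
    · have h1 := gk i hi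
      have h2 := gk j hj
      have h3 := hfE e he j hj i hi
      have h4 := hE e he
      have h5 := hg i
      have h6 := hg j
      simp only [s1, s2]
      omega

end Gadget

/-! ### The weighted forest of a graph -/

/-- The largest vertex of a cycle has two different neighbors on the cycle, both of them smaller. -/
theorem isAcyclic_of_unique_lower {V : Type*} [LinearOrder V] {G : SimpleGraph V}
    (h : ∀ v u u', G.Adj v u → G.Adj v u' → u < v → u' < v → u = u') : G.IsAcyclic := by
  intro v c hc
  obtain ⟨m, hm, hmax⟩ := c.support.toFinset.exists_max_image id ⟨v, by simp⟩
  simp only [List.mem_toFinset, id] at hm hmax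
  have hc' := hc.rotate hm
  have hnil : ¬ (c.rotate m hm).Nil := hc'.not_nil
  have h1 := SimpleGraph.Walk.adj_snd hnil
  have h2 := SimpleGraph.Walk.adj_penultimate hnil
  have hle : ∀ i, (c.rotate m hm).getVert i ≤ m := fun i =>
    hmax _ ((c.mem_support_rotate_iff m hm).1 ((c.rotate m hm).getVert_mem_support i))
  exact hc'.snd_ne_penultimate (h m _ _ h1 h2.symm (lt_of_le_of_ne (hle _) h1.ne')
    (lt_of_le_of_ne (hle _) h2.ne))

theorem sup_natCast {V : Type*} (s : Finset V) (w : V → ℕ) :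
    (s.sup fun v => ((w v : ℕ) : ℝ≥0)) = ((s.sup w : ℕ) : ℝ≥0) := by
  classical
  induction s using Finset.induction with
  | empty => simp
  | insert a s _ ih => rw [Finset.sup_insert, Finset.sup_insert, ih, Nat.cast_max]

/-- All weights of colorings are natural numbers, so an infimum below `M + 1` yields a coloring of
weight at most `M`. -/
theorem weightedChromaticNumber_le_iff {V : Type} [Fintype V] (G : SimpleGraph V) (w : V → ℕ)
    (M : ℕ) : weightedChromaticNumber G (fun v => ((w v : ℕ) : ℝ≥0)) ≤ (M : ℝ≥0) ↔
      ∃ (r : ℕ) (c : G.Coloring (Fin r)),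
        ∑ i, (Finset.univ.filter fun v => c v = i).sup w ≤ M := by
  have key : ∀ (r : ℕ) (c : G.Coloring (Fin r)),
      coloringWeight G (fun v => ((w v : ℕ) : ℝ≥0)) c =
        ((∑ i, (Finset.univ.filter fun v => c v = i).sup w : ℕ) : ℝ≥0) := by
    intro r c
    simp only [coloringWeight, colorWeight, sup_natCast, Nat.cast_sum]
  constructor
  · intro h
    have hne : {x | ∃ (r : ℕ) (c : G.Coloring (Fin r)),
        coloringWeight G (fun v => ((w v : ℕ) : ℝ≥0)) c = x}.Nonempty :=
      ⟨_, Fintype.card V, SimpleGraph.Coloring.mk (Fintype.equivFin V)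
        fun hab he => hab.ne ((Fintype.equivFin V).injective he), rfl⟩
    have hlt : weightedChromaticNumber G (fun v => ((w v : ℕ) : ℝ≥0)) < ((M + 1 : ℕ) : ℝ≥0) :=
      lt_of_le_of_lt h (by exact_mod_cast Nat.lt_succ_self M)
    obtain ⟨x, ⟨r, c, rfl⟩, hx⟩ := exists_lt_of_csInf_lt hne hlt
    rw [key] at hx
    exact ⟨r, c, Nat.lt_succ_iff.1 (by exact_mod_cast hx)⟩
  · rintro ⟨r, c, h⟩
    refine le_trans (csInf_le (OrderBot.bddBelow _) ⟨r, c, rfl⟩) ?_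
    rw [key]
    exact_mod_cast h

/-! ### Disjoint copies of the tree and their components. -/

namespace Gadget

variable {k n : ℕ}

/-- The edges of `C` copies of the tree. -/
def copyEdges (k C : ℕ) : List (ℕ × ℕ) :=
  (List.range C).flatMap fun c => (List.range (inner k)).flatMap fun p =>
    (List.range (slots k)).flatMap fun j =>
      [(c * treeSize k + p, c * treeSize k + (p * slots k + j + 1))]

/-- The vertex `p` is the parent of `v` in `C` copies of the tree. -/
def Parent (k C : ℕ) (u v : ℕ) : Prop := ∃ c < C, ∃ p < inner k, ∃ j < slots k,
  u = c * treeSize k + p ∧ v = c * treeSize k + (p * slots k + j + 1)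

theorem mem_copyEdges {C u v : ℕ} : (u, v) ∈ copyEdges k C ↔ Parent k C u v := by
  simp only [copyEdges, Parent, List.mem_flatMap, List.mem_range, List.mem_singleton,
    Prod.mk.injEq]

theorem vert_lt {C c v : ℕ} (hc : c < C) (hv : v < treeSize k) :
    c * treeSize k + v < C * treeSize k := by
  have := Nat.mul_le_mul_right (treeSize k) (Nat.succ_le_of_lt hc)
  rw [Nat.succ_mul] at this
  omega

theorem lt_child {k p : ℕ} (j : ℕ) : p < p * slots k + j + 1 := by
  have := Nat.mul_le_mul_left p (Nat.succ_le_of_lt (slots_pos (k := k)))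
  omega

theorem vert_div {c v : ℕ} (hv : v < treeSize k) : (c * treeSize k + v) / treeSize k = c := by
  rw [Nat.mul_comm, Nat.mul_add_div (by omega), Nat.div_eq_of_lt hv, Nat.add_zero]

theorem vert_mod {c v : ℕ} (hv : v < treeSize k) : (c * treeSize k + v) % treeSize k = v := by
  rw [Nat.mul_comm, Nat.mul_add_mod, Nat.mod_eq_of_lt hv]

namespace Parent

variable {C u v : ℕ}

theorem lt (h : Parent k C u v) : u < v := by
  obtain ⟨c, _, p, _, j, _, rfl, rfl⟩ := h
  have := lt_child (k := k) (p := p) j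
  omega

theorem right_lt (h : Parent k C u v) : v < C * treeSize k := by
  obtain ⟨c, hc, p, hp, j, hj, rfl, rfl⟩ := h
  exact vert_lt hc (child_lt_treeSize hp hj)

theorem unique {u' : ℕ} (h : Parent k C u v) (h' : Parent k C u' v) : u = u' := by
  obtain ⟨c, hc, p, hp, j, hj, rfl, rfl⟩ := h
  obtain ⟨c', hc', p', hp', j', hj', rfl, h⟩ := h'
  have h1 := child_lt_treeSize hp hj
  have h2 := child_lt_treeSize hp' hj'
  have h3 := congrArg (· / treeSize k) h
  have h4 := congrArg (· % treeSize k) h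
  simp only [vert_div h1, vert_div h2] at h3
  simp only [vert_mod h1, vert_mod h2] at h4
  have h5 := congrArg (fun x => (x - 1) / slots k) h4
  simp only [div_child hj, div_child hj'] at h5
  rw [h3, h5]

theorem div_eq (h : Parent k C u v) : u / treeSize k = v / treeSize k := by
  obtain ⟨c, hc, p, hp, j, hj, rfl, rfl⟩ := h
  rw [vert_div (child_lt_treeSize hp hj),
    vert_div ((lt_child j).trans (child_lt_treeSize hp hj))]

/-- `treeSize k = 1 + inner k * slots k`, so every number other than that of the root is the number
of a child of an internal vertex. -/
theorem exists_of_mod_ne (hv : v < C * treeSize k) (h : v % treeSize k ≠ 0) :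
    ∃ u, Parent k C u v := by
  have h0 : 0 < treeSize k := by unfold treeSize; omega
  have hd := slots_pos (k := k)
  have hm := Nat.mod_lt v h0
  refine ⟨_, v / treeSize k, Nat.div_lt_of_lt_mul (by rwa [Nat.mul_comm]),
    (v % treeSize k - 1) / slots k, ?_, (v % treeSize k - 1) % slots k, Nat.mod_lt _ hd, rfl, ?_⟩
  · rw [Nat.div_lt_iff_lt_mul hd]
    unfold inner
    unfold treeSize at hm h ⊢
    have : (1 + (1 + width k) * slots k) * slots k =
        slots k + (1 + width k) * (slots k * slots k) := by ring
    omega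
  · rw [Nat.div_add_mod', Nat.sub_add_cancel (by omega), Nat.div_add_mod']

end Parent

/-- The forest of `C` copies of the tree. -/
def forestData (k C : ℕ) : GraphData where
  n := C * treeSize k
  edges := (copyEdges k C).pmap (fun e h => (⟨e.1, h.lt.trans h.right_lt⟩, ⟨e.2, h.right_lt⟩))
    (fun e he => mem_copyEdges.1 he : ∀ e ∈ copyEdges k C, Parent k C e.1 e.2)
  loopless e he := by
    obtain ⟨a, ha, rfl⟩ := List.mem_pmap.1 he
    intro h
    exact (mem_copyEdges.1 ha).lt.ne (congrArg Fin.val h)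

theorem mem_forestData_edges {C : ℕ} {u v : Fin (forestData k C).n} :
    (u, v) ∈ (forestData k C).edges ↔ Parent k C u v := by
  constructor
  · intro h
    obtain ⟨a, ha, h⟩ := List.mem_pmap.1 h
    have h1 : a.1 = u := congrArg (fun x => (x.1 : ℕ)) h
    have h2 : a.2 = v := congrArg (fun x => (x.2 : ℕ)) h
    rw [← h1, ← h2]
    exact mem_copyEdges.1 ha
  · intro h
    exact List.mem_pmap.2 ⟨(u, v), mem_copyEdges.2 h, rfl⟩

theorem forestData_adj {C : ℕ} {u v : Fin (forestData k C).n} :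
    (forestData k C).graph.Adj u v ↔ Parent k C u v ∨ Parent k C v u := by
  rw [GraphData.graph, SimpleGraph.fromRel_adj, mem_forestData_edges, mem_forestData_edges]
  refine ⟨fun h => h.2, fun h => ⟨?_, h⟩⟩
  rintro rfl
  rcases h with h | h <;> exact lt_irrefl _ h.lt

theorem forestData_isAcyclic (C : ℕ) : (forestData k C).graph.IsAcyclic := by
  refine isAcyclic_of_unique_lower fun v u u' h h' hu hu' => Fin.ext ?_
  rw [forestData_adj] at h h'
  have hu : (u : ℕ) < v := hu
  have hu' : (u' : ℕ) < v := hu'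
  rcases h with h | h
  · exact absurd h.lt (by omega)
  · rcases h' with h' | h'
    · exact absurd h'.lt (by omega)
    · exact h.unique h'

/-- Edges stay inside a copy, and going to parents leads to the root, the multiple of `treeSize k`
in the copy. -/
theorem forestData_reachable {C : ℕ} {u v : Fin (forestData k C).n} :
    (forestData k C).graph.Reachable u v ↔ (u : ℕ) / treeSize k = (v : ℕ) / treeSize k := by
  constructor
  · rintro ⟨p⟩
    induction p with
    | nil => rfl
    | cons h _ ih =>
      rw [← ih]
      rcases forestData_adj.1 h with h | h
      · exact h.div_eq
      · exact h.div_eq.symm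
  · have h0 : 0 < treeSize k := by unfold treeSize; omega
    have root : ∀ (m : ℕ) (v : Fin (forestData k C).n), (v : ℕ) = m →
        ∀ (r : Fin (forestData k C).n), (r : ℕ) = m / treeSize k * treeSize k →
        (forestData k C).graph.Reachable v r := by
      intro m
      induction m using Nat.strong_induction_on with
      | _ m ih =>
        intro v hv r hr
        by_cases hm : m % treeSize k = 0
        · have : v = r := Fin.ext (by
            rw [hr, hv, ← Nat.div_add_mod' m (treeSize k), hm]
            simp [h0])
          rw [this]
        · obtain ⟨u, hu⟩ := Parent.exists_of_mod_ne (k := k) (C := C) (v := m)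
            (hv ▸ v.isLt) hm
          have hu' := hu.lt
          let w : Fin (forestData k C).n := ⟨u, hu.lt.trans hu.right_lt⟩
          refine SimpleGraph.Reachable.trans (v := w) (SimpleGraph.Adj.reachable ?_)
            (ih u hu' w rfl r (by rw [hr, hu.div_eq]))
          rw [forestData_adj, hv]
          exact Or.inr hu
    intro h
    have hr : (v : ℕ) / treeSize k * treeSize k < (forestData k C).n :=
      lt_of_le_of_lt (Nat.div_mul_le_self _ _) v.isLt
    exact (root u u rfl ⟨_, hr⟩ (by rw [h])).trans (root v v rfl ⟨_, hr⟩ rfl).symm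

theorem largestComponentSize_forestData {C : ℕ} (hC : 0 < C) :
    largestComponentSize (forestData k C).graph = treeSize k := by
  have h0 : 0 < treeSize k := by unfold treeSize; omega
  have key : ∀ v : Fin (forestData k C).n,
      ((forestData k C).graph.connectedComponentMk v).supp.ncard = treeSize k := by
    intro v
    have hc : (v : ℕ) / treeSize k < C := Nat.div_lt_of_lt_mul (by
      rw [Nat.mul_comm]; exact v.isLt)
    let f : Fin (treeSize k) → Fin (forestData k C).n := fun i =>
      ⟨(v : ℕ) / treeSize k * treeSize k + i, vert_lt hc i.isLt⟩
    have hf : Function.Injective f := fun a b h => Fin.ext (by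
      have := congrArg Fin.val h
      simp only [f] at this
      omega)
    have hs : ((forestData k C).graph.connectedComponentMk v).supp = f '' Set.univ := by
      ext w
      rw [SimpleGraph.ConnectedComponent.mem_supp_iff, SimpleGraph.ConnectedComponent.eq,
        forestData_reachable]
      constructor
      · intro h
        refine ⟨⟨(w : ℕ) % treeSize k, Nat.mod_lt _ h0⟩, trivial, Fin.ext ?_⟩
        simp only [f]
        rw [← h, Nat.div_add_mod']
      · rintro ⟨i, _, rfl⟩
        exact vert_div i.isLt
    rw [hs, Set.ncard_image_of_injective _ hf, Set.ncard_univ, Nat.card_eq_fintype_card,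
      Fintype.card_fin]
  have hne : (Finset.univ : Finset (Fin (forestData k C).n)).Nonempty :=
    ⟨⟨0, Nat.mul_pos hC h0⟩, Finset.mem_univ _⟩
  unfold largestComponentSize
  rw [Finset.sup_congr rfl fun v _ => key v, Finset.sup_const hne]

/-! ### The constructed instance and its equivalence with Independent Set. -/

/-- The edges of a graph as pairs of numbers. -/
def pairs (D : GraphData) : List (ℕ × ℕ) := D.edges.map fun e => (e.1.val, e.2.val)

theorem pairs_bounds (D : GraphData) : ∀ e ∈ pairs D, e.1 < D.n ∧ e.2 < D.n ∧ e.1 ≠ e.2 := by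
  intro e he
  obtain ⟨a, ha, rfl⟩ := List.mem_map.1 he
  exact ⟨a.1.isLt, a.2.isLt, fun h => D.loopless a ha (Fin.ext h)⟩

/-- The clause with a given index. -/
def clause (k n : ℕ) (E : List (ℕ × ℕ)) (c : ℕ) : Clause :=
  (clauses k n E).getD c ⟨0, 0, 0, 0, 0, 0⟩

theorem clause_mem {E : List (ℕ × ℕ)} {c : ℕ} (hc : c < (clauses k n E).length) :
    clause k n E c ∈ clauses k n E := by
  rw [clause, List.getD_eq_getElem _ _ hc]
  exact List.getElem_mem hc

theorem weight_pos (φ : Clause) (v : ℕ) : 0 < weight k n φ v := by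
  have hU : 0 < base k n := by unfold base scale; positivity
  have hheavy : ∀ y a, 0 < heavy k n y a := fun y a => by unfold heavy; positivity
  rcases vertex_cases (slots_pos (k := k)) v with rfl | ⟨j, hjd, rfl⟩ | ⟨p, j', j, hj', hjd, rfl⟩
  · rw [weight_zero]
    positivity
  · rw [weight_child hjd]
    split_ifs
    · exact one_pos
    · exact hheavy _ _
  · rw [weight_grandchild hj' hjd]
    split_ifs
    · exact one_pos
    · positivity

/-- The natural weights of the vertices. -/
def vertexWeight (k n : ℕ) (E : List (ℕ × ℕ)) (v : ℕ) : ℕ :=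
  weight k n (clause k n E (v / treeSize k)) (v % treeSize k)

/-- The weighted forest of an instance of Independent Set. -/
def instanceOf (I : GraphData × ℕ) : WeightedForestData where
  toGraphData := forestData I.2 (clauses I.2 I.1.n (pairs I.1)).length
  weight v := (vertexWeight I.2 I.1.n (pairs I.1) v : ℕ)
  weight_pos v := by
    exact_mod_cast weight_pos _ _
  isForest := forestData_isAcyclic _
  bound := (bound I.2 I.1.n : ℕ)

/-- The extra pair `i = k` matters here: for `k = 0` all other clauses disappear, and without a tree
the parameter would not be `treeSize k`. -/
theorem length_clauses_pos (E : List (ℕ × ℕ)) : 0 < (clauses k n E).length := by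
  rw [length_clauses]
  positivity

theorem yes_iff_coloring (I : GraphData × ℕ) : weightedForestColoringProblem.Yes (instanceOf I) ↔
    ∃ (r : ℕ) (c : (instanceOf I).graph.Coloring (Fin r)),
      ∑ i, (Finset.univ.filter fun v => c v = i).sup
        (fun v : Fin (instanceOf I).n => vertexWeight I.2 I.1.n (pairs I.1) v) ≤
        bound I.2 I.1.n := by
  rw [← weightedChromaticNumber_le_iff]
  simp only [weightedForestColoringProblem, instanceOf, NNRat.cast_natCast]
  exact Iff.rfl

/-- The condition may range over all `u` and `v`, equal or not, as there are no loops; it covers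
both orders of the ends of an edge. -/
theorem isIndepSet_iff (D : GraphData) (S : Finset (Fin D.n)) :
    D.graph.IsIndepSet (S : Set (Fin D.n)) ↔
      ∀ e ∈ pairs D, ∀ u ∈ S, ∀ v ∈ S, ¬ ((u : ℕ) = e.1 ∧ (v : ℕ) = e.2) := by
  constructor
  · rintro h e he u hu v hv ⟨h1, h2⟩
    obtain ⟨a, ha, rfl⟩ := List.mem_map.1 he
    obtain rfl : u = a.1 := Fin.ext h1
    obtain rfl : v = a.2 := Fin.ext h2
    have hne := D.loopless a ha
    exact h hu hv hne ((SimpleGraph.fromRel_adj _ _ _).2 ⟨hne, Or.inl ha⟩)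
  · intro h u hu v hv _ hadj
    rw [GraphData.graph, SimpleGraph.fromRel_adj] at hadj
    rcases hadj.2 with ha | ha
    · exact h _ (List.mem_map.2 ⟨_, ha, rfl⟩) u hu v hv ⟨rfl, rfl⟩
    · exact h _ (List.mem_map.2 ⟨_, ha, rfl⟩) v hv u hu ⟨rfl, rfl⟩

theorem yes_of_indepSet (I : GraphData × ℕ) (h : independentSetProblem.Yes I) :
    weightedForestColoringProblem.Yes (instanceOf I) := by
  obtain ⟨D, k⟩ := I
  obtain ⟨S, hS, hI⟩ : ∃ S : Finset (Fin D.n), k ≤ S.card ∧ D.graph.IsIndepSet S := h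
  rw [isIndepSet_iff] at hI
  have hlt : ∀ i : Fin k, (i : ℕ) < S.card := fun i => i.isLt.trans_le hS
  let g : ℕ → ℕ := fun i => if h : i < k then (S.equivFin.symm ⟨i, h.trans_le hS⟩).1.1 else 0
  have hg : ∀ i (h : i < k), g i = (S.equivFin.symm ⟨i, h.trans_le hS⟩).1.1 := fun i h => dif_pos h
  obtain ⟨s, hs, hφ⟩ := exists_slack_of_choice (k := k) (pairs_bounds D) (f := g)
    (fun i hi => by rw [hg i hi]; exact (S.equivFin.symm _).1.isLt)
    (fun i hi j hj hij he => by
      rw [hg i hi, hg j hj] at he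
      have := S.equivFin.symm.injective (Subtype.ext (Fin.ext he))
      exact hij (congrArg Fin.val this))
    (fun e he i hi j hj => by
      rw [hg i hi, hg j hj]
      exact hI e he _ (S.equivFin.symm _).2 _ (S.equivFin.symm _).2)
  set E := pairs D with hE
  set C := (clauses k D.n E).length with hC
  have hb := clauses_bounds (k := k) (E := E) fun e he =>
    ⟨(pairs_bounds D e he).1, (pairs_bounds D e he).2.1⟩
  have h0 : 0 < treeSize k := by unfold treeSize; omega
  -- Each tree is colored according to one true literal of its clause.
  choose! lit hlit using fun c (hc : c < C) => hφ _ (clause_mem hc)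
  rw [yes_iff_coloring]
  have hdiv : ∀ v : Fin (instanceOf (D, k)).n, (v : ℕ) / treeSize k < C := fun v =>
    Nat.div_lt_of_lt_mul (by rw [Nat.mul_comm]; exact v.isLt)
  let col : Fin (instanceOf (D, k)).n → Fin (slots k + 2) := fun v =>
    ⟨color k (clause k D.n E (v / treeSize k)) (lit (v / treeSize k)) (v % treeSize k),
      color_lt (hb _ (clause_mem (hdiv v))).1 (hb _ (clause_mem (hdiv v))).2.1
        (hlit _ (hdiv v)).1 _⟩
  have hpar : ∀ u v : Fin (instanceOf (D, k)).n, Parent k C u v → col u ≠ col v := by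
    rintro u v ⟨c, hc, p, hp, j, hj, hu, hv⟩ huv
    have h1 := child_lt_treeSize hp hj
    have h2 := (lt_child j).trans h1
    have huv := congrArg Fin.val huv
    simp only [col, hu, hv, vert_div h1, vert_div h2, vert_mod h1, vert_mod h2] at huv
    exact color_ne_child (hb _ (clause_mem hc)).1 (hb _ (clause_mem hc)).2.1
      (hlit _ hc).1 p hj huv
  refine ⟨slots k + 2, SimpleGraph.Coloring.mk col fun {u v} hadj => ?_, ?_⟩
  · rcases forestData_adj.1 hadj with h | h
    · exact hpar u v h
    · exact (hpar v u h).symm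
  · refine le_trans (Finset.sum_le_sum (g := fun i : Fin (slots k + 2) => cap k D.n s i)
      fun i _ => Finset.sup_le fun v hv => ?_) ?_
    · have hv : col v = i := (Finset.mem_filter.1 hv).2
      rw [← hv]
      have hm := clause_mem (hdiv v)
      exact weight_le_cap (hb _ hm).1 (hb _ hm).2.1 (hb _ hm).2.2 (hlit _ (hdiv v)).1
        (hlit _ (hdiv v)).2 _
    · rw [Fin.sum_univ_eq_sum_range (fun i => cap k D.n s i)]
      exact sum_cap hs

theorem indepSet_of_yes (I : GraphData × ℕ)
    (h : weightedForestColoringProblem.Yes (instanceOf I)) : independentSetProblem.Yes I := by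
  obtain ⟨D, k⟩ := I
  rw [yes_iff_coloring] at h
  obtain ⟨r, col, hcol⟩ := h
  simp only at hcol
  set E := pairs D with hE
  set C := (clauses k D.n E).length with hC
  have hC0 : 0 < C := length_clauses_pos E
  have hEb : ∀ e ∈ E, e.1 < D.n ∧ e.2 < D.n := fun e he =>
    ⟨(pairs_bounds D e he).1, (pairs_bounds D e he).2.1⟩
  have hb := clauses_bounds (k := k) hEb
  have h0 : 0 < treeSize k := by unfold treeSize; omega
  have hN : (instanceOf (D, k)).n = C * treeSize k := rfl
  have hpos : 0 < C * treeSize k := Nat.mul_pos hC0 h0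
  -- The vertex `0` is a default value; only numbers inside the forest are used below.
  let vert : ℕ → ℕ → Fin (instanceOf (D, k)).n := fun c v =>
    if h : c * treeSize k + v < C * treeSize k then ⟨_, h⟩ else ⟨0, hpos⟩
  have hvert : ∀ c < C, ∀ v < treeSize k, (vert c v : ℕ) = c * treeSize k + v :=
    fun c hc v hv => by
      simp only [vert]
      rw [dif_pos (vert_lt hc hv)]
  obtain ⟨s, hs, hφ⟩ := exists_slack hC0 (clause k D.n E) (fun c hc =>
    ⟨(hb _ (clause_mem hc)).1, (hb _ (clause_mem hc)).2.1⟩) (fun c v => col (vert c v)) _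
    (fun c hc p hp j hj => col.valid (forestData_adj.2 (Or.inl ⟨c, hc, p, hp, j, hj,
      hvert c hc p ((lt_child j).trans (child_lt_treeSize hp hj)),
      hvert c hc _ (child_lt_treeSize hp hj)⟩)))
    (fun c hc v hv => by
      refine le_trans ?_ (Finset.le_sup (Finset.mem_filter.2 ⟨Finset.mem_univ (vert c v), rfl⟩))
      rw [vertexWeight, hvert c hc v hv, vert_div hv, vert_mod hv]) hcol
  obtain ⟨f, hf, hf', hfE⟩ := exists_choice hs hEb (fun φ hmem => by
    obtain ⟨c, hc, rfl⟩ := List.getElem_of_mem hmem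
    have := hφ c hc
    rwa [clause, List.getD_eq_getElem _ _ hc] at this)
  refine ⟨Finset.univ.image fun i : Fin k => (⟨f i, hf i i.isLt⟩ : Fin D.n), ?_, ?_⟩
  · rw [Finset.card_image_of_injective, Finset.card_univ, Fintype.card_fin]
    intro i j hij
    by_contra hne
    exact hf' i i.isLt j j.isLt (fun h => hne (Fin.ext h)) (congrArg Fin.val hij)
  · refine (isIndepSet_iff D _).2 fun e he u hu v hv => ?_
    obtain ⟨i, _, rfl⟩ := Finset.mem_image.1 hu
    obtain ⟨j, _, rfl⟩ := Finset.mem_image.1 hv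
    exact hfE e he i i.isLt j j.isLt

end Gadget

/-! ### The program of the reduction -/

theorem flatMap_range_add {α : Type*} (a b : ℕ) (f : ℕ → List α) :
    (List.range (a + b)).flatMap f =
      (List.range a).flatMap f ++ (List.range b).flatMap fun i => f (a + i) := by
  rw [List.range_add, List.flatMap_append, List.flatMap_map]

theorem flatMap_range_one {α : Type*} (f : ℕ → List α) : (List.range 1).flatMap f = f 0 := by
  simp

theorem flatMap_range_mul {α : Type*} (a b : ℕ) (f : ℕ → List α) :
    (List.range (a * b)).flatMap f =
      (List.range a).flatMap fun i => (List.range b).flatMap fun j => f (i * b + j) := by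
  induction a with
  | zero => simp
  | succ a ih => rw [Nat.succ_mul, flatMap_range_add, ih, flatMap_range_add, flatMap_range_one,
      Nat.add_zero]

theorem flatMap_range_const {α : Type*} (n : ℕ) (a : α) :
    ((List.range n).flatMap fun _ => [a]) = List.replicate n a := by
  induction n with
  | zero => rfl
  | succ n ih => rw [flatMap_range_add, ih, List.replicate_add]; rfl

theorem flatMap_range_congr {α : Type*} {n : ℕ} {f g : ℕ → List α} (h : ∀ i < n, f i = g i) :
    (List.range n).flatMap f = (List.range n).flatMap g :=
  List.flatMap_congr fun i hi => h i (List.mem_range.1 hi)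

theorem ofFn_eq_map_range {α : Type*} (n : ℕ) (g : ℕ → α) :
    List.ofFn (fun i : Fin n => g i) = (List.range n).map g :=
  List.ext_getElem (by simp) fun i h1 h2 => by simp

theorem flatMap_range_getD {α β : Type*} (l : List α) (d : α) (f : α → List β) :
    ((List.range l.length).flatMap fun i => f (l.getD i d)) = l.flatMap f := by
  have : (List.range l.length).map (fun i => l.getD i d) = l :=
    List.ext_getElem (by simp) fun i h1 h2 => by simp [h2]
  conv_rhs => rw [← this, List.flatMap_map]

open Cmd
open Function (update)

/-- The two tokens of a natural number as a rational number. -/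
def natTokens (w : ℕ) : List Symb := binWord w ++ [mark, tally, mark]

/-- The loop language has no powers. A factor `2 ^ s` is written as `s` zeros in front, the least
significant digits, and only `u` is ever computed in unary. -/
theorem binWord_two_pow_mul {u : ℕ} (hu : 0 < u) (s : ℕ) :
    binWord (2 ^ s * u) = List.replicate s (some (some false)) ++ binWord u := by
  induction s with
  | zero => simp
  | succ s ih =>
    have h1 : 2 ^ (s + 1) * u / 2 = 2 ^ s * u := by
      rw [pow_succ', Nat.mul_assoc]; omega
    have h2 : 2 ^ (s + 1) * u % 2 = 0 := by
      rw [pow_succ', Nat.mul_assoc]; omega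
    rw [binWord_of_pos (by positivity), h1, h2, ih]
    rfl

theorem natTokens_one : natTokens 1 = [tally, mark, tally, mark] := by
  rw [natTokens, binWord_of_pos one_pos]
  rfl

namespace Expr

/-- Zero if and only if the expressions have the same value. -/
def dist (e f : Expr) : Expr := .add (.sub e f) (.sub f e)

/-- One if the expressions have distinct values, and zero otherwise. -/
def neq (e f : Expr) : Expr := .sub (.const 1) (.sub (.const 1) (dist e f))

theorem eval_neq (ρ : ℕ → ℕ) (e f : Expr) : (neq e f).eval ρ = Gadget.neq (e.eval ρ) (f.eval ρ) :=
  rfl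

theorem dist_inRange {e f : Expr} {v : ℕ} (he : e.InRange v) (hf : f.InRange v) :
    (dist e f).InRange v := ⟨⟨he, hf⟩, hf, he⟩

theorem InRange.mono {e : Expr} {v v' : ℕ} (h : e.InRange v) (hv : v ≤ v') : e.InRange v' := by
  induction e with
  | const n => trivial
  | var i => exact lt_of_lt_of_le h hv
  | add e f ihe ihf => exact ⟨ihe h.1, ihf h.2⟩
  | mul e f ihe ihf => exact ⟨ihe h.1, ihf h.2⟩
  | sub e f ihe ihf => exact ⟨ihe h.1, ihf h.2⟩

theorem eval_update {e : Expr} {v i : ℕ} (h : e.InRange v) (hv : v ≤ i) (ρ : ℕ → ℕ) (x : ℕ) :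
    e.eval (update ρ i x) = e.eval ρ :=
  eval_congr (fun j hj => Function.update_of_ne (by omega) _ _) h

end Expr

/-! ### Programs that write the weights and the edges of the forest. -/

namespace Gadget

/-- The number of slots. -/
def slotsE : Expr := .add (.mul (.const 2) (.var 0)) (.const 6)

/-- The smallest weight of a heavy color. -/
def baseE : Expr := .mul (.var 3) (.add (.var 1) (.const 3))

/-- The variables hold the parameters of the construction. -/
structure Params (k n : ℕ) (ρ : ℕ → ℕ) : Prop where
  h0 : ρ 0 = k
  h1 : ρ 1 = n
  h3 : ρ 3 = scale k
  h4 : ρ 4 = width k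

variable {k n : ℕ} {ρ : ℕ → ℕ} {v : ℕ}

theorem Params.update (h : Params k n ρ) {i : ℕ} (hi : 5 ≤ i) (x : ℕ) :
    Params k n (update ρ i x) := by
  constructor <;> rw [Function.update_of_ne (by omega)]
  exacts [h.h0, h.h1, h.h3, h.h4]

theorem Params.slots (h : Params k n ρ) : slotsE.eval ρ = slots k := by
  simp only [slotsE, Expr.eval, h.h0, Gadget.slots]

theorem Params.base (h : Params k n ρ) : baseE.eval ρ = base k n := by
  simp only [baseE, Expr.eval, h.h1, h.h3, Gadget.base]

theorem slotsE_inRange (hv : 5 ≤ v) : slotsE.InRange v := ⟨⟨trivial, by change 0 < v; omega⟩, trivial⟩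

theorem baseE_inRange (hv : 5 ≤ v) : baseE.InRange v :=
  ⟨by change 3 < v; omega, by change 1 < v; omega, trivial⟩

theorem base_pos : 0 < base k n := by unfold base scale; positivity

/-- Write a number `2 ^ s * u`. -/
def writeScaled (s u : Expr) : Stm :=
  .seq (.loop s (.emit [some (some false)])) (.seq (.bin u) (.emit [mark, tally, mark]))

theorem out_writeScaled {s u : Expr} (hu : 0 < u.eval ρ) :
    (writeScaled s u).out v ρ = natTokens (2 ^ s.eval ρ * u.eval ρ) := by
  simp only [writeScaled, Stm.out, flatMap_range_const, natTokens, binWord_two_pow_mul hu,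
    List.append_assoc]

theorem writeScaled_inRange {s u : Expr} (hs : s.InRange v) (hu : u.InRange v) :
    (writeScaled s u).InRange v := ⟨⟨hs, trivial⟩, hu, trivial⟩

/-- Write the number one. -/
def writeOne : Stm := .emit [tally, mark, tally, mark]

theorem out_writeOne : writeOne.out v ρ = natTokens 1 := natTokens_one.symm

/-- Write the weights of the children of a vertex in slot `j'`, where the slot `l` is not forced. -/
def writeRow (v : ℕ) (j' l : Expr) : Stm :=
  .loop slotsE (.seq
    (.loop (.sub (.const 1) (.mul (.dist (.var v) j') (.dist (.var v) l))) writeOne)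
    (.loop (.sub (.const 1) (.sub (.const 1) (.mul (.dist (.var v) j') (.dist (.var v) l))))
      (writeScaled (.var v) baseE)))

/-- Two loops with `1 - p` and `1 - (1 - p)` rounds act as a case distinction on `p = 0`, where `p`
is the product of the distances of `j` to the two light slots. -/
theorem out_writeRow {j' l : Expr} (h : Params k n ρ) (hv : 5 ≤ v) (hj : j'.InRange v)
    (hl : l.InRange v) : (writeRow v j' l).out v ρ = (List.range (slots k)).flatMap fun j =>
      natTokens (if j = j'.eval ρ ∨ j = l.eval ρ then 1 else 2 ^ j * base k n) := by
  rw [writeRow, Stm.out, h.slots]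
  refine flatMap_range_congr fun j _ => ?_
  have h' := h.update hv j
  have e1 : (Expr.mul (.dist (.var v) j') (.dist (.var v) l)).eval (update ρ v j) =
      ((j - j'.eval ρ) + (j'.eval ρ - j)) * ((j - l.eval ρ) + (l.eval ρ - j)) := by
    simp only [Expr.dist, Expr.eval, Function.update_self, Expr.eval_update hj le_rfl,
      Expr.eval_update hl le_rfl]
  simp only [Stm.out]
  have e2 : ∀ e : Expr, (Expr.sub (.const 1) e).eval (update ρ v j) = 1 - e.eval (update ρ v j) :=
    fun _ => rfl
  rw [e2, e2, e2, e1]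
  generalize hp : ((j - j'.eval ρ) + (j'.eval ρ - j)) * ((j - l.eval ρ) + (l.eval ρ - j)) = p
  have hp0 : p = 0 ↔ j = j'.eval ρ ∨ j = l.eval ρ := by
    rw [← hp, Nat.mul_eq_zero]
    omega
  by_cases hc : p = 0
  · rw [if_pos (hp0.1 hc), hc]
    simp [out_writeOne]
  · rw [if_neg (fun h => hc (hp0.2 h)), show 1 - p = 0 by omega]
    have h'' := h'.update (show 5 ≤ v + 1 by omega) 0
    simp only [Nat.sub_zero, flatMap_range_one, List.range_zero, List.flatMap_nil, List.nil_append]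
    rw [out_writeScaled (by rw [h''.base]; exact base_pos), h''.base, Expr.eval,
      Function.update_of_ne (by omega), Function.update_self]

theorem writeRow_inRange {j' l : Expr} (hv : 5 ≤ v) (hj : j'.InRange v) (hl : l.InRange v) :
    (writeRow v j' l).InRange v := by
  have hm : (Expr.mul (.dist (.var v) j') (.dist (.var v) l)).InRange (v + 1) :=
    ⟨Expr.dist_inRange (Nat.lt_succ_self v) (hj.mono (by omega)),
      Expr.dist_inRange (Nat.lt_succ_self v) (hl.mono (by omega))⟩
  exact ⟨slotsE_inRange hv, ⟨⟨trivial, hm⟩, trivial⟩, ⟨trivial, trivial, hm⟩,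
    writeScaled_inRange (show v < v + 1 + 1 by omega) (baseE_inRange (by omega))⟩

/-- Write the weight of a vertex with the color `2 * i + 1`, and then the weight of a vertex with
the color `2 * i`. -/
def writeLiterals (i a b : Expr) : Stm :=
  .seq (writeScaled (.mul (.const 2) i) (.add (.mul (.const 2) baseE) (.mul (.const 3) a)))
    (writeScaled (.mul (.const 2) i) (.add baseE (.mul (.const 3) b)))

/-- This is why the unit of slack contains `4 ^ (y / 2)`: the weights factor as `2 ^ (2 * i) * (2 *
U + 3 * a)` and `2 ^ (2 * i) * (U + 3 * b)`, with `U` for `base k n`, and can be written by zeros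
and a small factor. -/
theorem out_writeLiterals {i a b : Expr} (h : Params k n ρ) : (writeLiterals i a b).out v ρ =
    natTokens (heavy k n (2 * i.eval ρ + 1) (a.eval ρ)) ++
      natTokens (heavy k n (2 * i.eval ρ) (b.eval ρ)) := by
  have hb := base_pos (k := k) (n := n)
  have e : (4 : ℕ) = 2 ^ 2 := rfl
  rw [writeLiterals, Stm.out, out_writeScaled, out_writeScaled]
  · simp only [Expr.eval, h.base]
    congr 2
    · rw [heavy, show (2 * i.eval ρ + 1) / 2 = i.eval ρ by omega, e, ← pow_mul]
      ring
    · rw [heavy, show (2 * i.eval ρ) / 2 = i.eval ρ by omega, e, ← pow_mul]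
      ring
  · simp only [Expr.eval, h.base]; omega
  · simp only [Expr.eval, h.base]; omega

theorem writeLiterals_inRange {i a b : Expr} (hv : 5 ≤ v) (hi : i.InRange v) (ha : a.InRange v)
    (hb : b.InRange v) : (writeLiterals i a b).InRange v :=
  ⟨writeScaled_inRange ⟨trivial, hi⟩ ⟨⟨trivial, baseE_inRange hv⟩, trivial, ha⟩,
    writeScaled_inRange ⟨trivial, hi⟩ ⟨baseE_inRange hv, trivial, hb⟩⟩

/-- The weights of the tree of a clause. -/
def treeWord (k n : ℕ) (φ : Clause) : List Symb :=
  (List.range (treeSize k)).flatMap fun v => natTokens (weight k n φ v)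

/-- The number of light children of the root. -/
def lightE : Expr := .add (.mul (.const 2) (.var 0)) (.const 2)

/-- Write the weights of the tree of a clause. -/
def writeTree (v : ℕ) (i a b j c e : Expr) : Stm :=
  .seq (writeScaled (.const 0) (.mul (.var 3) baseE)) <|
  .seq (.loop lightE writeOne) <|
  .seq (writeLiterals i a b) <|
  .seq (writeLiterals j c e) <|
  .seq (.loop lightE (writeRow (v + 1) (.var v) (.var v))) <|
  .seq (writeRow v lightE (.add (.mul (.const 2) i) (.const 1))) <|
  .seq (writeRow v (.add lightE (.const 1)) (.mul (.const 2) i)) <|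
  .seq (writeRow v (.add lightE (.const 2)) (.add (.mul (.const 2) j) (.const 1))) <|
  .seq (writeRow v (.add lightE (.const 3)) (.mul (.const 2) j)) <|
  .loop (.var 4) (.loop slotsE (writeRow (v + 2) (.var (v + 1)) (.var (v + 1))))

/-- The weights of the children of a vertex, one of them not being forced. -/
def rowWord (k n j' l : ℕ) : List Symb := (List.range (slots k)).flatMap fun j =>
  natTokens (if j = j' ∨ j = l then 1 else 2 ^ j * base k n)

/-- The numbering goes level by level: the root, its children, the block of all grandchildren of the
root, and `width k` further blocks of size `slots k * slots k`. The grandparent is not the root in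
these further blocks, so lightness only means equal slots and the blocks are identical. -/
theorem treeWord_eq (φ : Clause) : treeWord k n φ =
    natTokens (scale k * base k n) ++ (((List.range (2 * k + 2)).flatMap fun _ => natTokens 1) ++
    ((natTokens (heavy k n (2 * φ.i + 1) φ.a) ++ natTokens (heavy k n (2 * φ.i) φ.b)) ++
    ((natTokens (heavy k n (2 * φ.j + 1) φ.c) ++ natTokens (heavy k n (2 * φ.j) φ.e)) ++
    (((List.range (2 * k + 2)).flatMap fun j' => rowWord k n j' j') ++
    (rowWord k n (2 * k + 2) (2 * φ.i + 1) ++ (rowWord k n (2 * k + 2 + 1) (2 * φ.i) ++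
    (rowWord k n (2 * k + 2 + 2) (2 * φ.j + 1) ++ (rowWord k n (2 * k + 2 + 3) (2 * φ.j) ++
    (List.range (width k)).flatMap fun _ => (List.range (slots k)).flatMap fun j' =>
      rowWord k n j' j')))))))) := by
  have hd : slots k = 2 * k + 2 + 1 + 1 + 1 + 1 := rfl
  have hroot : weight k n φ 0 = scale k * base k n := rfl
  have hchild : ((List.range (slots k)).flatMap fun j => natTokens (weight k n φ (1 + j))) =
      ((List.range (2 * k + 2)).flatMap fun _ => natTokens 1) ++
      ((natTokens (heavy k n (2 * φ.i + 1) φ.a) ++ natTokens (heavy k n (2 * φ.i) φ.b)) ++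
      (natTokens (heavy k n (2 * φ.j + 1) φ.c) ++ natTokens (heavy k n (2 * φ.j) φ.e))) := by
    have h1 : ∀ j < 2 * k + 2, weight k n φ (1 + j) = 1 := fun j hj => by
      rw [Nat.add_comm, weight_child (by omega), if_pos (by omega)]
    have h2 : ∀ m < 4, weight k n φ (1 + (2 * k + 2 + m)) = heavy k n (φ.color m) (φ.thresh m) :=
      fun m hm => by
        rw [Nat.add_comm, weight_child (by omega), if_neg (by omega),
          show 2 * k + 2 + m + 4 - slots k = m by omega]
    rw [hd]
    rw [flatMap_range_add, flatMap_range_add, flatMap_range_add, flatMap_range_add]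
    rw [flatMap_range_congr (n := 2 * k + 2) (g := fun _ => natTokens 1)
      fun j hj => by rw [h1 j hj]]
    simp only [flatMap_range_one, Nat.add_zero, Nat.add_assoc, Nat.reduceAdd]
    have a0 := h2 0 (by omega)
    have a1 := h2 1 (by omega)
    have a2 := h2 2 (by omega)
    have a3 := h2 3 (by omega)
    simp only [Nat.add_zero, Nat.add_assoc] at a0 a1 a2 a3
    rw [a0, a1, a2, a3]
    simp only [List.append_assoc]
    rfl
  have hrow : ∀ p, ∀ j' < slots k, ∀ l, (∀ j, Light k φ p j' j ↔ j = j' ∨ j = l) →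
      ((List.range (slots k)).flatMap fun j => natTokens (weight k n φ
        (1 + slots k + ((p * slots k + j') * slots k + j)))) = rowWord k n j' l :=
    fun p j' hj' l hl => by
      refine flatMap_range_congr fun j hj => ?_
      rw [show 1 + slots k + ((p * slots k + j') * slots k + j) =
        (p * slots k + j' + 1) * slots k + j + 1 by ring, weight_grandchild hj' hj]
      simp only [hl]
  have hfirst : ((List.range (slots k)).flatMap fun j' => (List.range (slots k)).flatMap fun j =>
      natTokens (weight k n φ (1 + slots k + ((0 * slots k + j') * slots k + j)))) =
      ((List.range (2 * k + 2)).flatMap fun j' => rowWord k n j' j') ++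
      (rowWord k n (2 * k + 2) (2 * φ.i + 1) ++ (rowWord k n (2 * k + 2 + 1) (2 * φ.i) ++
      (rowWord k n (2 * k + 2 + 2) (2 * φ.j + 1) ++ rowWord k n (2 * k + 2 + 3) (2 * φ.j)))) := by
    have hl : ∀ m < 4, ∀ j, Light k φ 0 (2 * k + 2 + m) j ↔
        j = 2 * k + 2 + m ∨ j = φ.color m := fun m hm j => by
      have e : 2 * k + 2 + m + 4 - slots k = m := by omega
      rw [Light, e]
      have : slots k ≤ 2 * k + 2 + m + 4 := by omega
      simp [this]
    have h0 : ∀ j' < 2 * k + 2, ∀ j, Light k φ 0 j' j ↔ j = j' ∨ j = j' := fun j' hj' j => by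
      rw [Light]
      have : ¬ slots k ≤ j' + 4 := by omega
      simp [this]
    rw [flatMap_range_congr (n := slots k) (g := fun j' => if j' < 2 * k + 2 then rowWord k n j' j'
      else rowWord k n j' (φ.color (j' - (2 * k + 2)))) fun j' hj' => ?_]
    · rw [hd]
      rw [flatMap_range_add, flatMap_range_add, flatMap_range_add, flatMap_range_add]
      rw [flatMap_range_congr (n := 2 * k + 2) (g := fun j' => rowWord k n j' j')
        fun j' hj' => if_pos hj']
      simp [Nat.add_assoc, Clause.color]
    · split_ifs with h
      · exact hrow 0 j' hj' j' (h0 j' h)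
      · obtain ⟨m, rfl⟩ := Nat.exists_eq_add_of_le (not_lt.1 h)
        rw [Nat.add_sub_cancel_left]
        exact hrow 0 _ hj' _ (hl m (by omega))
  rw [treeWord, treeSize, flatMap_range_add, flatMap_range_add, flatMap_range_one, hroot, hchild,
    flatMap_range_mul (1 + width k), flatMap_range_add 1 (width k), flatMap_range_one]
  have e : ∀ p, ((List.range (slots k * slots k)).flatMap fun q =>
      natTokens (weight k n φ (1 + slots k + (p * (slots k * slots k) + q)))) =
      (List.range (slots k)).flatMap fun j' => (List.range (slots k)).flatMap fun j =>
        natTokens (weight k n φ (1 + slots k + ((p * slots k + j') * slots k + j))) := fun p => by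
    rw [flatMap_range_mul]
    refine flatMap_range_congr fun j' _ => flatMap_range_congr fun j _ => ?_
    rw [show p * (slots k * slots k) + (j' * slots k + j) = (p * slots k + j') * slots k + j by ring]
  rw [e, hfirst, flatMap_range_congr (n := width k) fun p _ => (e (1 + p)).trans
    (flatMap_range_congr fun j' hj' => hrow (1 + p) j' hj' j' fun j => by
      rw [Light]; simp)]
  simp only [List.append_assoc]

theorem Params.light (h : Params k n ρ) : lightE.eval ρ = 2 * k + 2 := by
  simp only [lightE, Expr.eval, h.h0]

theorem lightE_inRange (hv : 5 ≤ v) : lightE.InRange v :=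
  ⟨⟨trivial, by change 0 < v; omega⟩, trivial⟩

theorem out_writeTree {i a b j c e : Expr} (h : Params k n ρ) (hv : 5 ≤ v) (hi : i.InRange v)
    (hj : j.InRange v) : (writeTree v i a b j c e).out v ρ =
      treeWord k n ⟨i.eval ρ, a.eval ρ, b.eval ρ, j.eval ρ, c.eval ρ, e.eval ρ⟩ := by
  have hb := base_pos (k := k) (n := n)
  have hQ : 0 < scale k := by unfold scale; positivity
  have hL := lightE_inRange hv
  have hL' : ∀ m, (Expr.add lightE (.const m)).InRange v := fun _ => ⟨hL, trivial⟩
  have h2 : ∀ {i : Expr}, i.InRange v → (Expr.mul (.const 2) i).InRange v := fun h => ⟨trivial, h⟩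
  have h3 : ∀ {i : Expr}, i.InRange v → (Expr.add i (.const 1)).InRange v := fun h => ⟨h, trivial⟩
  have hvar : ∀ v, (Expr.var v).InRange (v + 1) := Nat.lt_succ_self
  rw [treeWord_eq, writeTree]
  simp only [Stm.out]
  rw [out_writeScaled (by simp only [Expr.eval, h.base, h.h3]; positivity), out_writeLiterals h,
    out_writeLiterals h, h.light, out_writeRow h hv hL (h3 (h2 hi)),
    out_writeRow h hv (hL' 1) (h2 hi), out_writeRow h hv (hL' 2) (h3 (h2 hj)),
    out_writeRow h hv (hL' 3) (h2 hj)]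
  rw [flatMap_range_congr (n := 2 * k + 2)
    (f := fun x => (writeRow (v + 1) (.var v) (.var v)).out (v + 1) (update ρ v x))
    (g := fun j' => rowWord k n j' j') fun x _ => by
      refine (out_writeRow (h.update hv x) (by omega) (hvar v) (hvar v)).trans ?_
      simp only [Expr.eval, Function.update_self]
      rfl]
  rw [flatMap_range_congr (n := (Expr.var 4).eval ρ) (g := fun _ =>
    (List.range (slots k)).flatMap fun j' => rowWord k n j' j') fun p _ => by
      rw [(h.update hv p).slots]
      refine flatMap_range_congr fun x _ => ?_
      refine (out_writeRow ((h.update hv p).update (by omega) x) (by omega) (hvar _)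
        (hvar _)).trans ?_
      simp only [Expr.eval, Function.update_self]
      rfl]
  simp only [Expr.eval, h.light, h.base, h.h3, h.h4, pow_zero, one_mul, out_writeOne]
  rfl

theorem writeTree_inRange {i a b j c e : Expr} (hv : 5 ≤ v) (hi : i.InRange v) (ha : a.InRange v)
    (hb : b.InRange v) (hj : j.InRange v) (hc : c.InRange v) (he : e.InRange v) :
    (writeTree v i a b j c e).InRange v := by
  have hL := lightE_inRange hv
  refine ⟨writeScaled_inRange trivial ⟨by change 3 < v; omega, baseE_inRange hv⟩,
    ⟨hL, trivial⟩, writeLiterals_inRange hv hi ha hb, writeLiterals_inRange hv hj hc he,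
    ⟨hL, writeRow_inRange (by omega) (Nat.lt_succ_self v) (Nat.lt_succ_self v)⟩,
    writeRow_inRange hv hL ⟨⟨trivial, hi⟩, trivial⟩,
    writeRow_inRange hv ⟨hL, trivial⟩ ⟨trivial, hi⟩,
    writeRow_inRange hv ⟨hL, trivial⟩ ⟨⟨trivial, hj⟩, trivial⟩,
    writeRow_inRange hv ⟨hL, trivial⟩ ⟨trivial, hj⟩,
    by change 4 < v; omega, slotsE_inRange (by omega),
    writeRow_inRange (by omega) (Nat.lt_succ_self _) (Nat.lt_succ_self _)⟩

/-- The number of vertices of a tree. -/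
def treeSizeE : Expr :=
  .add (.add (.const 1) slotsE) (.mul (.add (.const 1) (.var 4)) (.mul slotsE slotsE))

/-- The number of clauses, where the variable `2` is twice the number of edges. -/
def numClausesE : Expr :=
  .add (.add (.add (.mul (.add (.var 0) (.const 1)) (.add (.var 1) (.const 1))) (.var 0))
    (.mul (.var 0) (.mul (.var 0) (.var 1)))) (.mul (.var 2) (.mul (.var 0) (.var 0)))

/-- The bound of the instance. -/
def boundE : Expr :=
  .add (.mul (.sub (.mul (.const 16) (.var 3)) (.const 1)) baseE)
    (.add (.mul (.sub (.var 3) (.const 1)) (.var 1)) (.const 2))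

/-- The number of internal vertices of a tree. -/
def innerE : Expr := .add (.const 1) (.mul (.add (.const 1) (.var 4)) slotsE)

/-- Write a number in unary. -/
def writeUnary (e : Expr) : Stm := .loop e (.emit [tally])

theorem out_writeUnary (e : Expr) : (writeUnary e).out v ρ = tl (e.eval ρ) := by
  simp only [writeUnary, Stm.out, flatMap_range_const]

/-- Write the trees of the clauses that do not depend on edges. -/
def writeClauses : Stm :=
  .seq (.loop (.add (.var 0) (.const 1)) (.loop (.add (.var 1) (.const 1))
    (writeTree 7 (.var 5) (.var 6) (.sub (.add (.var 1) (.const 1)) (.var 6))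
      (.var 5) (.var 6) (.sub (.add (.var 1) (.const 1)) (.var 6))))) <|
  .seq (.loop (.var 0) (writeTree 6 (.var 5) (.const 1) (.add (.var 1) (.const 1))
    (.var 5) (.const 1) (.add (.var 1) (.const 1)))) <|
  .loop (.var 0) (.loop (.var 0) (.loop (.var 1) (writeTree 8
    (.var 5) (.mul (.add (.var 7) (.const 2)) (.neq (.var 5) (.var 6)))
      (.mul (.sub (.var 1) (.var 7)) (.neq (.var 5) (.var 6)))
    (.var 6) (.mul (.add (.var 7) (.const 2)) (.neq (.var 5) (.var 6)))
      (.mul (.sub (.var 1) (.var 7)) (.neq (.var 5) (.var 6))))))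

/-- Write the trees of the clauses of the edge between the variables `5` and `6`. -/
def writeEdgeClauses : Stm :=
  .loop (.var 0) (.loop (.var 0) (.seq
    (writeTree 9 (.var 7) (.add (.var 5) (.const 2)) (.sub (.var 1) (.var 5))
      (.var 8) (.add (.var 6) (.const 2)) (.sub (.var 1) (.var 6)))
    (writeTree 9 (.var 7) (.add (.var 6) (.const 2)) (.sub (.var 1) (.var 6))
      (.var 8) (.add (.var 5) (.const 2)) (.sub (.var 1) (.var 5)))))

/-- Write the parameter, the number of vertices, the bound and the first weights. -/
def writeHeader : Stm :=
  .seq (.loop treeSizeE (.emit [none])) <|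
  .seq (writeUnary (.mul numClausesE treeSizeE)) <|
  .seq (.emit [mark]) <|
  .seq (writeScaled (.const 0) boundE) writeClauses

/-- Write the edges of the forest. -/
def writeEdges : Stm :=
  .loop numClausesE (.loop innerE (.loop slotsE (
    .seq (writeUnary (.add (.mul (.var 5) treeSizeE) (.var 6))) <|
    .seq (.emit [mark]) <|
    .seq (writeUnary (.add (.mul (.var 5) treeSizeE)
      (.add (.add (.mul (.var 6) slotsE) (.var 7)) (.const 1)))) <|
    .emit [mark])))

theorem writeHeader_inRange : writeHeader.InRange 5 := by
  refine ⟨⟨?_, trivial⟩, ⟨?_, trivial⟩, trivial, writeScaled_inRange trivial ?_,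
    ⟨?_, ?_, writeTree_inRange (by decide) ?_ ?_ ?_ ?_ ?_ ?_⟩,
    ⟨?_, writeTree_inRange (by decide) ?_ ?_ ?_ ?_ ?_ ?_⟩,
    ⟨?_, ?_, ?_, writeTree_inRange (by decide) ?_ ?_ ?_ ?_ ?_ ?_⟩⟩ <;>
  simp [Expr.InRange, treeSizeE, numClausesE, slotsE, boundE, baseE, Expr.neq, Expr.dist]

theorem writeEdgeClauses_inRange : writeEdgeClauses.InRange 7 := by
  refine ⟨?_, ?_, writeTree_inRange (by decide) ?_ ?_ ?_ ?_ ?_ ?_,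
    writeTree_inRange (by decide) ?_ ?_ ?_ ?_ ?_ ?_⟩ <;>
  simp [Expr.InRange]

theorem writeEdges_inRange : writeEdges.InRange 5 := by
  refine ⟨?_, ?_, ?_, ⟨?_, trivial⟩, trivial, ⟨?_, trivial⟩, trivial⟩ <;>
  simp [Expr.InRange, treeSizeE, numClausesE, slotsE, innerE]

theorem Params.treeSize (h : Params k n ρ) : treeSizeE.eval ρ = treeSize k := by
  simp only [treeSizeE, Expr.eval, h.slots, h.h4, Gadget.treeSize]

theorem Params.bound (h : Params k n ρ) : boundE.eval ρ = bound k n := by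
  simp only [boundE, Expr.eval, h.base, h.h1, h.h3, Gadget.bound]

theorem Params.inner (h : Params k n ρ) : innerE.eval ρ = inner k := by
  simp only [innerE, Expr.eval, h.slots, h.h4, Gadget.inner]

theorem Params.numClauses (h : Params k n ρ) {E : List (ℕ × ℕ)} (h2 : ρ 2 = 2 * E.length) :
    numClausesE.eval ρ = (clauses k n E).length := by
  simp only [numClausesE, Expr.eval, h.h0, h.h1, h2, length_clauses]

/-- A word composed of words for the clauses. -/
theorem flatMap_clauses (E : List (ℕ × ℕ)) (f : Clause → List Symb) :
    (clauses k n E).flatMap f =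
      ((List.range (k + 1)).flatMap fun i => (List.range (n + 1)).flatMap fun u =>
        f ⟨i, u, n + 1 - u, i, u, n + 1 - u⟩) ++
      (((List.range k).flatMap fun i => f ⟨i, 1, n + 1, i, 1, n + 1⟩) ++
      (((List.range k).flatMap fun i => (List.range k).flatMap fun j =>
        (List.range n).flatMap fun x =>
        f ⟨i, (x + 2) * neq i j, (n - x) * neq i j, j, (x + 2) * neq i j, (n - x) * neq i j⟩) ++
      E.flatMap fun e => (List.range k).flatMap fun i => (List.range k).flatMap fun j =>
        f ⟨i, e.1 + 2, n - e.1, j, e.2 + 2, n - e.2⟩ ++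
        f ⟨i, e.2 + 2, n - e.2, j, e.1 + 2, n - e.1⟩)) := by
  simp only [clauses, List.flatMap_append, List.flatMap_assoc, List.flatMap_cons,
    List.flatMap_nil, List.append_nil, List.append_assoc]

theorem out_writeClauses (h : Params k n ρ) : writeClauses.out 5 ρ =
      ((List.range (k + 1)).flatMap fun i => (List.range (n + 1)).flatMap fun u =>
        treeWord k n ⟨i, u, n + 1 - u, i, u, n + 1 - u⟩) ++
      (((List.range k).flatMap fun i => treeWord k n ⟨i, 1, n + 1, i, 1, n + 1⟩) ++
      ((List.range k).flatMap fun i => (List.range k).flatMap fun j =>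
        (List.range n).flatMap fun x => treeWord k n
        ⟨i, (x + 2) * neq i j, (n - x) * neq i j, j, (x + 2) * neq i j, (n - x) * neq i j⟩)) := by
  have e0 := h.h0
  have e1 := h.h1
  rw [writeClauses]
  simp only [Stm.out]
  refine congrArg₂ (· ++ ·) ?_ (congrArg₂ (· ++ ·) ?_ ?_)
  · simp only [Expr.eval, e0]
    refine flatMap_range_congr fun i _ => ?_
    have hi := h.update (i := 5) le_rfl i
    rw [hi.h1]
    refine flatMap_range_congr fun u _ => ?_
    have hu := hi.update (i := 6) (by decide) u
    refine (out_writeTree hu (by decide) (by simp [Expr.InRange]) (by simp [Expr.InRange])).trans ?_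
    simp [Expr.eval, e1]
  · simp only [Expr.eval, e0]
    refine flatMap_range_congr fun i _ => ?_
    have hi := h.update (i := 5) le_rfl i
    refine (out_writeTree hi (by decide) (by simp [Expr.InRange]) (by simp [Expr.InRange])).trans ?_
    simp [Expr.eval, e1]
  · simp only [Expr.eval, e0]
    refine flatMap_range_congr fun i _ => ?_
    have hi := h.update (i := 5) le_rfl i
    rw [hi.h0]
    refine flatMap_range_congr fun j _ => ?_
    have hj := hi.update (i := 6) (by decide) j
    rw [hj.h1]
    refine flatMap_range_congr fun x _ => ?_
    have hx := hj.update (i := 7) (by decide) x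
    refine (out_writeTree hx (by decide) (by simp [Expr.InRange]) (by simp [Expr.InRange])).trans ?_
    simp [Expr.eval_neq, Expr.eval, e1]

theorem out_writeEdgeClauses (h : Params k n ρ) : writeEdgeClauses.out 7 ρ =
    (List.range k).flatMap fun i => (List.range k).flatMap fun j =>
      treeWord k n ⟨i, ρ 5 + 2, n - ρ 5, j, ρ 6 + 2, n - ρ 6⟩ ++
      treeWord k n ⟨i, ρ 6 + 2, n - ρ 6, j, ρ 5 + 2, n - ρ 5⟩ := by
  have e1 := h.h1
  rw [writeEdgeClauses]
  simp only [Stm.out, Expr.eval, h.h0]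
  refine flatMap_range_congr fun i _ => ?_
  have hi := h.update (i := 7) (by decide) i
  rw [hi.h0]
  refine flatMap_range_congr fun j _ => ?_
  have hj := hi.update (i := 8) (by decide) j
  refine congrArg₂ (· ++ ·) ?_ ?_
  · refine (out_writeTree hj (by decide) (by simp [Expr.InRange]) (by simp [Expr.InRange])).trans ?_
    simp [Expr.eval, e1]
  · refine (out_writeTree hj (by decide) (by simp [Expr.InRange]) (by simp [Expr.InRange])).trans ?_
    simp [Expr.eval, e1]

theorem out_writeEdges (h : Params k n ρ) {E : List (ℕ × ℕ)} (h2 : ρ 2 = 2 * E.length) :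
    writeEdges.out 5 ρ = pairsWord (copyEdges k (clauses k n E).length) := by
  rw [writeEdges, pairsWord, copyEdges]
  simp only [Stm.out, h.numClauses h2, List.flatMap_assoc, List.flatMap_singleton]
  refine flatMap_range_congr fun c _ => ?_
  have hc := h.update (i := 5) le_rfl c
  rw [hc.inner]
  refine flatMap_range_congr fun p _ => ?_
  have hp := hc.update (i := 6) (by decide) p
  rw [hp.slots]
  refine flatMap_range_congr fun j _ => ?_
  have hj := hp.update (i := 7) (by decide) j
  simp only [out_writeUnary, Expr.eval, hj.treeSize, hj.slots]
  simp

theorem params_env (k n m : ℕ) : Params k n (env k n m (scale k) (width k)) := ⟨rfl, rfl, rfl, rfl⟩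

theorem bound_pos : 0 < bound k n := by unfold bound; omega

/-- The output of the program is the word of the instance of Weighted Coloring. -/
theorem out_eq (k n : ℕ) (E : List (ℕ × ℕ)) (ρ : ℕ → ℕ)
    (hρ : ρ = env k n (2 * E.length) (scale k) (width k)) :
    writeHeader.out 5 ρ ++ (E.flatMap fun e =>
        writeEdgeClauses.out 7 (update (update ρ 5 e.1) 6 e.2)) ++ writeEdges.out 5 ρ =
      List.replicate (treeSize k) none ++ (tl ((clauses k n E).length * treeSize k) ++ mark ::
        (natTokens (bound k n) ++ ((clauses k n E).flatMap (treeWord k n) ++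
          pairsWord (copyEdges k (clauses k n E).length)))) := by
  have h : Params k n ρ := hρ ▸ params_env k n _
  have h2 : ρ 2 = 2 * E.length := hρ ▸ rfl
  have hB : ∀ e : ℕ × ℕ, writeEdgeClauses.out 7 (update (update ρ 5 e.1) 6 e.2) =
      (List.range k).flatMap fun i => (List.range k).flatMap fun j =>
        treeWord k n ⟨i, e.1 + 2, n - e.1, j, e.2 + 2, n - e.2⟩ ++
        treeWord k n ⟨i, e.2 + 2, n - e.2, j, e.1 + 2, n - e.1⟩ := fun e => by
    rw [out_writeEdgeClauses ((h.update le_rfl e.1).update (by decide) e.2)]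
    simp
  simp only [hB]
  rw [out_writeEdges h h2, flatMap_clauses, writeHeader]
  simp only [Stm.out]
  rw [out_writeScaled (by rw [h.bound]; exact bound_pos), out_writeUnary, out_writeClauses h,
    h.treeSize, h.bound, flatMap_range_const]
  simp only [Expr.eval, h.numClauses h2, h.treeSize, pow_zero, one_mul, List.append_assoc,
    List.cons_append, List.nil_append]

/-! ### The words of the two instances over the stack alphabet. -/

theorem encodeTokens_append (L M : List (List Bool)) :
    encodeTokens (L ++ M) = encodeTokens L ++ encodeTokens M := List.flatMap_append

theorem encodeTokens_cons (a : List Bool) (L : List (List Bool)) :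
    encodeTokens (a :: L) = a.map some ++ none :: encodeTokens L := by
  simp [encodeTokens]

theorem map_unary (n : ℕ) : ((unary n).map some).map some = tl n := by
  simp [unary]

theorem map_ratTokens (w : ℕ) : (encodeTokens (ratTokens (w : ℚ≥0))).map some = natTokens w := by
  rw [ratTokens, NNRat.num_natCast, NNRat.den_natCast, encodeTokens_cons, encodeTokens_cons,
    natTokens, binWord]
  have : Computability.encodeNat 1 = [true] := rfl
  rw [this]
  simp [encodeTokens]

theorem map_flatMap_ratTokens (L : List ℕ) :
    (encodeTokens ((L.map fun w : ℕ => (w : ℚ≥0)).flatMap ratTokens)).map some =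
      L.flatMap natTokens := by
  induction L with
  | nil => rfl
  | cons a L ih =>
    rw [List.map_cons, List.flatMap_cons, encodeTokens_append, List.map_append, ih, map_ratTokens,
      List.flatMap_cons]

theorem map_edgeTokens {N : ℕ} (E : List (Fin N × Fin N)) :
    (encodeTokens (edgeTokens E)).map some =
      pairsWord (E.map fun e => (e.1.val, e.2.val)) := by
  induction E with
  | nil => rfl
  | cons e E ih =>
    have h1 : edgeTokens (e :: E) = [unary e.1, unary e.2] ++ edgeTokens E := rfl
    have h2 : encodeTokens [unary e.1, unary e.2] =
      (unary e.1).map some ++ none :: ((unary e.2).map some ++ [none]) := by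
      simp [encodeTokens]
    rw [h1, encodeTokens_append, List.map_append, ih, h2]
    simp only [List.map_append, List.map_cons, map_unary, pairsWord, List.flatMap_cons,
      List.map_nil]

theorem forestData_edges_map (C : ℕ) :
    ((forestData k C).edges.map fun e => (e.1.val, e.2.val)) = copyEdges k C := by
  have : ∀ (l : List (ℕ × ℕ)) (h : ∀ e ∈ l, Parent k C e.1 e.2),
      ((l.pmap (fun e h => ((⟨e.1, h.lt.trans h.right_lt⟩, ⟨e.2, h.right_lt⟩) :
        Fin (C * treeSize k) × Fin (C * treeSize k))) h).map fun e => (e.1.val, e.2.val)) = l := by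
    intro l h
    rw [List.map_pmap]
    simp
  exact this _ _

theorem word_instanceOf (I : GraphData × ℕ) :
    @Eq (List Symb) (weightedForestColoringProblem.word (instanceOf I))
      (List.replicate (treeSize I.2) none ++
        (tl ((clauses I.2 I.1.n (pairs I.1)).length * treeSize I.2) ++ mark ::
        (natTokens (bound I.2 I.1.n) ++ ((clauses I.2 I.1.n (pairs I.1)).flatMap
          (treeWord I.2 I.1.n) ++
          pairsWord (copyEdges I.2 (clauses I.2 I.1.n (pairs I.1)).length))))) := by
  obtain ⟨D, k⟩ := I
  set C := (clauses k D.n (pairs D)).length with hC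
  have h1 : (encodeTokens ((List.ofFn fun v : Fin (C * treeSize k) =>
      ((vertexWeight k D.n (pairs D) v : ℕ) : ℚ≥0)).flatMap ratTokens)).map some =
      (clauses k D.n (pairs D)).flatMap (treeWord k D.n) := by
    rw [ofFn_eq_map_range (C * treeSize k) fun v => ((vertexWeight k D.n (pairs D) v : ℕ) : ℚ≥0),
      ← flatMap_range_getD (clauses k D.n (pairs D)) ⟨0, 0, 0, 0, 0, 0⟩ (treeWord k D.n), ← hC]
    have := map_flatMap_ratTokens ((List.range (C * treeSize k)).map (vertexWeight k D.n (pairs D)))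
    rw [List.map_map] at this
    refine this.trans ?_
    rw [List.flatMap_map, flatMap_range_mul]
    refine flatMap_range_congr fun c _ => flatMap_range_congr fun v hv => ?_
    rw [vertexWeight, vert_div hv, vert_mod hv]
    rfl
  have h2 := map_edgeTokens (forestData k C).edges
  rw [forestData_edges_map] at h2
  have h3 : largestComponentSize (forestData k C).graph = treeSize k :=
    largestComponentSize_forestData (length_clauses_pos _)
  change (List.replicate (largestComponentSize (forestData k C).graph) (none : Symb) ++
    (encodeTokens (unary (C * treeSize k) :: (ratTokens ((bound k D.n : ℕ) : ℚ≥0) ++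
      ((List.ofFn fun v : Fin (C * treeSize k) =>
      ((vertexWeight k D.n (pairs D) v : ℕ) : ℚ≥0)).flatMap ratTokens ++
      edgeTokens (forestData k C).edges)))).map some : List Symb) = _
  rw [h3, encodeTokens_cons, encodeTokens_append, encodeTokens_append, List.map_append,
    List.map_cons, List.map_append, List.map_append, h1, h2, map_ratTokens, map_unary]

theorem word_independentSet (I : GraphData × ℕ) : @Eq (List Symb) (independentSetProblem.word I)
    (List.replicate I.2 none ++ tl I.1.n ++ mark :: pairsWord (pairs I.1)) := by
  change (List.replicate I.2 (none : Symb) ++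
    (encodeTokens (unary I.1.n :: edgeTokens I.1.edges)).map some : List Symb) = _
  rw [encodeTokens_cons, List.map_append, List.map_cons, map_unary, map_edgeTokens,
    List.append_assoc]
  rfl

/-! ### Computability of the bounds and the running time. -/

theorem length_le_pairsWord (E : List (ℕ × ℕ)) : 2 * E.length ≤ (pairsWord E).length :=
  (count_pairsWord E).symm.le.trans List.count_le_length

theorem scale_le_width (k : ℕ) : scale k ≤ width k :=
  Nat.pow_le_pow_right (by decide) (by unfold slots; nlinarith)

theorem primrec_slots : Primrec slots :=
  Primrec.nat_add.comp (Primrec.nat_mul.comp (Primrec.const 2) Primrec.id) (Primrec.const 6)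

theorem primrec_pow : Primrec₂ ((· ^ ·) : ℕ → ℕ → ℕ) := Primrec₂.unpaired'.1 Nat.Primrec.pow

theorem primrec_width : Primrec width :=
  primrec_pow.comp (Primrec.const 2)
    (Primrec.nat_mul.comp primrec_slots (Primrec.nat_add.comp primrec_slots (Primrec.const 2)))

theorem primrec_treeSize : Primrec treeSize :=
  Primrec.nat_add.comp (Primrec.nat_add.comp (Primrec.const 1) primrec_slots)
    (Primrec.nat_mul.comp (Primrec.nat_add.comp (Primrec.const 1) primrec_width)
      (Primrec.nat_mul.comp primrec_slots primrec_slots))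

theorem param_instanceOf (I : GraphData × ℕ) :
    weightedForestColoringProblem.param (instanceOf I) = treeSize I.2 := by
  change largestComponentSize
    (forestData I.2 (clauses I.2 I.1.n (pairs I.1)).length).graph = treeSize I.2
  exact largestComponentSize_forestData (length_clauses_pos _)

theorem yes_iff (I : GraphData × ℕ) :
    independentSetProblem.Yes I ↔ weightedForestColoringProblem.Yes (instanceOf I) :=
  ⟨yes_of_indepSet I, indepSet_of_yes I⟩

/-- The program of the reduction. -/
def reduction : Cmd :=
  driver lightE (.mul slotsE (.add slotsE (.const 2))) writeHeader writeEdgeClauses writeEdges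

/-- The driver is used with `X = width k * |I|`, which is above all of its variables: `k`, `n` and
the number of end marks are at most `|I|`, while `scale k` and `width k` are at most `width k`. The
power `X ^ K` separates into a function of `k` and a power of `|I|`. -/
theorem exists_exec_reduction : ∃ K, ∀ I : GraphData × ℕ, ∃ N,
    N + 1 ≤ width I.2 ^ K * independentSetProblem.size I ^ K ∧
    Exec reduction (single 0 (independentSetProblem.word I))
      (single 2 (weightedForestColoringProblem.word (instanceOf I))) N := by
  obtain ⟨K, hK⟩ := runs_driver (eQ := lightE)
    (eP := .mul slotsE (.add slotsE (.const 2))) (H := writeHeader) (B := writeEdgeClauses)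
    (T := writeEdges) (by simp [lightE, Expr.InRange]) (by simp [slotsE, Expr.InRange])
    writeHeader_inRange writeEdgeClauses_inRange writeEdges_inRange
  refine ⟨K, fun I => ?_⟩
  have hw := word_independentSet I
  have hl : independentSetProblem.size I = I.2 + I.1.n + (1 + (pairsWord (pairs I.1)).length) :=
    (congrArg List.length hw).trans (show (List.replicate I.2 (none : Symb) ++ tl I.1.n ++
      mark :: pairsWord (pairs I.1)).length = _ by simp; omega)
  have hE := length_le_pairsWord (pairs I.1)
  set S := independentSetProblem.size I
  have hw2 : 2 ≤ width I.2 := by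
    calc 2 = 2 ^ 1 := rfl
      _ ≤ _ := Nat.pow_le_pow_right (by decide) (by unfold slots; nlinarith)
  have hS : ∀ x ≤ S, x ≤ width I.2 * S := fun x hx =>
    hx.trans (Nat.le_mul_of_pos_left _ (by omega))
  have hW : ∀ x ≤ width I.2, x ≤ width I.2 * S := fun x hx =>
    hx.trans (Nat.le_mul_of_pos_right _ (by omega))
  obtain ⟨N, hN, h⟩ := hK (width I.2 * S) I.2 I.1.n (2 * (pairs I.1).length) (scale I.2)
    (width I.2) (pairs I.1) (hW _ hw2) (hS _ (by omega)) (hS _ (by omega)) (hS _ (by omega))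
    (hW _ (scale_le_width _)) (hW _ le_rfl) (fun e he => by
      have := pairs_bounds I.1 e he
      exact ⟨hS _ (by omega), hS _ (by omega)⟩) rfl rfl rfl
  rw [out_eq _ _ _ _ rfl] at h
  refine ⟨N, by rwa [← Nat.mul_pow], ?_⟩
  rw [hw, word_instanceOf]
  exact h

end Gadget

theorem theorem1 : weightedForestColoringProblem.IsW1Hard := by
  obtain ⟨K, hK⟩ := Gadget.exists_exec_reduction
  obtain ⟨L, hL⟩ := Gadget.reduction.exists_below
  refine ⟨Gadget.instanceOf, fun k => Gadget.width k ^ K, Gadget.treeSize, K,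
    Gadget.reduction.computer L, ?_, Gadget.primrec_treeSize.to_comp, Gadget.yes_iff,
    fun I => (Gadget.param_instanceOf I).le, fun I => ?_⟩
  · exact (Gadget.primrec_pow.comp Gadget.primrec_width (Primrec.const K)).to_comp
  · obtain ⟨N, hN, h⟩ := hK I
    exact Cmd.computer_outputs hL h hN
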